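/- Let $n\ge 0$ and $N\ge 1$ be integers, let $h>0$ and $T=Nh$, let $x_0,\xi_0\in\mathbb R^n$, and let $f,g:\mathbb R^n\times\mathbb R^n\to\mathbb R^n$ be bounded functions of class $C^1$. Consider the delayed impulsive system $$\text{(DIS)}\quad dx(t)=f(x(t),x(t-h))\,dt+g(x(t),x(t-h))\,d\mu(t),\quad t\in[0,T],\qquad x(0)=x_0,\quad x(t)=\xi_0\ \text{ for } t\in[-h,0).$$ **Impulsive controls.** An impulsive control $(\mu,\{w^r\}_{r\in[0,h]})$ consists of a finite non-negative Borel measure $\mu$ on $[0,T]$ and of measurable functions $w^r=(w^r_1,\dots,w^r_N):[0,1]\to[0,\infty)^N$, $r\in[0,h]$, such that 1. for every $r\in[0,h]$, $\sum_{i=1}^N w^r_i(s)=\sum_{i=1}^N\int_0^1 w^r_i(s')\,ds'$ for a.e. $s\in[0,1]$; 2. for every $r\in(0,h)$ and $i=1,\dots,N$, $\int_0^1 w^r_i(s)\,ds=\mu(\{r+(i-1)h\})$; 3. for every $i=0,\dots,N$, $\int_0^1[w^h_i(s)+w^0_{i+1}(s)]\,ds=\mu(\{ih\})$, where $w^h_0\equiv0$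 and $w^0_{N+1}\equiv0$. **Extended processes.** An extended process $(x,\mu,\{w^r\}_{r\in[0,h]})$ consists of a function $x:[-h,T]\to\mathbb R^n$ of bounded variation and an impulsive control $(\mu,\{w^r\}_{r\in[0,h]})$ for which there are absolutely continuous functions $\zeta^r_i:[0,1]\to\mathbb R^n$, $r\in[0,h]$, $i=1,\dots,N$, with the following properties. Put $\zeta^r_0(s)=\xi_0$ if $s\in[0,1)$ or $r\in[0,h)$, and $\zeta^h_0(1)=x_0$; let $x^-(t)$ be the left limit of $x$ at $t$ and $\mu^c$ the continuous (atomless) component of $\mu$. Then, for all $r\in[0,h]$ and $i=1,\dots,N$, $$\frac{d}{ds}\zeta^r_i(s)=w^r_i(s)\,g(\zeta^r_i(s),\zeta^r_{i-1}(s))\ \text{ for a.e. } s\in[0,1],\qquad \zeta^r_i(0)=\begin{cases}x^-(r+(i-1)h)& r\in(0,h],\\ \zeta^h_{i-1}(1)& r=0,\end{cases}$$ and $x(t)=\xi_0$ for $t\in[-h,0)$, $x(0)=x_0$, $x((i-1)h)=\zeta^0_i(1)$ for $1<i\le N$, $x(T)=\zeta^h_N(1)$, and, for $i=1,\dots,N$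 and $t\in((i-1)h,ih)$, $$x(t)=\zeta^0_i(1)+\int_{(i-1)h}^t f(x(t'),x(t'-h))\,dt'+\int_{[(i-1)h,t]}g(x(t'),x(t'-h))\,d\mu^c(t')+\sum_{r\in(0,t-(i-1)h]}\bigl(\zeta^r_i(1)-x^-(r+(i-1)h)\bigr),$$ the (possibly uncountable) sum being unconditionally convergent. **Reparameterized processes.** A reparameterized process $(S,\{y_i\},\{\alpha_i\})$ consists of a number $S>0$, functions $\alpha_1,\dots,\alpha_N\in L^\infty(0,S)$, absolutely continuous functions $y_1,\dots,y_N:[0,S]\to\mathbb R^n$, and the function $y_0$ given by $y_0(s)=\xi_0$ for $s\in[0,S)$, $y_0(S)=x_0$, such that for a.e. $s\in[0,S]$ and all $i=1,\dots,N$ $$\dot y_i(s)=\Bigl(1-\sum_{j=1}^N\alpha_j(s)\Bigr)f(y_i(s),y_{i-1}(s))+\alpha_i(s)\,g(y_i(s),y_{i-1}(s)),\qquad \alpha_i(s)\ge0,\qquad \sum_{j=1}^N\alpha_j(s)\le1,$$ $y_{i+1}(0)=y_i(S)$ for $i=0,\dots,N-1$, and $\int_0^S\bigl(1-\sum_{i=1}^N\alpha_i(s)\bigr)\,ds=h$.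 **Theorem.** With $\|\mu\|_{TV}=\mu([0,T])$, the following statements hold. (A) For every reparameterized process $(S,\{y_i\},\{\alpha_i\})$ there is an extended process $(x,\mu,\{w^r\}_{r\in[0,h]})$ such that $x(T)=y_N(S)$ and $$\|\mu\|_{TV}=\sum_{i=1}^N\int_0^S\alpha_i(s)\,ds.\tag{1}$$ (B) For every extended process $(x,\mu,\{w^r\}_{r\in[0,h]})$ there is a reparameterized process $(S,\{y_i\},\{\alpha_i\})$ such that $y_N(S)=x(T)$ and (1) holds. -/

import Mathlib

open MeasureTheory Set

/-- The state space `ℝⁿ`. -/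
abbrev Vec (n : ℕ) : Type := EuclideanSpace ℝ (Fin n)

/-- The data of the delayed impulsive system
`dx(t) = f(x(t), x(t-h)) dt + g(x(t), x(t-h)) dμ(t)`, `t ∈ [0,T]`,
`x(0) = x₀`, `x(t) = ξ₀` for `t ∈ [-h,0[`. No law is imposed here: the standing assumptions on
the data are hypotheses of the theorem. -/
structure DIS (n : ℕ) where
  f : Vec n × Vec n → Vec n
  g : Vec n × Vec n → Vec n
  x₀ : Vec n
  ξ₀ : Vec n
  h : ℝ
  T : ℝ
  N : ℕ

namespace DIS

variable {n : ℕ}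

/-- `μ` belongs to `C^⊕(0,T)`: it is a finite non-negative Borel measure on `[0,T]`, represented
as a measure on `ℝ` that vanishes outside `[0,T]`. -/
structure IsMeasureOn (T : ℝ) (μ : Measure ℝ) : Prop where
  finite : IsFiniteMeasure μ
  supp : μ (Icc 0 T)ᶜ = 0

/-- Total variation (that is, total mass) on `[0,T]` of a non-negative measure. -/
noncomputable def totalVariation (T : ℝ) (μ : Measure ℝ) : ℝ := μ.real (Icc 0 T)

/-- The continuous (that is, atomless) component `μᶜ` of a finite measure on `ℝ`: the part of `μ`
carried by the complement of the (countable) set of atoms. -/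
noncomputable def continuousPart (μ : Measure ℝ) : Measure ℝ := μ.restrict {t | μ {t} = 0}

/-- Impulsive controls `(μ, {w^r}_{r ∈ [0,h]})`. Here `w r i s` stands for `w^r_i(s)`, and only the
values for `r ∈ [0,h]`, `1 ≤ i ≤ N`, `s ∈ [0,1]` are used. The two conditionals in `atom_mesh`
implement the conventions `w^h_0 ≡ 0` and `w^0_{N+1} ≡ 0`. -/
structure IsImpulsiveControl (D : DIS n) (μ : Measure ℝ) (w : ℝ → ℕ → ℝ → ℝ) : Prop where
  measure : IsMeasureOn D.T μ
  measurable : ∀ r ∈ Icc 0 D.h, ∀ i ∈ Finset.Icc 1 D.N,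
    AEMeasurable (w r i) (volume.restrict (Icc 0 1))
  nonneg : ∀ r ∈ Icc 0 D.h, ∀ i ∈ Finset.Icc 1 D.N, ∀ s ∈ Icc (0 : ℝ) 1, 0 ≤ w r i s
  sum_eq : ∀ r ∈ Icc 0 D.h, ∀ᵐ s ∂(volume.restrict (Icc (0 : ℝ) 1)),
    ∑ i ∈ Finset.Icc 1 D.N, w r i s = ∑ i ∈ Finset.Icc 1 D.N, ∫ s' in (0 : ℝ)..1, w r i s'
  atom_interior : ∀ r ∈ Ioo 0 D.h, ∀ i ∈ Finset.Icc 1 D.N,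
    ∫ s in (0 : ℝ)..1, w r i s = μ.real {r + ((i : ℝ) - 1) * D.h}
  atom_mesh : ∀ i ∈ Finset.Icc 0 D.N,
    (if i = 0 then 0 else ∫ s in (0 : ℝ)..1, w D.h i s)
      + (if i = D.N then 0 else ∫ s in (0 : ℝ)..1, w 0 (i + 1) s)
      = μ.real {(i : ℝ) * D.h}

/-- The functions `ζ^r_i : [0,1] → ℝⁿ` (written `ζ r i s`), `r ∈ [0,h]`, `0 ≤ i ≤ N`, describing
the jumps of `x`: for `i ≥ 1` they are the absolutely continuous solutions of the coupled
differential equations `dζ^r_i/ds = w^r_i g(ζ^r_i, ζ^r_{i-1})` with the prescribed initial values;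
`x⁻` is the left limit of `x`. -/
structure IsJumpFamily (D : DIS n) (x : ℝ → Vec n) (w : ℝ → ℕ → ℝ → ℝ)
    (ζ : ℝ → ℕ → ℝ → Vec n) : Prop where
  zero : ∀ r ∈ Icc 0 D.h, ∀ s ∈ Icc (0 : ℝ) 1, s ≠ 1 ∨ r ≠ D.h → ζ r 0 s = D.ξ₀
  zero_end : ζ D.h 0 1 = D.x₀
  absCont : ∀ r ∈ Icc 0 D.h, ∀ i ∈ Finset.Icc 1 D.N, AbsolutelyContinuousOnInterval (ζ r i) 0 1
  ode : ∀ r ∈ Icc 0 D.h, ∀ i ∈ Finset.Icc 1 D.N, ∀ᵐ s ∂(volume.restrict (Icc (0 : ℝ) 1)),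
    HasDerivAt (ζ r i) (w r i s • D.g (ζ r i s, ζ r (i - 1) s)) s
  init : ∀ r ∈ Ioc 0 D.h, ∀ i ∈ Finset.Icc 1 D.N,
    ζ r i 0 = Function.leftLim x (r + ((i : ℝ) - 1) * D.h)
  init_zero : ∀ i ∈ Finset.Icc 1 D.N, ζ 0 i 0 = ζ D.h (i - 1) 1

/-- The conditions that a trajectory `x` has to satisfy for a given family `ζ`. The sum over
`r ∈ ]0, t - (i-1)h]` is an unconditional sum, whose convergence is part of the requirement. -/
structure IsTrajectory (D : DIS n) (x : ℝ → Vec n) (μ : Measure ℝ)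
    (ζ : ℝ → ℕ → ℝ → Vec n) : Prop where
  history : ∀ t ∈ Ico (-D.h) 0, x t = D.ξ₀
  at_zero : x 0 = D.x₀
  at_mesh : ∀ i ∈ Finset.Icc 2 D.N, x (((i : ℝ) - 1) * D.h) = ζ 0 i 1
  at_end : x D.T = ζ D.h D.N 1
  summable : ∀ i ∈ Finset.Icc 1 D.N, ∀ t ∈ Ioo (((i : ℝ) - 1) * D.h) ((i : ℝ) * D.h),
    Summable (fun r : Ioc 0 (t - ((i : ℝ) - 1) * D.h) =>
      ζ r i 1 - Function.leftLim x (r + ((i : ℝ) - 1) * D.h))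
  interior : ∀ i ∈ Finset.Icc 1 D.N, ∀ t ∈ Ioo (((i : ℝ) - 1) * D.h) ((i : ℝ) * D.h),
    x t = ζ 0 i 1
      + (∫ t' in (((i : ℝ) - 1) * D.h)..t, D.f (x t', x (t' - D.h)))
      + (∫ t' in Icc (((i : ℝ) - 1) * D.h) t, D.g (x t', x (t' - D.h)) ∂(continuousPart μ))
      + ∑' r : Ioc 0 (t - ((i : ℝ) - 1) * D.h),
          (ζ r i 1 - Function.leftLim x (r + ((i : ℝ) - 1) * D.h))

/-- Extended processes `(x, μ, {w^r}_{r ∈ [0,h]})`. Only the values of `x` on `[-h,T]` are used. -/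
structure IsExtended (D : DIS n) (x : ℝ → Vec n) (μ : Measure ℝ)
    (w : ℝ → ℕ → ℝ → ℝ) : Prop where
  bv : BoundedVariationOn x (Icc (-D.h) D.T)
  control : D.IsImpulsiveControl μ w
  trajectory : ∃ ζ : ℝ → ℕ → ℝ → Vec n, D.IsJumpFamily x w ζ ∧ D.IsTrajectory x μ ζ

/-- Reparameterized processes `(S, {y_i}, {α_i})`, with `y_i` for `0 ≤ i ≤ N` and `α_i` for
`1 ≤ i ≤ N`. The functions `y_1, …, y_N` are absolutely continuous; `y_0` is the prescribed
function, which jumps at `S` when `x₀ ≠ ξ₀`. -/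
structure IsReparameterized (D : DIS n) (S : ℝ) (y : ℕ → ℝ → Vec n)
    (α : ℕ → ℝ → ℝ) : Prop where
  pos : 0 < S
  memLinfty : ∀ i ∈ Finset.Icc 1 D.N, MemLp (α i) ⊤ (volume.restrict (Icc 0 S))
  absCont : ∀ i ∈ Finset.Icc 1 D.N, AbsolutelyContinuousOnInterval (y i) 0 S
  ode : ∀ i ∈ Finset.Icc 1 D.N, ∀ᵐ s ∂(volume.restrict (Icc 0 S)),
    HasDerivAt (y i)
      ((1 - ∑ j ∈ Finset.Icc 1 D.N, α j s) • D.f (y i s, y (i - 1) s)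
        + α i s • D.g (y i s, y (i - 1) s)) s
  nonneg : ∀ i ∈ Finset.Icc 1 D.N, ∀ᵐ s ∂(volume.restrict (Icc 0 S)), 0 ≤ α i s
  sum_le : ∀ᵐ s ∂(volume.restrict (Icc 0 S)), ∑ i ∈ Finset.Icc 1 D.N, α i s ≤ 1
  y_zero : ∀ s ∈ Ico 0 S, y 0 s = D.ξ₀
  y_zero_end : y 0 S = D.x₀
  link : ∀ i ∈ Finset.range D.N, y (i + 1) 0 = y i S
  time : ∫ s in (0 : ℝ)..S, (1 - ∑ i ∈ Finset.Icc 1 D.N, α i s) = D.h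

end DIS

/-!
The two kinds of processes are related by a change of time. Given a reparameterized process, the
clock `φ(s) = ∫₀ˢ (1 - Σ αⱼ)` is a nondecreasing map of `[0, S]` onto `[0, h]`, and a point of the
`i`-th slot `[(i - 1) h, i h]` is written `r + (i - 1) h` with `r ∈ [0, h]`. The fibres of `φ` are
intervals `[entryTime r, exitTime r]`; at most countably many of them are nondegenerate, and these
*plateaus* are the times of the impulses. The two sides correspond as follows:

* `x (r + (i - 1) h) = yᵢ (exitTime r)` for `r ∈ (0, h)`, so that the left limit of `x` there is
  `yᵢ (entryTime r)` (`IsTimeChange.leftLim_eq`);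
* on the slot, `μ` is the image of `αᵢ ds` under `φ + (i - 1) h`, while Lebesgue measure is the
  image of `(1 - Σ αⱼ) ds`;
* `w^r_i` and `ζ^r_i` are `αᵢ` and `yᵢ` on the plateau at height `r`, rescaled to `[0, 1]`.

Under this dictionary the integrated differential equation for `yᵢ` is the formula for `x`. Both
directions rest on `DIS.hasSum_jumps`, a consequence of a fact about image measures
(`hasSum_setIntegral_fiber`): the integral of a function that factors through `φ` off the fibres of
positive mass is an integral against the atomless part of the image measure plus the sum of the
integrals over those fibres.

From a reparameterized process (`DIS.IsReparameterized.exists_isExtended`) the extended process is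
read off from the dictionary. In the converse direction
(`DIS.IsExtended.exists_isReparameterized`) the time change has to be built: all the impulses, moved
to `[0, h]`, and Lebesgue measure add up to a finite measure `ν` (`DIS.parameterMeasure`), and `φ` is
the generalized inverse of its distribution function. It is `1`-Lipschitz because `ν` dominates
Lebesgue measure, and it carries Lebesgue measure on `[0, ν [0, h]]` to `ν`
(`map_inverseDistribution`). Off the plateaus `αᵢ` is the Radon-Nikodym density of the impulses of
the `i`-th slot with respect to `ν`, and on the plateaus it is `w^r_i`, rescaled.
-/

open scoped Topology ENNReal
open Filter (Tendsto)

/-! ### Functions of bounded variation and absolutely continuous functions -/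

/-- A function of bounded variation on an open interval has limits at its ends, so any values there
keep the variation bounded. -/
theorem BoundedVariationOn.Icc_of_Ioo {E : Type*} [PseudoMetricSpace E] [CompleteSpace E]
    {f : ℝ → E} {a b : ℝ} (hab : a < b) (h : BoundedVariationOn f (Ioo a b)) :
    BoundedVariationOn f (Icc a b) := by
  have h1 : BoundedVariationOn f (Ioc a b) := by
    obtain ⟨l, hl⟩ := h.exists_tendsto_left b
    have e1 : Ioc a b ∩ Iio b = Ioo a b := by ext; simp; grind
    have e2 : Ioc a b ∩ Iic b = Ioc a b := by ext; simp
    have e3 : Ioo a b ∩ Iio b = Ioo a b := by ext; simp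
    have key := eVariationOn.eVariationOn_on_inter_Iic_eq_Iio_add_edist (f := f) (s := Ioc a b)
      (a := b) (l := l)
      (by rw [e1]; exact mem_closure_iff_nhdsWithin_neBot.1
            (by rw [closure_Ioo hab.ne]; exact right_mem_Icc.2 hab.le))
      (right_mem_Ioc.2 hab) (by rwa [e1, ← e3])
    rw [e1, e2] at key
    rw [BoundedVariationOn, key]
    exact ENNReal.add_ne_top.2 ⟨h, edist_ne_top _ _⟩
  obtain ⟨l, hl⟩ := h1.exists_tendsto_right a
  have e1 : Icc a b ∩ Ioi a = Ioc a b := by ext; simp; grind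
  have e2 : Icc a b ∩ Ici a = Icc a b := by ext; simp; grind
  have e3 : Ioc a b ∩ Ioi a = Ioc a b := by ext; simp
  have key := eVariationOn.eVariationOn_on_inter_Ici_eq_Ioi_add_edist (f := f) (s := Icc a b)
    (a := a) (l := l)
    (by rw [e1]; exact mem_closure_iff_nhdsWithin_neBot.1
          (by rw [closure_Ioc hab.ne]; exact left_mem_Icc.2 hab.le))
    (left_mem_Icc.2 hab.le) (by rwa [e1, ← e3])
  rw [e1, e2] at key
  rw [BoundedVariationOn, key]
  exact ENNReal.add_ne_top.2 ⟨h1, edist_ne_top _ _⟩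

/-- A function of bounded variation is Borel on its interval: coordinatewise it is a difference of
monotone functions. -/
theorem BoundedVariationOn.exists_measurable_eqOn {n : ℕ} {x : ℝ → Vec n} {a b : ℝ}
    (h : BoundedVariationOn x (Icc a b)) : ∃ x' : ℝ → Vec n, Measurable x' ∧ EqOn x' x (Icc a b) := by
  rcases lt_or_ge b a with hab | hab
  · exact ⟨fun _ => 0, measurable_const, by simp [Icc_eq_empty_of_lt hab]⟩
  have hm : ∀ p : ℝ → ℝ, MonotoneOn p (Icc a b) → ∃ p', Monotone p' ∧ EqOn p p' (Icc a b) := by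
    intro p hp
    refine hp.exists_monotone_extension ?_ ?_
    · exact ⟨p a, by rintro _ ⟨t, ht, rfl⟩; exact hp (left_mem_Icc.2 hab) ht ht.1⟩
    · exact ⟨p b, by rintro _ ⟨t, ht, rfl⟩; exact hp ht (right_mem_Icc.2 hab) ht.2⟩
  have hc : ∀ k : Fin n, ∃ c : ℝ → ℝ, Measurable c ∧ EqOn c (fun t => x t k) (Icc a b) := by
    intro k
    have hlip : LipschitzWith 1 (fun v : Vec n => v k) :=
      LipschitzWith.of_dist_le_mul fun u v => by
        simpa [dist_eq_norm] using PiLp.norm_apply_le (u - v) k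
    obtain ⟨p, q, hp, hq, hpq⟩ :=
      (hlip.comp_boundedVariationOn h).locallyBoundedVariationOn.exists_monotoneOn_sub_monotoneOn
    obtain ⟨p', hp', hpe⟩ := hm p hp
    obtain ⟨q', hq', hqe⟩ := hm q hq
    refine ⟨p' - q', hp'.measurable.sub hq'.measurable, fun t ht => ?_⟩
    have := congrFun hpq t
    simp only [Function.comp, Pi.sub_apply] at this ⊢
    rw [this, hpe ht, hqe ht]
  choose c hc hce using hc
  refine ⟨fun t => WithLp.toLp 2 fun k => c k t, ?_, fun t ht => ?_⟩
  · exact (WithLp.measurable_toLp 2 _).comp (measurable_pi_lambda _ hc)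
  · ext k
    exact hce k ht

theorem AbsolutelyContinuousOnInterval.of_dist_le {X Y : Type*} [PseudoMetricSpace X]
    [PseudoMetricSpace Y] {f : ℝ → X} {g : ℝ → Y} {a b : ℝ}
    (hg : AbsolutelyContinuousOnInterval g a b)
    (h : ∀ s ∈ uIcc a b, ∀ t ∈ uIcc a b, dist (f s) (f t) ≤ dist (g s) (g t)) :
    AbsolutelyContinuousOnInterval f a b := by
  rw [absolutelyContinuousOnInterval_iff] at hg ⊢
  intro ε hε
  obtain ⟨δ, hδ, H⟩ := hg ε hε
  refine ⟨δ, hδ, fun E hE hlt => (Finset.sum_le_sum fun i hi => ?_).trans_lt (H E hE hlt)⟩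
  have := hE.1 i hi
  exact h _ this.1 _ this.2

section integral

variable {E : Type*} [NormedAddCommGroup E] [NormedSpace ℝ E]

theorem IntervalIntegrable.absolutelyContinuousOnInterval_integral {f : ℝ → E} {a b : ℝ}
    (hf : IntervalIntegrable f volume a b) :
    AbsolutelyContinuousOnInterval (fun x => ∫ v in a..x, f v) a b := by
  refine (hf.norm.absolutelyContinuousOnInterval_intervalIntegral
    (c := a) left_mem_uIcc).of_dist_le fun s hs t ht => ?_
  have hi : ∀ u ∈ uIcc a b, IntervalIntegrable f volume a u := fun u hu =>
    hf.mono_set (uIcc_subset_uIcc_left hu)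
  rw [dist_eq_norm, Real.dist_eq, intervalIntegral.integral_interval_sub_left (hi s hs) (hi t ht),
    intervalIntegral.integral_interval_sub_left (hi s hs).norm (hi t ht).norm]
  exact intervalIntegral.norm_integral_le_abs_integral_norm

/-- Fundamental theorem of calculus for vector-valued absolutely continuous functions with an
integrable almost everywhere derivative. -/
theorem AbsolutelyContinuousOnInterval.integral_eq_sub_of_ae_hasDerivAt [CompleteSpace E]
    {f f' : ℝ → E} {a b : ℝ} (hf : AbsolutelyContinuousOnInterval f a b)
    (hd : ∀ᵐ s, s ∈ uIcc a b → HasDerivAt f (f' s) s) (hi : IntervalIntegrable f' volume a b) :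
    ∫ s in a..b, f' s = f b - f a := by
  obtain ⟨C, hC⟩ := (hf.sub hi.absolutelyContinuousOnInterval_integral).const_of_ae_hasDerivAt_zero
    (by
      filter_upwards [hd, hi.ae_hasDerivAt_integral] with s h1 h2 h3
      simpa using! (h1 h3).sub (h2 h3 a left_mem_uIcc))
  have h1 := hC a left_mem_uIcc
  have h2 := hC b right_mem_uIcc
  simp only [Pi.sub_apply, intervalIntegral.integral_same, sub_zero] at h1 h2
  rw [h1, ← h2]; abel

end integral

/-! ### Integration over the fibres of a map; time changes and their plateaus -/

theorem MeasureTheory.Measure.countable_atoms (κ : Measure ℝ) [SFinite κ] :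
    {t | κ {t} ≠ 0}.Countable := by
  have := Measure.countable_meas_pos_of_disjoint_iUnion (μ := κ) (As := fun t : ℝ => {t})
    (fun t => measurableSet_singleton t) (fun s t hst => by simpa using hst)
  simpa [pos_iff_ne_zero] using this

theorem MeasureTheory.Measure.measurableSet_nonatoms (κ : Measure ℝ) [SFinite κ] :
    MeasurableSet {t | κ {t} = 0} := by
  have := κ.countable_atoms.measurableSet.compl
  convert this using 1
  ext t; simp

/-- If `Y = X ∘ φ` away from the fibres of `φ` of positive mass, then integrating `Y` over `φ⁻¹ B`
amounts to integrating `X` over `B` against the atomless part of the image measure, plus summing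
the integrals of `Y` over the fibres. The sum is over all points of `B`, but only the countably
many atoms of the image measure contribute. -/
theorem hasSum_setIntegral_fiber {E : Type*} [NormedAddCommGroup E] [NormedSpace ℝ E]
    {A : Type*} [MeasurableSpace A] {m : Measure A} [IsFiniteMeasure m]
    {φ : A → ℝ} (hφ : Measurable φ) {Y : A → E} (hY : Integrable Y m) {X : ℝ → E}
    (hX : AEStronglyMeasurable X (m.map φ)) {B : Set ℝ} (hB : MeasurableSet B)
    (hXY : ∀ᵐ s ∂m, φ s ∈ B → m.map φ {φ s} = 0 → Y s = X (φ s)) :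
    HasSum (fun r : B => ∫ s in φ ⁻¹' {(r : ℝ)}, Y s ∂m)
      ((∫ s in φ ⁻¹' B, Y s ∂m) - ∫ t in B ∩ {t | m.map φ {t} = 0}, X t ∂(m.map φ)) := by
  have : IsFiniteMeasure (m.map φ) := Measure.isFiniteMeasure_map m φ
  set κ := m.map φ with hκ
  set C := {t | κ {t} ≠ 0} with hC
  have hCc : C.Countable := κ.countable_atoms
  have hN : MeasurableSet {t | κ {t} = 0} := κ.measurableSet_nonatoms
  have hBC : (B ∩ C).Countable := hCc.mono inter_subset_right
  have : Countable ↥(B ∩ C) := hBC.to_subtype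
  have h1 : HasSum (fun r : ↥(B ∩ C) => ∫ s in φ ⁻¹' {(r : ℝ)}, Y s ∂m)
      (∫ s in ⋃ r : ↥(B ∩ C), φ ⁻¹' {(r : ℝ)}, Y s ∂m) :=
    hasSum_integral_iUnion (fun r => hφ (measurableSet_singleton _))
      (fun r r' hrr => Disjoint.preimage _ (by simpa using fun h => hrr (Subtype.ext h)))
      hY.integrableOn
  have h2 : (⋃ r : ↥(B ∩ C), φ ⁻¹' {(r : ℝ)}) = φ ⁻¹' (B ∩ C) := by
    ext s; simp
  have h3 : ∫ s in φ ⁻¹' (B ∩ {t | κ {t} = 0}), Y s ∂m = ∫ t in B ∩ {t | κ {t} = 0}, X t ∂κ := by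
    rw [hκ, setIntegral_map (by rw [← hκ]; exact hB.inter hN) hX hφ.aemeasurable, ← hκ]
    refine setIntegral_congr_ae (hφ (hB.inter hN)) ?_
    filter_upwards [hXY] with s hs hs2 using hs hs2.1 hs2.2
  have h4 : ∫ s in φ ⁻¹' B, Y s ∂m
      = (∫ s in φ ⁻¹' (B ∩ C), Y s ∂m) + ∫ s in φ ⁻¹' (B ∩ {t | κ {t} = 0}), Y s ∂m := by
    rw [← setIntegral_union _ (hφ (hB.inter hN)) hY.integrableOn hY.integrableOn, ← preimage_union,
      ← inter_union_distrib_left]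
    · congr 3
      ext t; simp [hC, em']
    · refine Disjoint.preimage _ (Set.disjoint_left.2 fun t h h' => h.2 h'.2)
  rw [h4, h3, add_sub_cancel_right, ← h2]
  refine (hasSum_subtype_iff_indicator (f := fun r => ∫ s in φ ⁻¹' {r}, Y s ∂m)).2 ?_
  have h5 := (hasSum_subtype_iff_indicator (f := fun r => ∫ s in φ ⁻¹' {r}, Y s ∂m)).1 h1
  convert h5 using 1
  ext r
  by_cases hr : r ∈ C
  · by_cases hrB : r ∈ B <;> simp [hr, hrB, indicator]
  · have h0 : m (φ ⁻¹' {r}) = 0 := by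
      rw [← Measure.map_apply hφ (measurableSet_singleton r)]
      simpa [hC] using hr
    have : ∫ s in φ ⁻¹' {r}, Y s ∂m = 0 := setIntegral_measure_zero _ h0
    simp [indicator, this]

/-- A nondecreasing continuous time change of `[0, S]` onto `[0, h]`. -/
structure IsTimeChange (S h : ℝ) (φ : ℝ → ℝ) : Prop where
  pos : 0 < S
  cont : Continuous φ
  mono : Monotone φ
  map_zero : φ 0 = 0
  map_top : φ S = h

/-- The first time at which the time change `φ` of `[0, S]` reaches the value `r`. -/
noncomputable def entryTime (S : ℝ) (φ : ℝ → ℝ) (r : ℝ) : ℝ := sInf (Icc 0 S ∩ φ ⁻¹' {r})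

/-- The last time at which the time change `φ` of `[0, S]` takes the value `r`. -/
noncomputable def exitTime (S : ℝ) (φ : ℝ → ℝ) (r : ℝ) : ℝ := sSup (Icc 0 S ∩ φ ⁻¹' {r})

namespace IsTimeChange

variable {S h : ℝ} {φ : ℝ → ℝ} {r r' s : ℝ}

theorem mapsTo (H : IsTimeChange S h φ) (hs : s ∈ Icc 0 S) : φ s ∈ Icc 0 h :=
  ⟨H.map_zero ▸ H.mono hs.1, H.map_top ▸ H.mono hs.2⟩

theorem fiber_nonempty (H : IsTimeChange S h φ) (hr : r ∈ Icc 0 h) :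
    (Icc 0 S ∩ φ ⁻¹' {r}).Nonempty := by
  have := intermediate_value_Icc H.pos.le H.cont.continuousOn
  rw [H.map_zero, H.map_top] at this
  obtain ⟨s, hs, rfl⟩ := this hr
  exact ⟨s, hs, rfl⟩

theorem fiber_compact (H : IsTimeChange S h φ) (r : ℝ) : IsCompact (Icc 0 S ∩ φ ⁻¹' {r}) :=
  isCompact_Icc.inter_right (isClosed_singleton.preimage H.cont)

theorem entryTime_mem (H : IsTimeChange S h φ) (hr : r ∈ Icc 0 h) :
    entryTime S φ r ∈ Icc 0 S ∩ φ ⁻¹' {r} := (H.fiber_compact r).sInf_mem (H.fiber_nonempty hr)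

theorem exitTime_mem (H : IsTimeChange S h φ) (hr : r ∈ Icc 0 h) :
    exitTime S φ r ∈ Icc 0 S ∩ φ ⁻¹' {r} := (H.fiber_compact r).sSup_mem (H.fiber_nonempty hr)

theorem apply_entryTime (H : IsTimeChange S h φ) (hr : r ∈ Icc 0 h) : φ (entryTime S φ r) = r :=
  (H.entryTime_mem hr).2

theorem apply_exitTime (H : IsTimeChange S h φ) (hr : r ∈ Icc 0 h) : φ (exitTime S φ r) = r :=
  (H.exitTime_mem hr).2

theorem le_exitTime_iff (H : IsTimeChange S h φ) (hr : r ∈ Icc 0 h) (hs : s ∈ Icc 0 S) :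
    s ≤ exitTime S φ r ↔ φ s ≤ r := by
  refine ⟨fun hle => H.apply_exitTime hr ▸ H.mono hle, fun hle => ?_⟩
  by_contra! hlt
  have h1 : φ s = r := le_antisymm hle (H.apply_exitTime hr ▸ H.mono hlt.le)
  exact hlt.not_ge (le_csSup (H.fiber_compact r).bddAbove ⟨hs, h1⟩)

theorem entryTime_le_iff (H : IsTimeChange S h φ) (hr : r ∈ Icc 0 h) (hs : s ∈ Icc 0 S) :
    entryTime S φ r ≤ s ↔ r ≤ φ s := by
  refine ⟨fun hle => H.apply_entryTime hr ▸ H.mono hle, fun hle => ?_⟩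
  by_contra! hlt
  have h1 : φ s = r := le_antisymm (H.apply_entryTime hr ▸ H.mono hlt.le) hle
  exact hlt.not_ge (csInf_le (H.fiber_compact r).bddBelow ⟨hs, h1⟩)

theorem entryTime_le_exitTime (H : IsTimeChange S h φ) (hr : r ∈ Icc 0 h) :
    entryTime S φ r ≤ exitTime S φ r :=
  (H.entryTime_le_iff hr (H.exitTime_mem hr).1).2 (H.apply_exitTime hr).ge

theorem fiber_eq (H : IsTimeChange S h φ) (hr : r ∈ Icc 0 h) :
    Icc 0 S ∩ φ ⁻¹' {r} = Icc (entryTime S φ r) (exitTime S φ r) := by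
  ext s
  constructor
  · rintro ⟨hs, rfl⟩
    exact ⟨(H.entryTime_le_iff hr hs).2 le_rfl, (H.le_exitTime_iff hr hs).2 le_rfl⟩
  · rintro ⟨h1, h2⟩
    have hs : s ∈ Icc 0 S := ⟨(H.entryTime_mem hr).1.1.trans h1, h2.trans (H.exitTime_mem hr).1.2⟩
    exact ⟨hs, le_antisymm ((H.le_exitTime_iff hr hs).1 h2) ((H.entryTime_le_iff hr hs).1 h1)⟩

theorem exitTime_lt_entryTime (H : IsTimeChange S h φ) (hr : r ∈ Icc 0 h) (hr' : r' ∈ Icc 0 h)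
    (hlt : r < r') : exitTime S φ r < entryTime S φ r' := by
  by_contra! hle
  have := H.mono hle
  rw [H.apply_entryTime hr', H.apply_exitTime hr] at this
  exact hlt.not_ge this

theorem exitTime_monotoneOn (H : IsTimeChange S h φ) : MonotoneOn (exitTime S φ) (Icc 0 h) :=
  fun _ hr _ hr' hle => (H.le_exitTime_iff hr' (H.exitTime_mem hr).1).2 ((H.apply_exitTime hr).le.trans hle)

theorem nonneg (H : IsTimeChange S h φ) : 0 ≤ h := H.map_zero ▸ H.map_top ▸ H.mono H.pos.le

theorem entryTime_zero (H : IsTimeChange S h φ) : entryTime S φ 0 = 0 :=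
  le_antisymm ((H.entryTime_le_iff ⟨le_rfl, H.nonneg⟩ ⟨le_rfl, H.pos.le⟩).2 H.map_zero.ge)
    (H.entryTime_mem ⟨le_rfl, H.nonneg⟩).1.1

theorem exitTime_top (H : IsTimeChange S h φ) : exitTime S φ h = S :=
  le_antisymm (H.exitTime_mem ⟨H.nonneg, le_rfl⟩).1.2
    ((H.le_exitTime_iff ⟨H.nonneg, le_rfl⟩ ⟨H.pos.le, le_rfl⟩).2 H.map_top.le)

theorem tendsto_exitTime (H : IsTimeChange S h φ) (hr : r ∈ Ioc 0 h) :
    Tendsto (exitTime S φ) (𝓝[<] r) (𝓝 (entryTime S φ r)) := by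
  have hrI : r ∈ Icc 0 h := Ioc_subset_Icc_self hr
  rw [tendsto_order]
  constructor
  · intro s hs
    have hm : max (φ (max s 0)) 0 < r := by
      refine max_lt ?_ hr.1
      by_contra! hle
      have h0 : (0 : ℝ) < entryTime S φ r := by
        by_contra! h0
        have := H.mono h0
        rw [H.apply_entryTime hrI, H.map_zero] at this
        exact this.not_gt hr.1
      have hlt : max s 0 < entryTime S φ r := max_lt hs h0
      exact hlt.not_ge ((H.entryTime_le_iff hrI
        ⟨le_max_right _ _, hlt.le.trans (H.entryTime_mem hrI).1.2⟩).2 hle)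
    filter_upwards [Ioo_mem_nhdsLT hm] with r' hr'
    have hI : r' ∈ Icc 0 h := ⟨(le_max_right _ _).trans hr'.1.le, hr'.2.le.trans hr.2⟩
    by_contra! hle
    have h1 := H.mono (hle.trans (le_max_left s 0))
    rw [H.apply_exitTime hI] at h1
    exact (h1.trans (le_max_left _ _)).not_gt hr'.1
  · intro s hs
    filter_upwards [Ioo_mem_nhdsLT hr.1] with r' hr'
    exact (H.exitTime_lt_entryTime ⟨hr'.1.le, hr'.2.le.trans hr.2⟩ hrI hr'.2).trans hs

theorem countable_plateaus (H : IsTimeChange S h φ) :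
    {r ∈ Icc 0 h | entryTime S φ r < exitTime S φ r}.Countable := by
  set P := {r ∈ Icc 0 h | entryTime S φ r < exitTime S φ r}
  have hinj : InjOn (entryTime S φ) P := fun r hr r' hr' he => by
    rw [← H.apply_entryTime hr.1, he, H.apply_entryTime hr'.1]
  refine countable_of_injective_of_countable_image hinj ?_
  refine Set.PairwiseDisjoint.countable_of_Ioo (y := fun s => exitTime S φ (φ s)) ?_ ?_
  · rintro _ ⟨r, hr, rfl⟩ _ ⟨r', hr', rfl⟩ hne
    refine Set.disjoint_left.2 fun s hs hs' => hne ?_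
    simp only [H.apply_entryTime hr.1, H.apply_entryTime hr'.1] at hs hs'
    have h1 := (H.fiber_eq hr.1).ge (Ioo_subset_Icc_self hs)
    have h2 := (H.fiber_eq hr'.1).ge (Ioo_subset_Icc_self hs')
    rw [← h1.2, ← h2.2]
  · rintro _ ⟨r, hr, rfl⟩
    simpa only [H.apply_entryTime hr.1] using hr.2

end IsTimeChange

/-! ### The time change formula -/

theorem DIS.continuousPart_singleton (μ : Measure ℝ) [SFinite μ] (t : ℝ) :
    DIS.continuousPart μ {t} = 0 := by
  rw [DIS.continuousPart, Measure.restrict_apply (measurableSet_singleton t)]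
  by_cases h : μ {t} = 0
  · exact measure_mono_null inter_subset_left h
  · have : {t} ∩ {t | μ {t} = 0} = (∅ : Set ℝ) := by
      ext u; simp only [mem_inter_iff, mem_singleton_iff, mem_ofPred_eq, mem_empty_iff_false,
        iff_false]
      rintro ⟨rfl, h'⟩; exact h h'
    rw [this, measure_empty]

/-- The measure `α ds` on `[0, S]`. -/
noncomputable def densityMeasure (S : ℝ) (α : ℝ → ℝ) : Measure ℝ :=
  (volume.restrict (Icc 0 S)).withDensity fun s => ENNReal.ofReal (α s)

section densityMeasure

variable {E : Type*} [NormedAddCommGroup E] [NormedSpace ℝ E] {S : ℝ} {α : ℝ → ℝ}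

theorem densityMeasure_absolutelyContinuous :
    densityMeasure S α ≪ volume.restrict (Icc 0 S) := withDensity_absolutelyContinuous _ _

theorem isFiniteMeasure_densityMeasure (hα : IntegrableOn α (Icc 0 S)) :
    IsFiniteMeasure (densityMeasure S α) :=
  isFiniteMeasure_withDensity_ofReal hα.2

theorem setIntegral_densityMeasure (hα : IntegrableOn α (Icc 0 S))
    (hα0 : ∀ᵐ s ∂volume.restrict (Icc 0 S), 0 ≤ α s) (Y : ℝ → E) {A : Set ℝ}
    (hA : MeasurableSet A) :
    ∫ s in A, Y s ∂densityMeasure S α = ∫ s in A ∩ Icc 0 S, α s • Y s := by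
  rw [densityMeasure, setIntegral_withDensity_eq_setIntegral_toReal_smul₀ _ _ _ hA,
    Measure.restrict_restrict hA]
  · refine integral_congr_ae ?_
    have := ae_restrict_of_ae_restrict_of_subset (inter_subset_right (s := A)) hα0
    filter_upwards [this] with s hs
    rw [ENNReal.toReal_ofReal hs]
  · exact (hα.aestronglyMeasurable.aemeasurable.ennreal_ofReal).restrict
  · exact Filter.Eventually.of_forall fun s => ENNReal.ofReal_lt_top

theorem densityMeasure_real (hα : IntegrableOn α (Icc 0 S))
    (hα0 : ∀ᵐ s ∂volume.restrict (Icc 0 S), 0 ≤ α s) {A : Set ℝ} (hA : MeasurableSet A) :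
    (densityMeasure S α).real A = ∫ s in A ∩ Icc 0 S, α s := by
  have := isFiniteMeasure_densityMeasure hα
  simpa using setIntegral_densityMeasure hα hα0 (fun _ => (1 : ℝ)) hA

end densityMeasure

namespace IsTimeChange

variable {E : Type*} [NormedAddCommGroup E] [NormedSpace ℝ E] {S h : ℝ} {φ : ℝ → ℝ}

theorem preimage_singleton_inter (H : IsTimeChange S h φ) {r : ℝ} (a : ℝ) (hr : r ∈ Icc 0 h) :
    (fun s => φ s + a) ⁻¹' {r + a} ∩ Icc 0 S = Icc (entryTime S φ r) (exitTime S φ r) := by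
  rw [← H.fiber_eq hr, inter_comm]
  ext s; simp

theorem preimage_Ioc_inter (H : IsTimeChange S h φ) {r : ℝ} (a : ℝ) (hr : r ∈ Icc 0 h) :
    (fun s => φ s + a) ⁻¹' (Ioc a (r + a)) ∩ Icc 0 S
      = Ioc (exitTime S φ 0) (exitTime S φ r) := by
  have h0 : (0 : ℝ) ∈ Icc 0 h := ⟨le_rfl, H.nonneg⟩
  ext s
  simp only [mem_inter_iff, mem_preimage, mem_Ioc]
  constructor
  · rintro ⟨⟨h1, h2⟩, hs⟩
    refine ⟨?_, (H.le_exitTime_iff hr hs).2 (by linarith)⟩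
    rw [← not_le, H.le_exitTime_iff h0 hs]
    linarith
  · rintro ⟨h1, h2⟩
    have hs : s ∈ Icc 0 S :=
      ⟨(H.exitTime_mem h0).1.1.trans h1.le, h2.trans (H.exitTime_mem hr).1.2⟩
    rw [← not_le, H.le_exitTime_iff h0 hs] at h1
    rw [H.le_exitTime_iff hr hs] at h2
    exact ⟨⟨by linarith, by linarith⟩, hs⟩

/-- The time change formula. On `(a, a + h)` let `μ` be the image of `α ds` under `φ + a`, and let
`Y` agree with `X ∘ (φ + a)` at the times outside the plateaus of `φ`. The integral of `α Y` then
splits into an integral of `X` against the atomless part of `μ` and the contributions of the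
plateaus. -/
theorem hasSum_plateau (H : IsTimeChange S h φ) {a : ℝ} {α : ℝ → ℝ}
    (hα : IntegrableOn α (Icc 0 S)) (hα0 : ∀ᵐ s ∂volume.restrict (Icc 0 S), 0 ≤ α s)
    {μ : Measure ℝ} [SFinite μ]
    (hμ : ((densityMeasure S α).map (fun s => φ s + a)).restrict (Ioo a (a + h))
      = μ.restrict (Ioo a (a + h)))
    {X Y : ℝ → E} (hX : StronglyMeasurable X)
    (hY : AEStronglyMeasurable Y (volume.restrict (Icc 0 S))) {C : ℝ} (hC : ∀ s, ‖Y s‖ ≤ C)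
    (hXY : ∀ s ∈ Icc 0 S, φ s ∈ Ioo 0 h → entryTime S φ (φ s) = exitTime S φ (φ s) →
      Y s = X (φ s + a))
    {t : ℝ} (ht : t ∈ Ioo a (a + h)) :
    HasSum (fun r : Ioc 0 (t - a) => ∫ s in entryTime S φ r..exitTime S φ r, α s • Y s)
      ((∫ s in exitTime S φ 0..exitTime S φ (t - a), α s • Y s)
        - ∫ u in Icc a t, X u ∂(DIS.continuousPart μ)) := by
  have hfin := isFiniteMeasure_densityMeasure hα
  set m := densityMeasure S α with hm
  have hφ : Measurable (fun s => φ s + a) := H.cont.measurable.add_const a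
  set κ := m.map (fun s => φ s + a) with hκ
  have hκf : IsFiniteMeasure κ := Measure.isFiniteMeasure_map m _
  have hYm : Integrable Y m :=
    Integrable.of_bound (hY.mono_ac densityMeasure_absolutelyContinuous) C
      (Filter.Eventually.of_forall hC)
  have hsub : Ioc a t ⊆ Ioo a (a + h) := fun u hu => ⟨hu.1, hu.2.trans_lt ht.2⟩
  have hr0 : t - a ∈ Icc 0 h := ⟨by linarith [ht.1], by linarith [ht.2]⟩
  have hmem : ∀ᵐ s ∂m, s ∈ Icc 0 S :=
    densityMeasure_absolutelyContinuous.ae_le (ae_restrict_mem measurableSet_Icc)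
  -- Plateaus on which the image measure has no atom are negligible for `α ds`.
  have hnull : ∀ᵐ s ∂m, ∀ r ∈ {r ∈ Icc 0 h | entryTime S φ r < exitTime S φ r},
      κ {r + a} = 0 → φ s ≠ r := by
    rw [ae_ball_iff H.countable_plateaus]
    intro r _
    by_cases h0 : κ {r + a} = 0
    · rw [hκ, Measure.map_apply hφ (measurableSet_singleton _)] at h0
      have : ∀ᵐ s ∂m, s ∉ (fun s => φ s + a) ⁻¹' {r + a} := measure_eq_zero_iff_ae_notMem.1 h0
      filter_upwards [this] with s hs _ hs'
      exact hs (by simp [hs'])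
    · exact Filter.Eventually.of_forall fun s h' => absurd h' h0
  have key := hasSum_setIntegral_fiber (m := m) hφ hYm (X := X) hX.aestronglyMeasurable
    (B := Ioc a t) measurableSet_Ioc (by
      filter_upwards [hmem, hnull] with s hs hs2 hs3 hs4
      have h1 : φ s ∈ Ioo 0 h := ⟨by linarith [hs3.1], by linarith [hs3.2, ht.2]⟩
      refine hXY s hs h1 (le_antisymm (H.entryTime_le_exitTime (Ioo_subset_Icc_self h1)) ?_)
      by_contra! hlt
      exact hs2 (φ s) ⟨Ioo_subset_Icc_self h1, hlt⟩ hs4 rfl)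
  rw [← hκ] at key
  have hres : κ.restrict (Ioc a t) = μ.restrict (Ioc a t) := Measure.restrict_congr_mono hsub hμ
  have hsing : ∀ u ∈ Ioc a t, κ {u} = μ {u} := fun u hu => by
    have := congrArg (fun ν => ν {u}) hres
    simpa [Measure.restrict_apply, inter_eq_left.2 (singleton_subset_iff.2 hu)] using this
  have hset : Ioc a t ∩ {u | κ {u} = 0} = Ioc a t ∩ {u | μ {u} = 0} := by
    ext u
    simp only [mem_inter_iff, mem_ofPred_eq, and_congr_right_iff]
    intro hu; rw [hsing u hu]
  have hcont : ∫ u in Ioc a t ∩ {u | κ {u} = 0}, X u ∂κ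
      = ∫ u in Icc a t, X u ∂(DIS.continuousPart μ) := by
    rw [hset, integral_Icc_eq_integral_Ioc' (DIS.continuousPart_singleton μ a),
      DIS.continuousPart, Measure.restrict_restrict measurableSet_Ioc,
      Measure.restrict_congr_mono inter_subset_left hres]
  have hB : ∫ s in (fun s => φ s + a) ⁻¹' Ioc a t, Y s ∂m
      = ∫ s in exitTime S φ 0..exitTime S φ (t - a), α s • Y s := by
    rw [setIntegral_densityMeasure hα hα0 _ (hφ measurableSet_Ioc),
      intervalIntegral.integral_of_le (H.exitTime_monotoneOn ⟨le_rfl, H.nonneg⟩ hr0 hr0.1),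
      ← H.preimage_Ioc_inter a hr0, sub_add_cancel]
  rw [hcont, hB] at key
  let e : Ioc 0 (t - a) ≃ Ioc a t :=
    { toFun := fun r => ⟨r + a, by have := r.2.1; have := r.2.2; constructor <;> linarith⟩
      invFun := fun u => ⟨u - a, by have := u.2.1; have := u.2.2; constructor <;> linarith⟩
      left_inv := fun r => by simp
      right_inv := fun r => by simp }
  convert (e.hasSum_iff).2 key using 1
  ext r
  have hr : (r : ℝ) ∈ Icc 0 h := ⟨r.2.1.le, r.2.2.trans hr0.2⟩
  simp only [Function.comp, e, Equiv.coe_fn_mk]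
  rw [setIntegral_densityMeasure hα hα0 _ (hφ (measurableSet_singleton _)),
    H.preimage_singleton_inter a hr, integral_Icc_eq_integral_Ioc,
    intervalIntegral.integral_of_le (H.entryTime_le_exitTime hr)]

/-- The time change formula for Lebesgue measure: plateaus do not contribute. -/
theorem integral_eq_of_map_eq_volume (H : IsTimeChange S h φ) {a : ℝ} {b : ℝ → ℝ}
    (hb : IntegrableOn b (Icc 0 S)) (hb0 : ∀ᵐ s ∂volume.restrict (Icc 0 S), 0 ≤ b s)
    (hμ : ((densityMeasure S b).map (fun s => φ s + a)).restrict (Ioo a (a + h))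
      = (volume : Measure ℝ).restrict (Ioo a (a + h)))
    {X Y : ℝ → E} (hX : StronglyMeasurable X)
    (hY : AEStronglyMeasurable Y (volume.restrict (Icc 0 S))) {C : ℝ} (hC : ∀ s, ‖Y s‖ ≤ C)
    (hXY : ∀ s ∈ Icc 0 S, φ s ∈ Ioo 0 h → entryTime S φ (φ s) = exitTime S φ (φ s) →
      Y s = X (φ s + a))
    {t : ℝ} (ht : t ∈ Ioo a (a + h)) :
    ∫ s in exitTime S φ 0..exitTime S φ (t - a), b s • Y s = ∫ u in a..t, X u := by
  have key := H.hasSum_plateau hb hb0 hμ hX hY hC hXY ht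
  have hφ : Measurable (fun s => φ s + a) := H.cont.measurable.add_const a
  have hz : ∀ r : Ioc 0 (t - a), ∫ s in entryTime S φ r..exitTime S φ r, b s • Y s = 0 := by
    intro r
    have hr : (r : ℝ) ∈ Icc 0 h := ⟨r.2.1.le, by linarith [r.2.2, ht.2]⟩
    have hmem : (r : ℝ) + a ∈ Ioo a (a + h) :=
      ⟨by linarith [r.2.1], by linarith [r.2.2, ht.2]⟩
    have h0 := congrArg (fun ν => ν {(r : ℝ) + a}) hμ
    simp only [Measure.restrict_apply (measurableSet_singleton _),
      inter_eq_left.2 (singleton_subset_iff.2 hmem),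
      Measure.map_apply hφ (measurableSet_singleton _), Real.volume_singleton] at h0
    rw [intervalIntegral.integral_of_le (H.entryTime_le_exitTime hr),
      ← integral_Icc_eq_integral_Ioc, ← H.preimage_singleton_inter a hr,
      ← setIntegral_densityMeasure hb hb0 _ (hφ (measurableSet_singleton _))]
    exact setIntegral_measure_zero _ h0
  simp only [hz] at key
  have h1 := key.unique hasSum_zero
  have h2 : DIS.continuousPart (volume : Measure ℝ) = volume := by
    simp [DIS.continuousPart]
  rw [sub_eq_zero.1 h1, h2, integral_Icc_eq_integral_Ioc, intervalIntegral.integral_of_le ht.1.le]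

end IsTimeChange

/-! ### Left limits and the trajectory formula -/

/-- The left limits of a curve `r ↦ F (exitTime r)` are the values of `F` at entry times. -/
theorem IsTimeChange.leftLim_eq {E : Type*} [TopologicalSpace E] [T2Space E] {S h a r : ℝ}
    {φ : ℝ → ℝ} (H : IsTimeChange S h φ) {x F : ℝ → E} (hF : ContinuousOn F (Icc 0 S))
    (hx : ∀ r ∈ Ioo 0 h, x (r + a) = F (exitTime S φ r)) (hr : r ∈ Ioc 0 h) :
    Function.leftLim x (r + a) = F (entryTime S φ r) := by
  have hrI := Ioc_subset_Icc_self hr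
  refine leftLim_eq_of_tendsto ?_
  have h1 : Tendsto (exitTime S φ) (𝓝[<] r) (𝓝[Icc 0 S] (entryTime S φ r)) := by
    refine tendsto_nhdsWithin_iff.2 ⟨H.tendsto_exitTime hr, ?_⟩
    filter_upwards [Ioo_mem_nhdsLT hr.1] with r' hr'
    exact (H.exitTime_mem ⟨hr'.1.le, hr'.2.le.trans hr.2⟩).1
  have h2 : Tendsto (fun r' => F (exitTime S φ r')) (𝓝[<] r) (𝓝 (F (entryTime S φ r))) :=
    (hF _ (H.entryTime_mem hrI).1).tendsto.comp h1
  have h3 : Tendsto (fun u => u - a) (𝓝[<] (r + a)) (𝓝[<] r) := by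
    refine tendsto_nhdsWithin_iff.2 ⟨?_, ?_⟩
    · have : Tendsto (fun u => u - a) (𝓝 (r + a)) (𝓝 (r + a - a)) :=
        (continuous_id.sub continuous_const).tendsto _
      rw [add_sub_cancel_right] at this
      exact this.mono_left nhdsWithin_le_nhds
    · filter_upwards [self_mem_nhdsWithin] with u hu
      simp only [mem_Iio] at hu ⊢; linarith
  refine (h2.comp h3).congr' ?_
  filter_upwards [h3 (Ioo_mem_nhdsLT hr.1)] with u hu
  have := hx (u - a) ⟨hu.1, hu.2.trans_le hr.2⟩
  simpa using this.symm

theorem map_add_restrict_of_map_eq {h : ℝ} {φ : ℝ → ℝ} (hφ : Measurable φ) {m : Measure ℝ}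
    (hm : m.map φ = volume.restrict (Icc 0 h)) (a : ℝ) :
    (m.map (fun s => φ s + a)).restrict (Ioo a (a + h))
      = (volume : Measure ℝ).restrict (Ioo a (a + h)) := by
  have h1 : m.map (fun s => φ s + a) = (m.map φ).map (· + a) :=
    (Measure.map_map (measurable_add_const a) hφ).symm
  have h2 : (volume.restrict (Icc 0 h)).map (· + a)
      = (volume : Measure ℝ).restrict (Icc a (a + h)) := by
    have := ((measurePreserving_add_right volume a).restrict_preimage
      (measurableSet_Icc (a := a) (b := a + h))).map_eq
    rw [← this]
    congr 2
    ext s; simp [add_comm]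
  rw [h1, hm, h2, Measure.restrict_restrict measurableSet_Ioo,
    inter_eq_left.2 Ioo_subset_Icc_self]

namespace DIS

variable {n : ℕ} {D : DIS n}

/-- The right-hand side of the reparameterized system on the slot starting at `a = (i - 1) h`,
compared with the terms of the formula for the trajectory of the original system. -/
theorem hasSum_jumps (hf : Continuous D.f) (hg : Continuous D.g)
    (hfb : ∃ C : ℝ, ∀ z, ‖D.f z‖ ≤ C) (hgb : ∃ C : ℝ, ∀ z, ‖D.g z‖ ≤ C)
    {S : ℝ} {φ : ℝ → ℝ} (H : IsTimeChange S D.h φ)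
    {x : ℝ → Vec n} (hx : BoundedVariationOn x (Icc (-D.h) D.T)) {μ : Measure ℝ} [SFinite μ]
    {a : ℝ} (ha : 0 ≤ a) (haT : a + D.h ≤ D.T) {α b : ℝ → ℝ}
    (hα : IntegrableOn α (Icc 0 S)) (hα0 : ∀ᵐ s ∂volume.restrict (Icc 0 S), 0 ≤ α s)
    (hb : IntegrableOn b (Icc 0 S)) (hb0 : ∀ᵐ s ∂volume.restrict (Icc 0 S), 0 ≤ b s)
    (hμ : ((densityMeasure S α).map (fun s => φ s + a)).restrict (Ioo a (a + D.h))
      = μ.restrict (Ioo a (a + D.h)))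
    (hvol : (densityMeasure S b).map φ = volume.restrict (Icc 0 D.h))
    {Y : ℝ → Vec n × Vec n} (hY : AEStronglyMeasurable Y (volume.restrict (Icc 0 S)))
    (hXY : ∀ s ∈ Icc 0 S, φ s ∈ Ioo 0 D.h → entryTime S φ (φ s) = exitTime S φ (φ s) →
      Y s = (x (φ s + a), x (φ s + a - D.h)))
    {t : ℝ} (ht : t ∈ Ioo a (a + D.h)) :
    HasSum (fun r : Ioc 0 (t - a) =>
        ∫ s in entryTime S φ r..exitTime S φ r, α s • D.g (Y s))
      ((∫ s in exitTime S φ 0..exitTime S φ (t - a), (b s • D.f (Y s) + α s • D.g (Y s)))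
        - (∫ u in a..t, D.f (x u, x (u - D.h)))
        - ∫ u in Icc a t, D.g (x u, x (u - D.h)) ∂(continuousPart μ)) := by
  obtain ⟨Cf, hCf⟩ := hfb
  obtain ⟨Cg, hCg⟩ := hgb
  have hh := H.nonneg
  obtain ⟨x', hx'm, hx'⟩ := hx.exists_measurable_eqOn
  have hpair : ∀ u ∈ Icc a (a + D.h), (x' u, x' (u - D.h)) = (x u, x (u - D.h)) := fun u hu => by
    rw [hx' ⟨by linarith [hu.1], hu.2.trans haT⟩,
      hx' ⟨by linarith [hu.1], by linarith [hu.2]⟩]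
  have hXm : Measurable fun u => (x' u, x' (u - D.h)) :=
    hx'm.prodMk (hx'm.comp (measurable_id.sub_const _))
  have hXY' : ∀ s ∈ Icc 0 S, φ s ∈ Ioo 0 D.h → entryTime S φ (φ s) = exitTime S φ (φ s) →
      Y s = (x' (φ s + a), x' (φ s + a - D.h)) := fun s hs h1 h2 => by
    rw [hXY s hs h1 h2, hpair _ ⟨by linarith [h1.1], by linarith [h1.2]⟩]
  have kg := H.hasSum_plateau hα hα0 hμ (X := fun u => D.g (x' u, x' (u - D.h)))
    (Y := fun s => D.g (Y s)) (hg.measurable.comp hXm).stronglyMeasurable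
    (hg.comp_aestronglyMeasurable hY) (fun s => hCg _)
    (fun s hs h1 h2 => by rw [hXY' s hs h1 h2]) ht
  have kf := H.integral_eq_of_map_eq_volume hb hb0
    (map_add_restrict_of_map_eq H.cont.measurable hvol a)
    (X := fun u => D.f (x' u, x' (u - D.h)))
    (Y := fun s => D.f (Y s)) (hf.measurable.comp hXm).stronglyMeasurable
    (hf.comp_aestronglyMeasurable hY) (fun s => hCf _)
    (fun s hs h1 h2 => by rw [hXY' s hs h1 h2]) ht
  have e1 : ∫ u in a..t, D.f (x' u, x' (u - D.h)) = ∫ u in a..t, D.f (x u, x (u - D.h)) := by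
    refine intervalIntegral.integral_congr fun u hu => ?_
    rw [uIcc_of_le ht.1.le] at hu
    simp only [hpair u ⟨hu.1, hu.2.trans ht.2.le⟩]
  have e2 : ∫ u in Icc a t, D.g (x' u, x' (u - D.h)) ∂(continuousPart μ)
      = ∫ u in Icc a t, D.g (x u, x (u - D.h)) ∂(continuousPart μ) := by
    refine setIntegral_congr_fun measurableSet_Icc fun u hu => ?_
    simp only [hpair u ⟨hu.1, hu.2.trans ht.2.le⟩]
  have h0 : (0 : ℝ) ∈ Icc 0 D.h := ⟨le_rfl, hh⟩
  have hr : t - a ∈ Icc 0 D.h := ⟨by linarith [ht.1], by linarith [ht.2]⟩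
  have hle := H.exitTime_monotoneOn h0 hr hr.1
  have hsub : Ioc (exitTime S φ 0) (exitTime S φ (t - a)) ⊆ Icc 0 S := fun s hs =>
    ⟨(H.exitTime_mem h0).1.1.trans hs.1.le, hs.2.trans (H.exitTime_mem hr).1.2⟩
  have hint : ∀ {c : ℝ → ℝ} {F : Vec n × Vec n → Vec n} {C : ℝ}, IntegrableOn c (Icc 0 S) →
      Continuous F → (∀ z, ‖F z‖ ≤ C) → IntervalIntegrable (fun s => c s • F (Y s)) volume
        (exitTime S φ 0) (exitTime S φ (t - a)) := by
    intro c F C hc hF hC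
    rw [intervalIntegrable_iff_integrableOn_Ioc_of_le hle]
    have : IntegrableOn (fun s => c s • F (Y s)) (Icc 0 S) :=
      Integrable.smul_bdd hc C (hF.comp_aestronglyMeasurable hY)
        (Filter.Eventually.of_forall fun s => hC _)
    exact this.mono_set hsub
  rw [intervalIntegral.integral_add (hint hb hf hCf) (hint hα hg hCg), kf, ← e1, ← e2,
    add_sub_cancel_left]
  exact kg

end DIS

theorem quasiMeasurePreserving_affine (p : ℝ) {c : ℝ} (hc : c ≠ 0) :
    Measure.QuasiMeasurePreserving (fun s : ℝ => p + c * s) volume volume :=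
  (measurePreserving_add_left volume p).quasiMeasurePreserving.comp
    (Measure.quasiMeasurePreserving_smul volume hc)

theorem ae_restrict_comp_affine {Q : ℝ → Prop} {p c : ℝ} (hc : 0 < c)
    (hQ : ∀ᵐ u ∂volume.restrict (Icc p (p + c)), Q u) :
    ∀ᵐ s ∂volume.restrict (Icc (0 : ℝ) 1), Q (p + c * s) := by
  rw [ae_restrict_iff' measurableSet_Icc] at hQ ⊢
  filter_upwards [(quasiMeasurePreserving_affine p hc.ne').ae hQ] with s hs hs'
  exact hs ⟨by nlinarith [hs'.1], by nlinarith [hs'.2]⟩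

theorem ae_restrict_comp_affine_symm {Q : ℝ → Prop} {p c : ℝ} (hc : 0 < c)
    (hQ : ∀ᵐ s ∂volume.restrict (Icc (0 : ℝ) 1), Q s) :
    ∀ᵐ u ∂volume.restrict (Icc p (p + c)), Q ((u - p) / c) := by
  rw [ae_restrict_iff' measurableSet_Icc] at hQ ⊢
  filter_upwards [(quasiMeasurePreserving_affine (-p / c) (inv_ne_zero hc.ne')).ae hQ] with u hu hu'
  have e : -p / c + c⁻¹ * u = (u - p) / c := by field_simp; ring
  rw [e] at hu
  exact hu ⟨div_nonneg (by linarith [hu'.1]) hc.le, (div_le_one hc).2 (by linarith [hu'.2])⟩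

/-! ### Rates and the clock of a reparameterized process -/

theorem intervalIntegral_congr_ae_Icc {E : Type*} [NormedAddCommGroup E] [NormedSpace ℝ E]
    {f g : ℝ → E} {a b : ℝ} (hab : a ≤ b) (h : f =ᵐ[volume.restrict (Icc a b)] g) :
    ∫ s in a..b, f s = ∫ s in a..b, g s := by
  rw [intervalIntegral.integral_of_le hab, intervalIntegral.integral_of_le hab]
  exact integral_congr_ae (ae_restrict_of_ae_restrict_of_subset Ioc_subset_Icc_self h)

/-- Rates `α₁, …, α_N` that are Borel, nonnegative and of sum at most one at every time. -/
structure IsRateFamily (N : ℕ) (α : ℕ → ℝ → ℝ) : Prop where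
  measurable : ∀ i ∈ Finset.Icc 1 N, Measurable (α i)
  nonneg : ∀ i ∈ Finset.Icc 1 N, ∀ s, 0 ≤ α i s
  sum_le : ∀ s, ∑ i ∈ Finset.Icc 1 N, α i s ≤ 1

/-- The time of the original system elapsed at the parameter value `s`. -/
noncomputable def clock (N : ℕ) (α : ℕ → ℝ → ℝ) (s : ℝ) : ℝ :=
  ∫ u in (0 : ℝ)..s, (1 - ∑ i ∈ Finset.Icc 1 N, α i u)

namespace IsRateFamily

variable {N : ℕ} {α : ℕ → ℝ → ℝ}

theorem le_one (A : IsRateFamily N α) {i : ℕ} (hi : i ∈ Finset.Icc 1 N) (s : ℝ) : α i s ≤ 1 :=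
  (Finset.single_le_sum (f := fun j => α j s) (fun j hj => A.nonneg j hj s) hi).trans (A.sum_le s)

theorem integrableOn (A : IsRateFamily N α) {i : ℕ} (hi : i ∈ Finset.Icc 1 N) (a b : ℝ) :
    IntegrableOn (α i) (Icc a b) :=
  Integrable.of_bound (A.measurable i hi).aestronglyMeasurable 1
    (Filter.Eventually.of_forall fun s => by
      rw [Real.norm_of_nonneg (A.nonneg i hi s)]; exact A.le_one hi s)

theorem measurable_speed (A : IsRateFamily N α) :
    Measurable fun s => 1 - ∑ i ∈ Finset.Icc 1 N, α i s :=
  measurable_const.sub (Finset.measurable_fun_sum _ A.measurable)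

theorem speed_nonneg (A : IsRateFamily N α) (s : ℝ) : 0 ≤ 1 - ∑ i ∈ Finset.Icc 1 N, α i s :=
  sub_nonneg.2 (A.sum_le s)

theorem speed_le_one (A : IsRateFamily N α) (s : ℝ) : 1 - ∑ i ∈ Finset.Icc 1 N, α i s ≤ 1 :=
  sub_le_self _ (Finset.sum_nonneg fun i hi => A.nonneg i hi s)

theorem integrableOn_speed (A : IsRateFamily N α) (a b : ℝ) :
    IntegrableOn (fun s => 1 - ∑ i ∈ Finset.Icc 1 N, α i s) (Icc a b) :=
  Integrable.of_bound A.measurable_speed.aestronglyMeasurable 1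
    (Filter.Eventually.of_forall fun s => by
      rw [Real.norm_of_nonneg (A.speed_nonneg s)]; exact A.speed_le_one s)

theorem intervalIntegrable_speed (A : IsRateFamily N α) (a b : ℝ) :
    IntervalIntegrable (fun s => 1 - ∑ i ∈ Finset.Icc 1 N, α i s) volume a b :=
  (A.integrableOn_speed (min a b) (max a b)).intervalIntegrable

theorem clock_sub (A : IsRateFamily N α) (a b : ℝ) :
    clock N α b - clock N α a = ∫ u in a..b, (1 - ∑ i ∈ Finset.Icc 1 N, α i u) :=
  intervalIntegral.integral_interval_sub_left (A.intervalIntegrable_speed _ _)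
    (A.intervalIntegrable_speed _ _)

theorem isTimeChange_clock (A : IsRateFamily N α) {S h : ℝ} (hS : 0 < S)
    (hh : ∫ s in (0 : ℝ)..S, (1 - ∑ i ∈ Finset.Icc 1 N, α i s) = h) :
    IsTimeChange S h (clock N α) where
  pos := hS
  cont := intervalIntegral.continuous_primitive A.intervalIntegrable_speed 0
  mono := fun a b hab => by
    rw [← sub_nonneg, A.clock_sub]
    exact intervalIntegral.integral_nonneg hab fun u _ => A.speed_nonneg u
  map_zero := by simp [clock]
  map_top := hh

theorem map_clock (A : IsRateFamily N α) {S h : ℝ} (H : IsTimeChange S h (clock N α)) :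
    (densityMeasure S fun s => 1 - ∑ i ∈ Finset.Icc 1 N, α i s).map (clock N α)
      = volume.restrict (Icc 0 h) := by
  have hI := A.integrableOn_speed 0 S
  have hn : ∀ᵐ s ∂volume.restrict (Icc 0 S), 0 ≤ 1 - ∑ i ∈ Finset.Icc 1 N, α i s :=
    Filter.Eventually.of_forall A.speed_nonneg
  have hfin := isFiniteMeasure_densityMeasure hI
  set m := densityMeasure S fun s => 1 - ∑ i ∈ Finset.Icc 1 N, α i s with hm
  have : IsFiniteMeasure (m.map (clock N α)) := Measure.isFiniteMeasure_map m _
  refine Measure.ext_of_Iic _ _ fun r => ?_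
  rw [← measureReal_eq_measureReal_iff, map_measureReal_apply H.cont.measurable measurableSet_Iic,
    measureReal_restrict_apply measurableSet_Iic, hm,
    densityMeasure_real hI hn (H.cont.measurable measurableSet_Iic)]
  rcases lt_or_ge r 0 with hr | hr
  · have e1 : clock N α ⁻¹' Iic r ∩ Icc 0 S = ∅ := by
      ext s
      simp only [mem_inter_iff, mem_preimage, mem_Iic, mem_empty_iff_false, iff_false, not_and]
      intro h1 h2
      linarith [(H.mapsTo h2).1]
    have e2 : Iic r ∩ Icc 0 h = ∅ := by
      ext s
      simp only [mem_inter_iff, mem_Iic, mem_Icc, mem_empty_iff_false, iff_false]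
      intro h1; linarith [h1.1, h1.2.1]
    simp [e1, e2]
  · have hr' : min r h ∈ Icc 0 h := ⟨le_min hr H.nonneg, min_le_right _ _⟩
    have e1 : clock N α ⁻¹' Iic r ∩ Icc 0 S = Icc 0 (exitTime S (clock N α) (min r h)) := by
      ext s
      constructor
      · rintro ⟨h1, h2⟩
        exact ⟨h2.1, (H.le_exitTime_iff hr' h2).2 (le_min h1 (H.mapsTo h2).2)⟩
      · rintro ⟨h1, h2⟩
        have hs : s ∈ Icc 0 S := ⟨h1, h2.trans (H.exitTime_mem hr').1.2⟩
        exact ⟨((H.le_exitTime_iff hr' hs).1 h2).trans (min_le_left _ _), hs⟩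
    have e2 : Iic r ∩ Icc 0 h = Icc 0 (min r h) := by
      ext s; simp only [mem_inter_iff, mem_Iic, mem_Icc, le_min_iff]; tauto
    rw [e1, e2, integral_Icc_eq_integral_Ioc,
      ← intervalIntegral.integral_of_le (H.exitTime_mem hr').1.1]
    have := H.apply_exitTime hr'
    rw [clock] at this
    rw [this]
    simp [hr'.1]

/-- On a plateau of the clock the rates sum to one. -/
theorem speed_eq_zero_of_plateau (A : IsRateFamily N α) {S h r : ℝ}
    (H : IsTimeChange S h (clock N α)) (hr : r ∈ Icc 0 h) :
    ∀ᵐ s ∂volume.restrict (Icc (entryTime S (clock N α) r) (exitTime S (clock N α) r)),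
      1 - ∑ i ∈ Finset.Icc 1 N, α i s = 0 := by
  have h1 := A.clock_sub (entryTime S (clock N α) r) (exitTime S (clock N α) r)
  rw [H.apply_entryTime hr, H.apply_exitTime hr, sub_self,
    intervalIntegral.integral_of_le (H.entryTime_le_exitTime hr),
    ← integral_Icc_eq_integral_Ioc] at h1
  exact (integral_eq_zero_iff_of_nonneg A.speed_nonneg (A.integrableOn_speed _ _)).1 h1.symm

end IsRateFamily

namespace DIS

variable {n : ℕ} {D : DIS n}

/-- The rates of a reparameterized process only matter up to null sets. -/
theorem IsReparameterized.exists_isRateFamily {S : ℝ} {y : ℕ → ℝ → Vec n} {α : ℕ → ℝ → ℝ}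
    (P : D.IsReparameterized S y α) : ∃ β : ℕ → ℝ → ℝ, IsRateFamily D.N β ∧
      D.IsReparameterized S y β ∧
      ∀ i ∈ Finset.Icc 1 D.N, ∫ s in (0 : ℝ)..S, β i s = ∫ s in (0 : ℝ)..S, α i s := by
  have h1 : ∀ i, ∃ g : ℝ → ℝ, Measurable g ∧
      (i ∈ Finset.Icc 1 D.N → α i =ᵐ[volume.restrict (Icc 0 S)] g) := by
    intro i
    by_cases hi : i ∈ Finset.Icc 1 D.N
    · have := (P.memLinfty i hi).aestronglyMeasurable.aemeasurable
      exact ⟨this.mk, this.measurable_mk, fun _ => this.ae_eq_mk⟩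
    · exact ⟨0, measurable_const, fun h => absurd h hi⟩
  choose β₀ hm hae using h1
  set G := {s | (∀ i ∈ Finset.Icc 1 D.N, 0 ≤ β₀ i s) ∧ ∑ i ∈ Finset.Icc 1 D.N, β₀ i s ≤ 1} with hG
  have hGm : MeasurableSet G := by
    have e : {s | ∀ i ∈ Finset.Icc 1 D.N, 0 ≤ β₀ i s}
        = ⋂ i ∈ Finset.Icc 1 D.N, {s | 0 ≤ β₀ i s} := by ext; simp
    have e' : MeasurableSet {s | ∀ i ∈ Finset.Icc 1 D.N, 0 ≤ β₀ i s} := by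
      rw [e]
      exact Finset.measurableSet_biInter _ fun i _ => measurableSet_le measurable_const (hm i)
    exact e'.inter (measurableSet_le
      (Finset.measurable_fun_sum _ fun i _ => hm i) measurable_const)
  have hall : ∀ᵐ s ∂volume.restrict (Icc 0 S), ∀ i ∈ Finset.Icc 1 D.N,
      G.indicator (β₀ i) s = α i s := by
    have e1 : ∀ᵐ s ∂volume.restrict (Icc 0 S), ∀ i ∈ Finset.Icc 1 D.N, α i s = β₀ i s :=
      (Finset.eventually_all _).2 fun i hi => hae i hi
    have e2 : ∀ᵐ s ∂volume.restrict (Icc 0 S), ∀ i ∈ Finset.Icc 1 D.N, 0 ≤ α i s :=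
      (Finset.eventually_all _).2 P.nonneg
    filter_upwards [e1, e2, P.sum_le] with s h1 h2 h3 i hi
    have hs : s ∈ G := ⟨fun j hj => h1 j hj ▸ h2 j hj, by rwa [← Finset.sum_congr rfl h1]⟩
    rw [indicator_of_mem hs, h1 i hi]
  have hsum : ∀ᵐ s ∂volume.restrict (Icc 0 S),
      ∑ i ∈ Finset.Icc 1 D.N, G.indicator (β₀ i) s = ∑ i ∈ Finset.Icc 1 D.N, α i s := by
    filter_upwards [hall] with s hs using Finset.sum_congr rfl hs
  have heach : ∀ i ∈ Finset.Icc 1 D.N,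
      G.indicator (β₀ i) =ᵐ[volume.restrict (Icc 0 S)] α i := fun i hi => by
    filter_upwards [hall] with s hs using hs i hi
  refine ⟨fun i => G.indicator (β₀ i), ⟨fun i _ => (hm i).indicator hGm, fun i hi s => ?_,
    fun s => ?_⟩, ⟨P.pos, fun i hi => (memLp_congr_ae (heach i hi)).2 (P.memLinfty i hi),
    P.absCont, fun i hi => ?_, fun i hi => ?_, ?_, P.y_zero, P.y_zero_end, P.link, ?_⟩,
    fun i hi => intervalIntegral_congr_ae_Icc P.pos.le (heach i hi)⟩
  · exact indicator_apply_nonneg fun hs => hs.1 i hi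
  · by_cases hs : s ∈ G
    · simpa [hs] using hs.2
    · simp [hs]
  · filter_upwards [P.ode i hi, hsum, heach i hi] with s h1 h2 h3
    rwa [h2, h3]
  · filter_upwards [heach i hi, P.nonneg i hi] with s h1 h2
    rwa [h1]
  · filter_upwards [hsum, P.sum_le] with s h1 h2
    rwa [h1]
  · rw [← P.time]
    refine intervalIntegral_congr_ae_Icc P.pos.le ?_
    filter_upwards [hsum] with s hs
    rw [hs]

end DIS

/-! ### Concatenation of the slots and the impulse measure -/

theorem mem_slot {h r : ℝ} {i N : ℕ} (hi : i ∈ Finset.Icc 1 N) (hr : r ∈ Icc 0 h) :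
    r + ((i : ℝ) - 1) * h ∈ Icc 0 (N * h) := by
  rw [Finset.mem_Icc] at hi
  have h1 : (1 : ℝ) ≤ i := by exact_mod_cast hi.1
  have h2 : (i : ℝ) ≤ N := by exact_mod_cast hi.2
  have h3 : 0 ≤ h := hr.1.trans hr.2
  constructor
  · have := mul_nonneg (sub_nonneg.2 h1) h3
    linarith [hr.1]
  · nlinarith [hr.2]

/-- Curves `c₁, …, c_N` on `[0, h)`, run one after the other after a constant history. -/
theorem exists_concat {V : Type*} {h : ℝ} (hh : 0 < h) {N : ℕ} (hN : 0 < N) (ξ x₀ e : V)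
    (c : ℕ → ℝ → V) : ∃ x : ℝ → V, (∀ t < 0, x t = ξ) ∧ x 0 = x₀ ∧ x (N * h) = e ∧
      (∀ i ∈ Finset.Icc 1 N, ∀ r ∈ Ioo 0 h, x (r + ((i : ℝ) - 1) * h) = c i r) ∧
      ∀ i ∈ Finset.Icc 2 N, x (((i : ℝ) - 1) * h) = c i 0 := by
  classical
  have hNh : 0 < (N : ℝ) * h := by positivity
  have hfl : ∀ i ∈ Finset.Icc 1 N, ∀ r ∈ Ico 0 h, ⌊(r + ((i : ℝ) - 1) * h) / h⌋₊ + 1 = i := by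
    intro i hi r hr
    rw [Finset.mem_Icc] at hi
    obtain ⟨j, rfl⟩ := Nat.exists_eq_add_of_le' hi.1
    rw [Nat.add_right_cancel_iff, Nat.floor_eq_iff (by
      have : (0 : ℝ) ≤ (((j + 1 : ℕ) : ℝ) - 1) * h := by push_cast; rw [add_sub_cancel_right]; positivity
      exact div_nonneg (by linarith [hr.1]) hh.le), le_div_iff₀ hh, div_lt_iff₀ hh]
    push_cast
    constructor <;> nlinarith [hr.1, hr.2]
  have hlt : ∀ i ∈ Finset.Icc 1 N, ∀ r ∈ Ico 0 h, r + ((i : ℝ) - 1) * h < N * h := by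
    intro i hi r hr
    rw [Finset.mem_Icc] at hi
    have h2 : (i : ℝ) ≤ N := by exact_mod_cast hi.2
    nlinarith [hr.2]
  refine ⟨fun t => if t < 0 then ξ else if t = 0 then x₀ else if t < N * h then
    c (⌊t / h⌋₊ + 1) (t - (((⌊t / h⌋₊ + 1 : ℕ) : ℝ) - 1) * h) else e,
    fun t ht => by simp [ht], by simp, by simp [hNh.not_gt, hNh.ne'], fun i hi r hr => ?_,
    fun i hi => ?_⟩
  · have h1 := mem_slot hi (Ioo_subset_Icc_self hr)
    have h2 : (1 : ℝ) ≤ i := by exact_mod_cast (Finset.mem_Icc.1 hi).1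
    have h3 : 0 < r + ((i : ℝ) - 1) * h := by
      have := mul_nonneg (sub_nonneg.2 h2) hh.le
      linarith [hr.1]
    simp only [h3.not_gt, h3.ne', hlt i hi r (Ioo_subset_Ico_self hr), if_true, if_false,
      hfl i hi r (Ioo_subset_Ico_self hr), add_sub_cancel_right]
  · have hi1 : i ∈ Finset.Icc 1 N := Finset.Icc_subset_Icc_left (by norm_num) hi
    have h2 : (2 : ℝ) ≤ i := by exact_mod_cast (Finset.mem_Icc.1 hi).1
    have h3 : 0 < ((i : ℝ) - 1) * h := mul_pos (by linarith) hh
    have e1 := hfl i hi1 0 ⟨le_rfl, hh⟩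
    have e2 := hlt i hi1 0 ⟨le_rfl, hh⟩
    rw [zero_add] at e1 e2
    simp only [h3.not_gt, h3.ne', e2, if_true, if_false, e1, sub_self]

/-- Bounded variation of the concatenated curve: only the open slots matter, because a function
of bounded variation on an open interval has limits at its ends. -/
theorem boundedVariationOn_of_slots {V : Type*} [PseudoMetricSpace V] [CompleteSpace V] {h : ℝ}
    (hh : 0 < h) (N : ℕ) {x : ℝ → V}
    (hx : ∀ i ≤ N, BoundedVariationOn x (Ioo (((i : ℝ) - 1) * h) ((i : ℝ) * h))) :
    BoundedVariationOn x (Icc (-h) (N * h)) := by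
  have hmono : Monotone fun k : ℕ => ((k : ℝ) - 1) * h := fun k l hkl => by
    have : (k : ℝ) ≤ l := by exact_mod_cast hkl
    exact mul_le_mul_of_nonneg_right (by linarith) hh.le
  have key := eVariationOn.sum' x hmono (n := N + 1)
  have e : Icc ((((0 : ℕ) : ℝ) - 1) * h) ((((N + 1 : ℕ) : ℝ) - 1) * h) = Icc (-h) (N * h) := by
    congr 1 <;> push_cast <;> ring
  simp only [e] at key
  rw [BoundedVariationOn, ← key]
  refine (ENNReal.sum_lt_top.2 fun i hi => lt_top_iff_ne_top.2 ?_).ne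
  have e' : (((i + 1 : ℕ) : ℝ) - 1) * h = i * h := by push_cast; ring
  rw [e']
  exact BoundedVariationOn.Icc_of_Ioo (by linarith) (hx i (Nat.lt_succ_iff.1 (Finset.mem_range.1 hi)))

namespace DIS

variable {n : ℕ} {D : DIS n}

/-- The part of the impulse measure produced by the rate `α i`, carried by the slot
`[(i - 1) h, i h]`. -/
noncomputable def slotMeasure (S h : ℝ) (φ : ℝ → ℝ) (α : ℕ → ℝ → ℝ) (i : ℕ) : Measure ℝ :=
  (densityMeasure S (α i)).map fun s => φ s + ((i : ℝ) - 1) * h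

/-- The impulse measure generated by the rates `α₁, …, α_N`. -/
noncomputable def impulseMeasure (N : ℕ) (S h : ℝ) (φ : ℝ → ℝ) (α : ℕ → ℝ → ℝ) : Measure ℝ :=
  ∑ i ∈ Finset.Icc 1 N, slotMeasure S h φ α i

section impulse

variable {N : ℕ} {S h : ℝ} {φ : ℝ → ℝ} {α : ℕ → ℝ → ℝ}

theorem isFiniteMeasure_slotMeasure (A : IsRateFamily N α) {i : ℕ} (hi : i ∈ Finset.Icc 1 N) :
    IsFiniteMeasure (slotMeasure S h φ α i) :=
  have := isFiniteMeasure_densityMeasure (A.integrableOn hi 0 S)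
  Measure.isFiniteMeasure_map _ _

theorem isFiniteMeasure_impulseMeasure (A : IsRateFamily N α) :
    IsFiniteMeasure (impulseMeasure N S h φ α) := by
  constructor
  rw [impulseMeasure, Measure.finsetSum_apply]
  exact ENNReal.sum_lt_top.2 fun i hi => (isFiniteMeasure_slotMeasure A hi).measure_univ_lt_top

theorem slotMeasure_compl (H : IsTimeChange S h φ) (i : ℕ) :
    slotMeasure S h φ α i (Icc (((i : ℝ) - 1) * h) (i * h))ᶜ = 0 := by
  rw [slotMeasure, Measure.map_apply (H.cont.measurable.add_const _) measurableSet_Icc.compl]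
  refine densityMeasure_absolutelyContinuous ?_
  rw [Measure.restrict_apply (H.cont.measurable.add_const _ measurableSet_Icc.compl)]
  convert measure_empty (μ := (volume : Measure ℝ))
  ext s
  simp only [mem_inter_iff, mem_preimage, mem_compl_iff, mem_empty_iff_false, iff_false, not_and]
  intro h1 h2
  have := H.mapsTo h2
  exact h1 ⟨by linarith [this.1], by linarith [this.2]⟩

theorem slotMeasure_eq_zero (H : IsTimeChange S h φ) (i : ℕ) {B : Set ℝ}
    (hB : Disjoint B (Icc (((i : ℝ) - 1) * h) (i * h))) : slotMeasure S h φ α i B = 0 :=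
  measure_mono_null (subset_compl_iff_disjoint_right.2 hB) (slotMeasure_compl H i)

theorem slotMeasure_real_univ (A : IsRateFamily N α) (H : IsTimeChange S h φ) {i : ℕ}
    (hi : i ∈ Finset.Icc 1 N) :
    (slotMeasure S h φ α i).real univ = ∫ s in (0 : ℝ)..S, α i s := by
  rw [slotMeasure, map_measureReal_apply (H.cont.measurable.add_const _) MeasurableSet.univ,
    densityMeasure_real (A.integrableOn hi 0 S) (Filter.Eventually.of_forall (A.nonneg i hi))
      (by simp), preimage_univ, univ_inter, integral_Icc_eq_integral_Ioc,
    intervalIntegral.integral_of_le H.pos.le]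

theorem slotMeasure_real_singleton (A : IsRateFamily N α) (H : IsTimeChange S h φ) {i : ℕ}
    (hi : i ∈ Finset.Icc 1 N) {r : ℝ} (hr : r ∈ Icc 0 h) :
    (slotMeasure S h φ α i).real {r + ((i : ℝ) - 1) * h}
      = ∫ s in entryTime S φ r..exitTime S φ r, α i s := by
  have hm : Measurable fun s => φ s + ((i : ℝ) - 1) * h := H.cont.measurable.add_const _
  rw [slotMeasure, map_measureReal_apply hm (measurableSet_singleton _),
    densityMeasure_real (A.integrableOn hi 0 S) (Filter.Eventually.of_forall (A.nonneg i hi))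
      (hm (measurableSet_singleton _)), H.preimage_singleton_inter _ hr,
    integral_Icc_eq_integral_Ioc, intervalIntegral.integral_of_le (H.entryTime_le_exitTime hr)]

theorem disjoint_slots (hh : 0 < h) {i j : ℕ} (hij : i ≠ j) :
    Disjoint (Ioo (((i : ℝ) - 1) * h) (i * h)) (Icc (((j : ℝ) - 1) * h) (j * h)) := by
  refine Set.disjoint_left.2 fun t h1 h2 => ?_
  rcases lt_or_gt_of_ne hij with hlt | hlt
  · have : (i : ℝ) + 1 ≤ j := by exact_mod_cast hlt
    nlinarith [h1.2, h2.1]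
  · have : (j : ℝ) + 1 ≤ i := by exact_mod_cast hlt
    nlinarith [h1.1, h2.2]

theorem impulseMeasure_restrict (hh : 0 < h) (H : IsTimeChange S h φ) {i : ℕ}
    (hi : i ∈ Finset.Icc 1 N) :
    (slotMeasure S h φ α i).restrict (Ioo (((i : ℝ) - 1) * h) (i * h))
      = (impulseMeasure N S h φ α).restrict (Ioo (((i : ℝ) - 1) * h) (i * h)) := by
  ext B hB
  rw [Measure.restrict_apply hB, Measure.restrict_apply hB, impulseMeasure,
    Measure.finsetSum_apply, Finset.sum_eq_single i _ (fun h' => absurd hi h')]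
  exact fun j _ hji =>
    slotMeasure_eq_zero H j ((disjoint_slots hh hji.symm).mono_left inter_subset_right)

theorem impulseMeasure_compl (H : IsTimeChange S h φ) :
    impulseMeasure N S h φ α (Icc 0 (N * h))ᶜ = 0 := by
  rw [impulseMeasure, Measure.finsetSum_apply]
  refine Finset.sum_eq_zero fun i hi => slotMeasure_eq_zero H i ?_
  refine disjoint_compl_left.mono_right fun t ht => ?_
  have := mem_slot (h := h) (r := t - ((i : ℝ) - 1) * h) hi
    ⟨by linarith [ht.1], by linarith [ht.2]⟩
  simpa using this

theorem impulseMeasure_real_univ (A : IsRateFamily N α) (H : IsTimeChange S h φ) :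
    (impulseMeasure N S h φ α).real univ = ∑ i ∈ Finset.Icc 1 N, ∫ s in (0 : ℝ)..S, α i s := by
  rw [Measure.real, impulseMeasure, Measure.finsetSum_apply, ENNReal.toReal_sum]
  · exact Finset.sum_congr rfl fun i hi => slotMeasure_real_univ A H hi
  · intro i hi
    have := isFiniteMeasure_slotMeasure (S := S) (h := h) (φ := φ) A hi
    exact measure_ne_top _ _

theorem impulseMeasure_real_interior (A : IsRateFamily N α) (hh : 0 < h) (H : IsTimeChange S h φ)
    {i : ℕ} (hi : i ∈ Finset.Icc 1 N) {r : ℝ} (hr : r ∈ Ioo 0 h) :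
    (impulseMeasure N S h φ α).real {r + ((i : ℝ) - 1) * h}
      = ∫ s in entryTime S φ r..exitTime S φ r, α i s := by
  rw [← slotMeasure_real_singleton A H hi (Ioo_subset_Icc_self hr)]
  have hmem : {r + ((i : ℝ) - 1) * h} ⊆ Ioo (((i : ℝ) - 1) * h) (i * h) :=
    singleton_subset_iff.2 ⟨by linarith [hr.1], by linarith [hr.2]⟩
  have := congrArg (fun ν => ν {r + ((i : ℝ) - 1) * h})
    (impulseMeasure_restrict (α := α) hh H hi)
  simp only [Measure.restrict_apply (measurableSet_singleton _), inter_eq_left.2 hmem] at this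
  rw [Measure.real, Measure.real, this]

theorem impulseMeasure_real_mesh (A : IsRateFamily N α) (hh : 0 < h) (H : IsTimeChange S h φ)
    {i : ℕ} (hi : i ∈ Finset.Icc 0 N) :
    (if i = 0 then 0 else ∫ s in entryTime S φ h..exitTime S φ h, α i s)
      + (if i = N then 0 else ∫ s in entryTime S φ 0..exitTime S φ 0, α (i + 1) s)
      = (impulseMeasure N S h φ α).real {(i : ℝ) * h} := by
  rw [Measure.real, impulseMeasure, Measure.finsetSum_apply, ENNReal.toReal_sum]
  swap
  · intro j hj
    have := isFiniteMeasure_slotMeasure (S := S) (h := h) (φ := φ) A hj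
    exact measure_ne_top _ _
  have hterm : ∀ j ∈ Finset.Icc 1 N, (slotMeasure S h φ α j {(i : ℝ) * h}).toReal
      = (if j = i then ∫ s in entryTime S φ h..exitTime S φ h, α i s else 0)
        + (if j = i + 1 then ∫ s in entryTime S φ 0..exitTime S φ 0, α (i + 1) s else 0) := by
    intro j hj
    by_cases h1 : j = i
    · subst h1
      rw [if_pos rfl, if_neg (Nat.lt_succ_self j).ne, add_zero,
        ← slotMeasure_real_singleton A H hj ⟨hh.le, le_rfl⟩, Measure.real]
      congr 3; ring
    by_cases h2 : j = i + 1
    · subst h2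
      rw [if_neg h1, if_pos rfl, zero_add, ← slotMeasure_real_singleton A H hj ⟨le_rfl, hh.le⟩,
        Measure.real]
      congr 3; push_cast; ring
    rw [if_neg h1, if_neg h2, add_zero, slotMeasure_eq_zero H j, ENNReal.toReal_zero]
    rw [Set.disjoint_singleton_left]
    intro hmem
    rcases lt_or_gt_of_ne h1 with hlt | hlt
    · have : (j : ℝ) + 1 ≤ i := by exact_mod_cast hlt
      nlinarith [hmem.2]
    · have : (i : ℝ) + 1 + 1 ≤ j := by exact_mod_cast (by omega : i + 1 + 1 ≤ j)
      nlinarith [hmem.1]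
  rw [Finset.mem_Icc] at hi
  have e1 : (i ∈ Finset.Icc 1 N) ↔ ¬ i = 0 := by rw [Finset.mem_Icc]; omega
  have e2 : (i + 1 ∈ Finset.Icc 1 N) ↔ ¬ i = N := by rw [Finset.mem_Icc]; omega
  change _ = ∑ j ∈ Finset.Icc 1 N, (slotMeasure S h φ α j {(i : ℝ) * h}).toReal
  rw [Finset.sum_congr rfl hterm, Finset.sum_add_distrib, Finset.sum_ite_eq', Finset.sum_ite_eq']
  simp only [e1, e2, ite_not]

end impulse

end DIS

/-! ### From reparameterized to extended processes -/

namespace DIS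

variable {n : ℕ} {D : DIS n} {S : ℝ} {y : ℕ → ℝ → Vec n} {α : ℕ → ℝ → ℝ}

namespace IsReparameterized

theorem continuousOn (P : D.IsReparameterized S y α) {i : ℕ} (hi : i ∈ Finset.Icc 1 D.N) :
    ContinuousOn (y i) (Icc 0 S) := by
  have := (P.absCont i hi).continuousOn
  rwa [uIcc_of_le P.pos.le] at this

theorem aestronglyMeasurable (P : D.IsReparameterized S y α) {i : ℕ} (hi : i ∈ Finset.Icc 1 D.N) :
    AEStronglyMeasurable (fun s => (y i s, y (i - 1) s)) (volume.restrict (Icc 0 S)) := by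
  have h1 : ∀ j ∈ Finset.Icc 1 D.N, AEStronglyMeasurable (y j) (volume.restrict (Icc 0 S)) :=
    fun j hj => (P.continuousOn hj).aestronglyMeasurable measurableSet_Icc
  refine (h1 i hi).prodMk ?_
  rw [Finset.mem_Icc] at hi
  rcases Nat.eq_zero_or_pos (i - 1) with h0 | h0
  · refine (aestronglyMeasurable_const (b := D.ξ₀)).congr ?_
    rw [h0, Filter.EventuallyEq, ← restrict_Ico_eq_restrict_Icc]
    filter_upwards [ae_restrict_mem measurableSet_Ico] with s hs
    exact (P.y_zero s hs).symm
  · exact h1 _ (Finset.mem_Icc.2 ⟨h0, by omega⟩)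

theorem integrableOn_rhs (P : D.IsReparameterized S y α)
    {F : Vec n × Vec n → Vec n} (hF : Continuous F) (hFb : ∃ C : ℝ, ∀ z, ‖F z‖ ≤ C)
    {i : ℕ} (hi : i ∈ Finset.Icc 1 D.N) {c : ℝ → ℝ} (hc : IntegrableOn c (Icc 0 S)) :
    IntegrableOn (fun s => c s • F (y i s, y (i - 1) s)) (Icc 0 S) := by
  obtain ⟨C, hC⟩ := hFb
  exact Integrable.smul_bdd hc C (hF.comp_aestronglyMeasurable (P.aestronglyMeasurable hi))
    (Filter.Eventually.of_forall fun s => hC _)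

theorem integral_rhs (P : D.IsReparameterized S y α) (A : IsRateFamily D.N α)
    (hf : Continuous D.f) (hg : Continuous D.g)
    (hfb : ∃ C : ℝ, ∀ z, ‖D.f z‖ ≤ C) (hgb : ∃ C : ℝ, ∀ z, ‖D.g z‖ ≤ C)
    {i : ℕ} (hi : i ∈ Finset.Icc 1 D.N) {p q : ℝ} (hp : p ∈ Icc 0 S) (hq : q ∈ Icc 0 S) :
    ∫ s in p..q, ((1 - ∑ j ∈ Finset.Icc 1 D.N, α j s) • D.f (y i s, y (i - 1) s)
        + α i s • D.g (y i s, y (i - 1) s)) = y i q - y i p := by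
  have hsub : uIcc p q ⊆ Icc 0 S := uIcc_subset_Icc hp hq
  refine ((P.absCont i hi).mono
    (by rwa [uIcc_of_le P.pos.le])).integral_eq_sub_of_ae_hasDerivAt ?_ ?_
  · have := P.ode i hi
    rw [ae_restrict_iff' measurableSet_Icc] at this
    filter_upwards [this] with s hs hs' using hs (hsub hs')
  · exact (((P.integrableOn_rhs hf hfb hi (A.integrableOn_speed 0 S)).add
      (P.integrableOn_rhs hg hgb hi (A.integrableOn hi 0 S))).mono_set hsub).intervalIntegrable

theorem exists_lipschitz (P : D.IsReparameterized S y α) (A : IsRateFamily D.N α)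
    (hf : Continuous D.f) (hg : Continuous D.g)
    (hfb : ∃ C : ℝ, ∀ z, ‖D.f z‖ ≤ C) (hgb : ∃ C : ℝ, ∀ z, ‖D.g z‖ ≤ C)
    {i : ℕ} (hi : i ∈ Finset.Icc 1 D.N) :
    ∃ K : NNReal, LipschitzOnWith K (y i) (Icc 0 S) := by
  obtain ⟨Cf, hCf⟩ := id hfb
  obtain ⟨Cg, hCg⟩ := id hgb
  have hf0 := (norm_nonneg _).trans (hCf 0)
  have hg0 := (norm_nonneg _).trans (hCg 0)
  refine ⟨⟨Cf + Cg, add_nonneg hf0 hg0⟩, LipschitzOnWith.of_dist_le_mul fun q hq p hp => ?_⟩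
  rw [dist_eq_norm, ← P.integral_rhs A hf hg hfb hgb hi hp hq, Real.dist_eq]
  refine intervalIntegral.norm_integral_le_of_norm_le_const fun s _ => (norm_add_le _ _).trans ?_
  rw [norm_smul, norm_smul, Real.norm_of_nonneg (A.speed_nonneg s),
    Real.norm_of_nonneg (A.nonneg i hi s)]
  exact add_le_add
    ((mul_le_of_le_one_left (norm_nonneg _) (A.speed_le_one s)).trans (hCf _))
    ((mul_le_of_le_one_left (norm_nonneg _) (A.le_one hi s)).trans (hCg _))

/-- Every reparameterized process with regular rates comes from an extended process: the impulse
measure is the image of `Σ αᵢ ds`, and the plateaus of the clock, rescaled to `[0, 1]`, describe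
the jumps. -/
theorem exists_isExtended (P : D.IsReparameterized S y α) (A : IsRateFamily D.N α)
    (hh : 0 < D.h) (hN : 0 < D.N) (hTN : D.T = D.N * D.h)
    (hf : Continuous D.f) (hg : Continuous D.g)
    (hfb : ∃ C : ℝ, ∀ z, ‖D.f z‖ ≤ C) (hgb : ∃ C : ℝ, ∀ z, ‖D.g z‖ ≤ C) :
    ∃ (x : ℝ → Vec n) (μ : Measure ℝ) (w : ℝ → ℕ → ℝ → ℝ),
      D.IsExtended x μ w ∧ x D.T = y D.N S ∧
      totalVariation D.T μ = ∑ i ∈ Finset.Icc 1 D.N, ∫ s in (0 : ℝ)..S, α i s := by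
  have H : IsTimeChange S D.h (clock D.N α) := A.isTimeChange_clock P.pos P.time
  set φ := clock D.N α with hφ
  set μ := impulseMeasure D.N S D.h φ α with hμ
  have hμf : IsFiniteMeasure μ := isFiniteMeasure_impulseMeasure A
  have hμc : μ (Icc 0 D.T)ᶜ = 0 := by rw [hTN]; exact impulseMeasure_compl H
  obtain ⟨x, x1, x2, x3, x4, x5⟩ := exists_concat hh hN D.ξ₀ D.x₀ (y D.N S)
    (fun i r => y i (exitTime S φ r))
  have h0I : (0 : ℝ) ∈ Icc 0 D.h := ⟨le_rfl, hh.le⟩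
  have hhI : D.h ∈ Icc 0 D.h := ⟨hh.le, le_rfl⟩
  -- On a plateau only the impulsive part of the dynamics is active.
  have hplateau : ∀ i ∈ Finset.Icc 1 D.N, ∀ r ∈ Icc 0 D.h,
      ∫ s in entryTime S φ r..exitTime S φ r, α i s • D.g (y i s, y (i - 1) s)
        = y i (exitTime S φ r) - y i (entryTime S φ r) := by
    intro i hi r hr
    rw [← P.integral_rhs A hf hg hfb hgb hi (H.entryTime_mem hr).1 (H.exitTime_mem hr).1]
    refine (intervalIntegral_congr_ae_Icc (H.entryTime_le_exitTime hr) ?_).symm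
    filter_upwards [A.speed_eq_zero_of_plateau H hr] with s hs
    rw [hs, zero_smul, zero_add]
  set w : ℝ → ℕ → ℝ → ℝ := fun r i s => (exitTime S φ r - entryTime S φ r) *
    α i (entryTime S φ r + (exitTime S φ r - entryTime S φ r) * s) with hw
  have hwint : ∀ r i, ∫ s in (0 : ℝ)..1, w r i s
      = ∫ s in entryTime S φ r..exitTime S φ r, α i s := by
    intro r i
    have := intervalIntegral.smul_integral_comp_add_mul (a := 0) (b := 1) (α i)
      (exitTime S φ r - entryTime S φ r) (entryTime S φ r)
    rw [mul_zero, add_zero, mul_one, add_sub_cancel, smul_eq_mul,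
      ← intervalIntegral.integral_const_mul] at this
    exact this
  have hwm : ∀ r, ∀ i ∈ Finset.Icc 1 D.N, Measurable (w r i) := fun r i hi =>
    ((A.measurable i hi).comp
      (measurable_const.add (measurable_id.const_mul _))).const_mul _
  have hlen : ∀ r ∈ Icc 0 D.h, 0 ≤ exitTime S φ r - entryTime S φ r := fun r hr =>
    sub_nonneg.2 (H.entryTime_le_exitTime hr)
  have hw0 : ∀ r ∈ Icc 0 D.h, ∀ i ∈ Finset.Icc 1 D.N, ∀ s, 0 ≤ w r i s := fun r hr i hi s =>
    mul_nonneg (hlen r hr) (A.nonneg i hi _)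
  have hwsum : ∀ r ∈ Icc 0 D.h, ∀ᵐ s ∂(volume.restrict (Icc (0 : ℝ) 1)),
      ∑ i ∈ Finset.Icc 1 D.N, w r i s = exitTime S φ r - entryTime S φ r := by
    intro r hr
    rcases (hlen r hr).eq_or_lt with h1 | h1
    · refine Filter.Eventually.of_forall fun s => ?_
      simp [hw, ← h1]
    · have := A.speed_eq_zero_of_plateau H hr
      rw [← add_sub_cancel (entryTime S φ r) (exitTime S φ r)] at this
      filter_upwards [ae_restrict_comp_affine h1 this] with s hs
      rw [hw, ← Finset.mul_sum, ← sub_eq_zero.1 hs, mul_one]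
  have hcontrol : D.IsImpulsiveControl μ w := by
    refine ⟨⟨hμf, hμc⟩, fun r _ i hi => (hwm r i hi).aemeasurable,
      fun r hr i hi s _ => hw0 r hr i hi s, fun r hr => ?_, fun r hr i hi => ?_, fun i hi => ?_⟩
    · have hi : ∀ i ∈ Finset.Icc 1 D.N, IntervalIntegrable (w r i) volume 0 1 := by
        intro i hi
        rw [intervalIntegrable_iff_integrableOn_Ioc_of_le zero_le_one]
        refine Integrable.of_bound (hwm r i hi).aestronglyMeasurable
          (exitTime S φ r - entryTime S φ r) (Filter.Eventually.of_forall fun s => ?_)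
        rw [Real.norm_of_nonneg (hw0 r hr i hi s)]
        exact mul_le_of_le_one_right (hlen r hr) (A.le_one hi _)
      have h1 : ∑ i ∈ Finset.Icc 1 D.N, ∫ s' in (0 : ℝ)..1, w r i s'
          = exitTime S φ r - entryTime S φ r := by
        rw [← intervalIntegral.integral_finsetSum hi,
          intervalIntegral_congr_ae_Icc zero_le_one (hwsum r hr)]
        simp
      rw [h1]
      exact hwsum r hr
    · rw [hwint, hμ, impulseMeasure_real_interior A hh H hi hr]
    · rw [hwint, hwint]
      exact impulseMeasure_real_mesh A hh H hi
  have hleft : ∀ i ∈ Finset.Icc 1 D.N, ∀ r ∈ Ioc 0 D.h,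
      Function.leftLim x (r + ((i : ℝ) - 1) * D.h) = y i (entryTime S φ r) := fun i hi r hr =>
    H.leftLim_eq (P.continuousOn hi) (x4 i hi) hr
  have hbv : BoundedVariationOn x (Icc (-D.h) D.T) := by
    rw [hTN]
    refine boundedVariationOn_of_slots hh D.N fun i hi => ?_
    rcases Nat.eq_zero_or_pos i with rfl | hi0
    · have : eVariationOn x (Ioo ((((0 : ℕ) : ℝ) - 1) * D.h) (((0 : ℕ) : ℝ) * D.h)) = 0 := by
        refine eVariationOn.constant_on ?_
        rintro _ ⟨s, hs, rfl⟩ _ ⟨t, ht, rfl⟩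
        rw [Nat.cast_zero, zero_mul] at hs ht
        rw [x1 s hs.2, x1 t ht.2]
      rw [BoundedVariationOn, this]
      exact ENNReal.zero_ne_top
    · have hi1 : i ∈ Finset.Icc 1 D.N := Finset.mem_Icc.2 ⟨hi0, hi⟩
      have hmem : ∀ t ∈ Ioo (((i : ℝ) - 1) * D.h) (i * D.h), t - ((i : ℝ) - 1) * D.h ∈ Ioo 0 D.h :=
        fun t ht => ⟨by linarith [ht.1], by linarith [ht.2]⟩
      have h1 : eVariationOn x (Ioo (((i : ℝ) - 1) * D.h) (i * D.h))
          = eVariationOn (y i ∘ fun t => exitTime S φ (t - ((i : ℝ) - 1) * D.h))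
            (Ioo (((i : ℝ) - 1) * D.h) (i * D.h)) := by
        refine eVariationOn.congr fun t ht => ?_
        have := x4 i hi1 _ (hmem t ht)
        rw [sub_add_cancel] at this
        exact this
      have h2 : BoundedVariationOn (y i) (Icc 0 S) := by
        have := (P.absCont i hi1).boundedVariationOn
        rwa [uIcc_of_le P.pos.le] at this
      rw [BoundedVariationOn, h1]
      refine ne_top_of_le_ne_top h2 (eVariationOn.comp_le_of_monotoneOn _ _ ?_ ?_)
      · intro s hs t ht hst
        exact H.exitTime_monotoneOn (Ioo_subset_Icc_self (hmem s hs))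
          (Ioo_subset_Icc_self (hmem t ht)) (by simpa using hst)
      · exact fun t ht => (H.exitTime_mem (Ioo_subset_Icc_self (hmem t ht))).1
  set ζ : ℝ → ℕ → ℝ → Vec n := fun r i s =>
    if i = 0 then (if s = 1 ∧ r = D.h then D.x₀ else D.ξ₀)
    else y i (entryTime S φ r + (exitTime S φ r - entryTime S φ r) * s) with hζ
  have hζpos : ∀ i ∈ Finset.Icc 1 D.N, ∀ r, ζ r i =
      fun s => y i (entryTime S φ r + (exitTime S φ r - entryTime S φ r) * s) := by
    intro i hi r
    have : i ≠ 0 := by have := (Finset.mem_Icc.1 hi).1; omega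
    simp [hζ, this]
  have hζ0 : ∀ i ∈ Finset.Icc 1 D.N, ∀ r, ζ r i 0 = y i (entryTime S φ r) := fun i hi r => by
    rw [hζpos i hi]; simp
  have hζ1 : ∀ i ∈ Finset.Icc 1 D.N, ∀ r, ζ r i 1 = y i (exitTime S φ r) := fun i hi r => by
    rw [hζpos i hi]; simp
  have hjump : D.IsJumpFamily x w ζ := by
    refine ⟨fun r hr s hs hne => ?_, by simp [hζ], fun r hr i hi => ?_, fun r hr i hi => ?_,
      fun r hr i hi => by rw [hζ0 i hi, hleft i hi r hr], fun i hi => ?_⟩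
    · have : ¬ (s = 1 ∧ r = D.h) := by tauto
      simp [hζ, this]
    · obtain ⟨K, hK⟩ := P.exists_lipschitz A hf hg hfb hgb hi
      rw [hζpos i hi]
      have hl : LipschitzOnWith (Real.nnabs (exitTime S φ r - entryTime S φ r))
          (fun s => entryTime S φ r + (exitTime S φ r - entryTime S φ r) * s) (uIcc 0 1) := by
        refine LipschitzOnWith.of_dist_le_mul fun s _ t _ => ?_
        rw [dist_add_left, Real.dist_eq, ← mul_sub, abs_mul, Real.dist_eq, Real.coe_nnabs]
      refine (hK.comp hl fun s hs => ?_).absolutelyContinuousOnInterval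
      rw [uIcc_of_le zero_le_one] at hs
      have h1 := (H.entryTime_mem hr).1.1
      have h2 := (H.exitTime_mem hr).1.2
      have h3 := hlen r hr
      constructor <;> nlinarith [hs.1, hs.2]
    · rcases (hlen r hr).eq_or_lt with h1 | h1
      · refine Filter.Eventually.of_forall fun s => ?_
        rw [hζpos i hi]
        simp only [hw, ← h1, zero_mul, zero_smul]
        exact hasDerivAt_const _ _
      · have hsub : Icc (entryTime S φ r) (exitTime S φ r) ⊆ Icc 0 S :=
          Icc_subset_Icc (H.entryTime_mem hr).1.1 (H.exitTime_mem hr).1.2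
        have h2 : ∀ᵐ u ∂volume.restrict (Icc (entryTime S φ r) (exitTime S φ r)),
            HasDerivAt (y i) (α i u • D.g (y i u, y (i - 1) u)) u := by
          filter_upwards [A.speed_eq_zero_of_plateau H hr,
            ae_restrict_of_ae_restrict_of_subset hsub (P.ode i hi)] with u hu hu2
          rwa [hu, zero_smul, zero_add] at hu2
        rw [← add_sub_cancel (entryTime S φ r) (exitTime S φ r)] at h2
        rw [← restrict_Ico_eq_restrict_Icc]
        filter_upwards [ae_restrict_of_ae_restrict_of_subset Ico_subset_Icc_self
          (ae_restrict_comp_affine h1 h2), ae_restrict_mem measurableSet_Ico] with s hs hs1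
        have h3 : ζ r (i - 1) s
            = y (i - 1) (entryTime S φ r + (exitTime S φ r - entryTime S φ r) * s) := by
          rcases Nat.eq_zero_or_pos (i - 1) with h0 | h0
          · have hS : entryTime S φ r + (exitTime S φ r - entryTime S φ r) * s ∈ Ico 0 S := by
              have := (H.entryTime_mem hr).1.1
              have := (H.exitTime_mem hr).1.2
              constructor <;> nlinarith [hs1.1, hs1.2]
            rw [h0, P.y_zero _ hS]
            simp [hζ, hs1.2.ne]
          · rw [hζpos _ (Finset.mem_Icc.2 ⟨h0, (Nat.sub_le _ _).trans (Finset.mem_Icc.1 hi).2⟩)]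
        rw [h3, hζpos i hi]
        have hd : HasDerivAt (fun s : ℝ => entryTime S φ r +
            (exitTime S φ r - entryTime S φ r) * s) (exitTime S φ r - entryTime S φ r) s := by
          simpa using ((hasDerivAt_id s).const_mul
            (exitTime S φ r - entryTime S φ r)).const_add (entryTime S φ r)
        simpa only [hw, mul_smul] using! hs.scomp s hd
    · rw [hζ0 i hi, H.entryTime_zero]
      obtain ⟨j, rfl⟩ := Nat.exists_eq_add_of_le' (Finset.mem_Icc.1 hi).1
      have hj := (Finset.mem_Icc.1 hi).2
      rw [P.link j (Finset.mem_range.2 hj), Nat.add_sub_cancel]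
      rcases Nat.eq_zero_or_pos j with rfl | h0
      · simp [hζ, P.y_zero_end]
      · rw [hζ1 j (Finset.mem_Icc.2 ⟨h0, by omega⟩), H.exitTime_top]
  have hkey : ∀ i ∈ Finset.Icc 1 D.N, ∀ t ∈ Ioo (((i : ℝ) - 1) * D.h) ((i : ℝ) * D.h),
      HasSum (fun r : Ioc 0 (t - ((i : ℝ) - 1) * D.h) =>
        ζ r i 1 - Function.leftLim x (r + ((i : ℝ) - 1) * D.h))
        (x t - ζ 0 i 1
          - (∫ t' in (((i : ℝ) - 1) * D.h)..t, D.f (x t', x (t' - D.h)))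
          - (∫ t' in Icc (((i : ℝ) - 1) * D.h) t, D.g (x t', x (t' - D.h)) ∂(continuousPart μ))) := by
    intro i hi t ht
    have hr : t - ((i : ℝ) - 1) * D.h ∈ Ioo 0 D.h := ⟨by linarith [ht.1], by linarith [ht.2]⟩
    have e : ((i : ℝ) - 1) * D.h + D.h = i * D.h := by ring
    have ha := mem_slot hi h0I
    have haT := mem_slot hi hhI
    have key := hasSum_jumps hf hg hfb hgb H hbv (μ := μ) (a := ((i : ℝ) - 1) * D.h)
      (by simpa using ha.1) (by rw [hTN]; linarith [haT.2]) (A.integrableOn hi 0 S)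
      (Filter.Eventually.of_forall (A.nonneg i hi)) (A.integrableOn_speed 0 S)
      (Filter.Eventually.of_forall A.speed_nonneg)
      (by rw [e]; exact impulseMeasure_restrict hh H hi) (A.map_clock H)
      (P.aestronglyMeasurable hi) ?_ (t := t) (by rw [e]; exact ht)
    · rw [P.integral_rhs A hf hg hfb hgb hi (H.exitTime_mem h0I).1
        (H.exitTime_mem (Ioo_subset_Icc_self hr)).1] at key
      have hxt := x4 i hi _ hr
      rw [sub_add_cancel] at hxt
      rw [hζ1 i hi, hxt]
      convert key using 1
      ext1 r
      have hrI : (r : ℝ) ∈ Ioc 0 D.h := ⟨r.2.1, r.2.2.trans hr.2.le⟩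
      rw [hζ1 i hi, hleft i hi r hrI, hplateau i hi r (Ioc_subset_Icc_self hrI)]
    · -- Off the plateaus the parameter is recovered from the time of the original system.
      intro s hs hφs heq
      have hφI := Ioo_subset_Icc_self hφs
      have hse : exitTime S φ (φ s) = s :=
        le_antisymm (heq ▸ (H.entryTime_le_iff hφI hs).2 le_rfl) ((H.le_exitTime_iff hφI hs).2 le_rfl)
      have h1 := x4 i hi (φ s) hφs
      rw [hse] at h1
      rw [h1]
      congr 1
      rcases Nat.eq_zero_or_pos (i - 1) with h0 | h0
      · have hi1 : i = 1 := by have := (Finset.mem_Icc.1 hi).1; omega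
        have hsS : s < S := by
          by_contra! hle
          have := H.mono hle
          rw [H.map_top] at this
          exact hφs.2.not_ge this
        rw [h0, P.y_zero s ⟨hs.1, hsS⟩, x1]
        rw [hi1]; push_cast; linarith [hφs.2]
      · have h2 := x4 (i - 1)
          (Finset.mem_Icc.2 ⟨h0, (Nat.sub_le _ _).trans (Finset.mem_Icc.1 hi).2⟩) (φ s) hφs
        rw [hse] at h2
        rw [← h2, Nat.cast_sub (Finset.mem_Icc.1 hi).1]
        congr 1; push_cast; ring
  refine ⟨x, μ, w, ⟨hbv, hcontrol, ζ, hjump, ?_⟩, by rw [hTN]; exact x3, ?_⟩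
  · refine ⟨fun t ht => x1 t ht.2, x2, fun i hi => ?_, ?_, fun i hi t ht => (hkey i hi t ht).summable,
      fun i hi t ht => ?_⟩
    · rw [x5 i hi, hζ1 i (Finset.Icc_subset_Icc_left (by norm_num) hi)]
    · rw [hTN, x3, hζ1 D.N (Finset.mem_Icc.2 ⟨hN, le_rfl⟩), H.exitTime_top]
    · rw [(hkey i hi t ht).tsum_eq]; abel
  · rw [totalVariation, ← impulseMeasure_real_univ A H, ← hμ]
    have h1 : μ.real (Icc 0 D.T)ᶜ = 0 := by rw [Measure.real, hμc, ENNReal.toReal_zero]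
    have := measureReal_add_measureReal_compl (μ := μ) (measurableSet_Icc (a := (0:ℝ)) (b := D.T))
    linarith

end IsReparameterized

end DIS

/-! ### The time change with a prescribed image measure -/

/-- Generalized inverse of the distribution function of a finite measure `ν` on `[0, h]`: the time
change of `[0, ν [0, h]]` onto `[0, h]` whose plateaus are the atoms of `ν`. -/
noncomputable def inverseDistribution (h : ℝ) (ν : Measure ℝ) (s : ℝ) : ℝ :=
  sInf {r ∈ Icc 0 h | min s (ν.real univ) ≤ ν.real (Iic r)}

section inverseDistribution

variable {h : ℝ} {ν : Measure ℝ} [IsFiniteMeasure ν]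

theorem measureReal_Iic_of_ge (hν : ν (Icc 0 h)ᶜ = 0) {r : ℝ} (hr : h ≤ r) :
    ν.real (Iic r) = ν.real univ := by
  have h0 : ν (Iic r)ᶜ = 0 := measure_mono_null
    (compl_subset_compl.2 fun t ht => ht.2.trans hr) hν
  have := measureReal_add_measureReal_compl (μ := ν) (measurableSet_Iic (a := r))
  rw [Measure.real, Measure.real, h0, ENNReal.toReal_zero, add_zero] at this
  exact this

theorem inverseDistribution_mem (hh : 0 ≤ h) (hν : ν (Icc 0 h)ᶜ = 0) (s : ℝ) :
    inverseDistribution h ν s ∈ {r ∈ Icc 0 h | min s (ν.real univ) ≤ ν.real (Iic r)} := by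
  set K := {r ∈ Icc 0 h | min s (ν.real univ) ≤ ν.real (Iic r)} with hK
  have hne : K.Nonempty :=
    ⟨h, ⟨hh, le_rfl⟩, by rw [measureReal_Iic_of_ge hν le_rfl]; exact min_le_right _ _⟩
  have hbd : BddBelow K := ⟨0, fun r hr => hr.1.1⟩
  have h1 : sInf K ∈ Icc 0 h := by
    refine ⟨le_csInf hne fun r hr => hr.1.1, ?_⟩
    obtain ⟨r, hr⟩ := hne
    exact (csInf_le hbd hr).trans hr.1.2
  refine ⟨h1, ?_⟩
  -- The distribution function is right-continuous, so the infimum is attained.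
  have h2 := tendsto_measure_biInter_gt (μ := ν) (s := fun r : ℝ => Iic r) (a := sInf K)
    (fun r _ => measurableSet_Iic.nullMeasurableSet) (fun i j _ hij => Iic_subset_Iic.2 hij)
    ⟨sInf K + 1, by simp, measure_ne_top _ _⟩
  have h3 : ⋂ r > sInf K, Iic r = Iic (sInf K) := by
    ext t
    simp only [mem_iInter, mem_Iic]
    exact ⟨fun H => le_of_forall_gt_imp_ge_of_dense fun r hr => H r hr, fun H r hr => H.trans hr.le⟩
  rw [h3] at h2
  have h4 := (ENNReal.tendsto_toReal (measure_ne_top ν (Iic (sInf K)))).comp h2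
  refine ge_of_tendsto h4 ?_
  filter_upwards [self_mem_nhdsWithin] with r hr
  obtain ⟨k, hk, hkr⟩ := exists_lt_of_csInf_lt hne hr
  exact hk.2.trans (measureReal_mono (Iic_subset_Iic.2 hkr.le))

theorem inverseDistribution_le_iff (hh : 0 ≤ h) (hν : ν (Icc 0 h)ᶜ = 0) {s r : ℝ}
    (hr : r ∈ Icc 0 h) :
    inverseDistribution h ν s ≤ r ↔ min s (ν.real univ) ≤ ν.real (Iic r) := by
  refine ⟨fun hle => (inverseDistribution_mem hh hν s).2.trans
    (measureReal_mono (Iic_subset_Iic.2 hle)), fun hle => ?_⟩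
  exact csInf_le ⟨0, fun r hr => hr.1.1⟩ ⟨hr, hle⟩

theorem add_sub_le_measureReal_Iic (hvol : volume.restrict (Icc 0 h) ≤ ν) {r r' : ℝ}
    (hr : 0 ≤ r) (hrr : r ≤ r') (hr' : r' ≤ h) :
    ν.real (Iic r) + (r' - r) ≤ ν.real (Iic r') := by
  have h1 : Iic r' = Iic r ∪ Ioc r r' := (Iic_union_Ioc_eq_Iic hrr).symm
  rw [h1, measureReal_union (Iic_disjoint_Ioc le_rfl) measurableSet_Ioc]
  have h2 : r' - r ≤ ν.real (Ioc r r') := by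
    have h3 := hvol (Ioc r r')
    rw [Measure.restrict_apply measurableSet_Ioc, inter_eq_left.2
      (Ioc_subset_Icc_self.trans (Icc_subset_Icc hr hr')), Real.volume_Ioc] at h3
    exact (ENNReal.ofReal_le_iff_le_toReal (measure_ne_top _ _)).1 h3
  linarith

theorem isTimeChange_inverseDistribution (hh : 0 < h) (hν : ν (Icc 0 h)ᶜ = 0)
    (hvol : volume.restrict (Icc 0 h) ≤ ν) :
    IsTimeChange (ν.real univ) h (inverseDistribution h ν) := by
  have hmem := inverseDistribution_mem (ν := ν) hh.le hν
  have hS : 0 < ν.real univ := by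
    have h1 := add_sub_le_measureReal_Iic hvol le_rfl hh.le le_rfl
    have h2 : ν.real (Iic h) ≤ ν.real univ := measureReal_mono (subset_univ _)
    have h3 : 0 ≤ ν.real (Iic 0) := measureReal_nonneg
    linarith
  refine ⟨hS, (LipschitzWith.of_le_add (fun s s' => ?_)).continuous, fun s s' hss => ?_, ?_, ?_⟩
  · rcases le_or_gt h (inverseDistribution h ν s' + dist s s') with h1 | h1
    · exact (hmem s).1.2.trans h1
    · have h0 := (hmem s').1.1
      have hd : 0 ≤ dist s s' := dist_nonneg
      rw [inverseDistribution_le_iff hh.le hν ⟨by linarith, h1.le⟩]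
      have h2 := add_sub_le_measureReal_Iic hvol h0 (le_add_of_nonneg_right hd) h1.le
      have h3 := (hmem s').2
      have h4 : s ≤ s' + dist s s' := by
        have := le_abs_self (s - s')
        rw [Real.dist_eq]; linarith
      have h5 : min s (ν.real univ) ≤ min s' (ν.real univ) + dist s s' := by
        rw [← min_add_add_right]
        exact min_le_min h4 (le_add_of_nonneg_right hd)
      linarith
  · rw [inverseDistribution_le_iff hh.le hν (hmem s').1]
    exact (min_le_min_right _ hss).trans (hmem s').2
  · refine le_antisymm ?_ (hmem 0).1.1
    rw [inverseDistribution_le_iff hh.le hν ⟨le_rfl, hh.le⟩]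
    exact (min_le_left _ _).trans measureReal_nonneg
  · refine le_antisymm (hmem _).1.2 ?_
    have h1 := (hmem (ν.real univ)).2
    rw [min_self] at h1
    have h2 := add_sub_le_measureReal_Iic hvol (hmem (ν.real univ)).1.1 (hmem (ν.real univ)).1.2 le_rfl
    rw [measureReal_Iic_of_ge hν le_rfl] at h2
    linarith

theorem map_inverseDistribution (hh : 0 < h) (hν : ν (Icc 0 h)ᶜ = 0)
    (hvol : volume.restrict (Icc 0 h) ≤ ν) :
    (volume.restrict (Icc 0 (ν.real univ))).map (inverseDistribution h ν) = ν := by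
  have H := isTimeChange_inverseDistribution hh hν hvol
  set φ := inverseDistribution h ν
  have : IsFiniteMeasure ((volume.restrict (Icc 0 (ν.real univ))).map φ) :=
    Measure.isFiniteMeasure_map _ _
  refine Measure.ext_of_Iic _ _ fun r => ?_
  rw [← measureReal_eq_measureReal_iff, map_measureReal_apply H.cont.measurable measurableSet_Iic,
    measureReal_restrict_apply (H.cont.measurable measurableSet_Iic)]
  rcases lt_or_ge r 0 with hr | hr
  · have e1 : φ ⁻¹' Iic r ∩ Icc 0 (ν.real univ) = ∅ := by
      ext s
      simp only [mem_inter_iff, mem_preimage, mem_Iic, mem_empty_iff_false, iff_false, not_and]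
      intro h1 h2
      linarith [(H.mapsTo h2).1]
    have e2 : ν (Iic r) = 0 :=
      measure_mono_null (show Iic r ⊆ (Icc 0 h)ᶜ from
        fun t ht ht' => (lt_of_le_of_lt ht hr).not_ge ht'.1) hν
    rw [e1, Measure.real, Measure.real, e2, measure_empty]
  rcases lt_or_ge h r with hr' | hr'
  · have e1 : φ ⁻¹' Iic r ∩ Icc 0 (ν.real univ) = Icc 0 (ν.real univ) :=
      inter_eq_right.2 fun s hs => (H.mapsTo hs).2.trans hr'.le
    rw [e1, measureReal_Iic_of_ge hν hr'.le]
    simp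
  · have e1 : φ ⁻¹' Iic r ∩ Icc 0 (ν.real univ) = Icc 0 (ν.real (Iic r)) := by
      ext s
      simp only [mem_inter_iff, mem_preimage, mem_Iic, mem_Icc]
      rw [inverseDistribution_le_iff hh.le hν ⟨hr, hr'⟩]
      have hle : ν.real (Iic r) ≤ ν.real univ := measureReal_mono (subset_univ _)
      constructor
      · rintro ⟨h1, h2, h3⟩
        rw [min_eq_left h3] at h1
        exact ⟨h2, h1⟩
      · rintro ⟨h1, h2⟩
        exact ⟨(min_le_left _ _).trans h2, h1, h2.trans hle⟩
    rw [e1]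
    simp

theorem exitTime_sub_entryTime (hh : 0 < h) (hν : ν (Icc 0 h)ᶜ = 0)
    (hvol : volume.restrict (Icc 0 h) ≤ ν) {r : ℝ} (hr : r ∈ Icc 0 h) :
    exitTime (ν.real univ) (inverseDistribution h ν) r
      - entryTime (ν.real univ) (inverseDistribution h ν) r = ν.real {r} := by
  have H := isTimeChange_inverseDistribution hh hν hvol
  have e := congrArg (fun κ : Measure ℝ => κ.real {r}) (map_inverseDistribution hh hν hvol)
  rw [← e, map_measureReal_apply H.cont.measurable (measurableSet_singleton _),
    measureReal_restrict_apply (H.cont.measurable (measurableSet_singleton _)), inter_comm,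
    H.fiber_eq hr]
  simp [H.entryTime_le_exitTime hr]

end inverseDistribution

/-- Two measures agree if they agree on the points of a countable set and off that set. -/
theorem MeasureTheory.Measure.ext_of_countable {κ₁ κ₂ : Measure ℝ} {C : Set ℝ} (hC : C.Countable)
    (h1 : κ₁.restrict Cᶜ = κ₂.restrict Cᶜ) (h2 : ∀ c ∈ C, κ₁ {c} = κ₂ {c}) : κ₁ = κ₂ := by
  have h3 : κ₁.restrict C = κ₂.restrict C := by
    have := (Measure.restrict_biUnion_congr (μ := κ₁) (ν := κ₂) (t := fun c => {c}) hC).2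
      fun c hc => by rw [Measure.restrict_singleton, Measure.restrict_singleton, h2 c hc]
    simpa using this
  rw [← Measure.restrict_add_restrict_compl (μ := κ₁) hC.measurableSet, h1, h3,
    Measure.restrict_add_restrict_compl hC.measurableSet]

namespace IsTimeChange

variable {S h : ℝ} {φ : ℝ → ℝ} {C : Set ℝ}

theorem Icc_eq_union (H : IsTimeChange S h φ) (hC : C ⊆ Icc 0 h) :
    Icc 0 S = (Icc 0 S ∩ φ ⁻¹' Cᶜ) ∪ ⋃ r ∈ C, Icc (entryTime S φ r) (exitTime S φ r) := by
  have e : ⋃ r ∈ C, Icc (entryTime S φ r) (exitTime S φ r) = Icc 0 S ∩ φ ⁻¹' C := by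
    ext s
    simp only [mem_iUnion, exists_prop, mem_inter_iff, mem_preimage]
    constructor
    · rintro ⟨r, hr, hs⟩
      have := (H.fiber_eq (hC hr)).ge hs
      exact ⟨this.1, by rw [this.2]; exact hr⟩
    · rintro ⟨h1, h2⟩
      exact ⟨φ s, h2, (H.fiber_eq (hC h2)).le ⟨h1, rfl⟩⟩
  rw [e, ← inter_union_distrib_left, ← preimage_union, compl_union_self, preimage_univ, inter_univ]

/-- A property holds almost everywhere if it does so off a countable family of plateaus, and on
each of them. -/
theorem ae_of_plateaus (H : IsTimeChange S h φ) (hC : C ⊆ Icc 0 h) (hCc : C.Countable)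
    {Q : ℝ → Prop} (h1 : ∀ᵐ s ∂volume.restrict (Icc 0 S), φ s ∉ C → Q s)
    (h2 : ∀ r ∈ C, ∀ᵐ s ∂volume.restrict (Icc (entryTime S φ r) (exitTime S φ r)), Q s) :
    ∀ᵐ s ∂volume.restrict (Icc 0 S), Q s := by
  have h3 : ∀ᵐ s ∂(volume : Measure ℝ), ∀ r ∈ C, s ∈ Icc (entryTime S φ r) (exitTime S φ r) → Q s :=
    (ae_ball_iff hCc).2 fun r hr => (ae_restrict_iff' measurableSet_Icc).1 (h2 r hr)
  rw [ae_restrict_iff' measurableSet_Icc] at h1 ⊢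
  filter_upwards [h1, h3] with s hs1 hs3 hs
  by_cases h : φ s ∈ C
  · exact hs3 (φ s) h ((H.fiber_eq (hC h)).le ⟨hs, rfl⟩)
  · exact hs1 hs h

theorem aestronglyMeasurable_of_plateaus {E : Type*} [TopologicalSpace E]
    [TopologicalSpace.PseudoMetrizableSpace E] (H : IsTimeChange S h φ) (hC : C ⊆ Icc 0 h)
    (hCc : C.Countable) {F G : ℝ → E} (hG : StronglyMeasurable G)
    (h1 : ∀ s ∈ Icc 0 S, φ s ∉ C → F s = G s)
    (h2 : ∀ r ∈ C, AEStronglyMeasurable F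
      (volume.restrict (Icc (entryTime S φ r) (exitTime S φ r)))) :
    AEStronglyMeasurable F (volume.restrict (Icc 0 S)) := by
  have : Countable C := hCc.to_subtype
  rw [H.Icc_eq_union hC, biUnion_eq_iUnion, aestronglyMeasurable_union_iff,
    aestronglyMeasurable_iUnion_iff]
  refine ⟨?_, fun r => h2 r r.2⟩
  refine hG.aestronglyMeasurable.congr ?_
  filter_upwards [ae_restrict_mem
    (measurableSet_Icc.inter (H.cont.measurable hCc.measurableSet.compl))] with s hs
  exact (h1 s hs.1 hs.2).symm

end IsTimeChange

/-! ### The parameter measure of an impulsive control -/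

namespace DIS

variable {n : ℕ} {D : DIS n} {μ : Measure ℝ} {w : ℝ → ℕ → ℝ → ℝ}

/-- The part of the impulsive control acting on the slot `[(i - 1) h, i h]`, moved to `[0, h]`: the
measure `μ` inside the slot, and the shares `w^0_i` and `w^h_i` of the impulses at its ends. -/
noncomputable def slotPart (h : ℝ) (μ : Measure ℝ) (w : ℝ → ℕ → ℝ → ℝ) (i : ℕ) : Measure ℝ :=
  (μ.restrict (Ioo (((i : ℝ) - 1) * h) (i * h))).map (fun t => t - ((i : ℝ) - 1) * h)
    + ENNReal.ofReal (∫ s in (0 : ℝ)..1, w 0 i s) • Measure.dirac 0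
    + ENNReal.ofReal (∫ s in (0 : ℝ)..1, w h i s) • Measure.dirac h

/-- The measure on `[0, h]` whose distribution function gives the parameter of the reparameterized
process: Lebesgue measure plus the impulses of all the slots. -/
noncomputable def parameterMeasure (N : ℕ) (h : ℝ) (μ : Measure ℝ) (w : ℝ → ℕ → ℝ → ℝ) :
    Measure ℝ := volume.restrict (Icc 0 h) + ∑ i ∈ Finset.Icc 1 N, slotPart h μ w i

theorem isFiniteMeasure_slotPart [IsFiniteMeasure μ] (h : ℝ) (i : ℕ) :
    IsFiniteMeasure (slotPart h μ w i) := by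
  have := Measure.isFiniteMeasure_map (μ.restrict (Ioo (((i : ℝ) - 1) * h) (i * h)))
    (fun t => t - ((i : ℝ) - 1) * h)
  have h1 := Measure.smul_finite (Measure.dirac (0 : ℝ))
    (c := ENNReal.ofReal (∫ s in (0 : ℝ)..1, w 0 i s)) ENNReal.ofReal_ne_top
  have h2 := Measure.smul_finite (Measure.dirac h)
    (c := ENNReal.ofReal (∫ s in (0 : ℝ)..1, w h i s)) ENNReal.ofReal_ne_top
  unfold slotPart
  infer_instance

theorem isFiniteMeasure_parameterMeasure [IsFiniteMeasure μ] (N : ℕ) (h : ℝ) :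
    IsFiniteMeasure (parameterMeasure N h μ w) := by
  constructor
  rw [parameterMeasure, Measure.add_apply, Measure.finsetSum_apply]
  exact ENNReal.add_lt_top.2 ⟨by simp, ENNReal.sum_lt_top.2 fun i _ =>
    (isFiniteMeasure_slotPart h i).measure_univ_lt_top⟩

theorem slotPart_le {N : ℕ} {h : ℝ} {i : ℕ} (hi : i ∈ Finset.Icc 1 N) :
    slotPart h μ w i ≤ parameterMeasure N h μ w := by
  refine Measure.le_iff.2 fun B _ => ?_
  rw [parameterMeasure, Measure.add_apply, Measure.finsetSum_apply]
  exact (Finset.single_le_sum (f := fun j => slotPart h μ w j B) (fun _ _ => zero_le) hi).trans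
    le_add_self

theorem volume_le_parameterMeasure (N : ℕ) (h : ℝ) :
    volume.restrict (Icc 0 h) ≤ parameterMeasure N h μ w := Measure.le_add_right le_rfl

theorem slotPart_compl {h : ℝ} (hh : 0 ≤ h) (i : ℕ) : slotPart h μ w i (Icc 0 h)ᶜ = 0 := by
  have hm : Measurable fun t : ℝ => t - ((i : ℝ) - 1) * h := measurable_id.sub_const _
  rw [slotPart, Measure.add_apply, Measure.add_apply, Measure.smul_apply, Measure.smul_apply,
    Measure.map_apply hm measurableSet_Icc.compl,
    Measure.restrict_apply (hm measurableSet_Icc.compl)]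
  have : (fun t : ℝ => t - ((i : ℝ) - 1) * h) ⁻¹' (Icc 0 h)ᶜ
      ∩ Ioo (((i : ℝ) - 1) * h) (i * h) = ∅ := by
    ext t
    simp only [mem_inter_iff, mem_preimage, mem_compl_iff, mem_empty_iff_false, iff_false, not_and]
    exact fun h1 h2 => h1 ⟨by linarith [h2.1], by linarith [h2.2]⟩
  rw [this]
  simp [hh]

theorem parameterMeasure_compl {h : ℝ} (hh : 0 ≤ h) (N : ℕ) :
    parameterMeasure N h μ w (Icc 0 h)ᶜ = 0 := by
  rw [parameterMeasure, Measure.add_apply, Measure.finsetSum_apply,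
    Measure.restrict_apply measurableSet_Icc.compl, compl_inter_self, measure_empty, zero_add]
  exact Finset.sum_eq_zero fun i _ => slotPart_compl hh i

theorem slotPart_restrict {h : ℝ} (i : ℕ) :
    ((slotPart h μ w i).map fun r => r + ((i : ℝ) - 1) * h).restrict
      (Ioo (((i : ℝ) - 1) * h) (i * h)) = μ.restrict (Ioo (((i : ℝ) - 1) * h) (i * h)) := by
  have hm : Measurable fun t : ℝ => t - ((i : ℝ) - 1) * h := measurable_id.sub_const _
  have hm' : Measurable fun t : ℝ => t + ((i : ℝ) - 1) * h := measurable_id.add_const _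
  ext B hB
  have hBI := hB.inter (measurableSet_Ioo (a := ((i : ℝ) - 1) * h) (b := i * h))
  rw [Measure.restrict_apply hB, Measure.restrict_apply hB, Measure.map_apply hm' hBI, slotPart,
    Measure.add_apply, Measure.add_apply, Measure.smul_apply, Measure.smul_apply,
    Measure.map_apply hm (hm' hBI), Measure.restrict_apply (hm (hm' hBI)),
    Measure.dirac_apply' _ (hm' hBI), Measure.dirac_apply' _ (hm' hBI)]
  have e0 : (0 : ℝ) ∉ (fun t : ℝ => t + ((i : ℝ) - 1) * h) ⁻¹'
      (B ∩ Ioo (((i : ℝ) - 1) * h) (i * h)) := fun h1 => by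
    have := h1.2.1; simp at this
  have e1 : h ∉ (fun t : ℝ => t + ((i : ℝ) - 1) * h) ⁻¹'
      (B ∩ Ioo (((i : ℝ) - 1) * h) (i * h)) := fun h1 => by
    have := h1.2.2; simp only at this; linarith
  rw [indicator_of_notMem e0, indicator_of_notMem e1, smul_zero, smul_zero, add_zero, add_zero]
  congr 1
  ext t
  simp only [mem_inter_iff, mem_preimage, sub_add_cancel]
  tauto

namespace IsImpulsiveControl

theorem integral_nonneg (K : D.IsImpulsiveControl μ w) {r : ℝ} (hr : r ∈ Icc 0 D.h) {i : ℕ}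
    (hi : i ∈ Finset.Icc 1 D.N) : 0 ≤ ∫ s in (0 : ℝ)..1, w r i s :=
  intervalIntegral.integral_nonneg zero_le_one fun s hs => K.nonneg r hr i hi s hs

theorem ae_le (K : D.IsImpulsiveControl μ w) {r : ℝ} (hr : r ∈ Icc 0 D.h) {i : ℕ}
    (hi : i ∈ Finset.Icc 1 D.N) : ∀ᵐ s ∂volume.restrict (Icc (0 : ℝ) 1),
      ‖w r i s‖ ≤ ∑ j ∈ Finset.Icc 1 D.N, ∫ s' in (0 : ℝ)..1, w r j s' := by
  filter_upwards [K.sum_eq r hr, ae_restrict_mem measurableSet_Icc] with s hs hs'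
  rw [← hs, Real.norm_of_nonneg (K.nonneg r hr i hi s hs')]
  exact Finset.single_le_sum (f := fun j => w r j s) (fun j hj => K.nonneg r hr j hj s hs') hi

theorem integrableOn (K : D.IsImpulsiveControl μ w) {r : ℝ} (hr : r ∈ Icc 0 D.h) {i : ℕ}
    (hi : i ∈ Finset.Icc 1 D.N) : IntegrableOn (w r i) (Icc 0 1) :=
  Integrable.of_bound (K.measurable r hr i hi).aestronglyMeasurable _ (K.ae_le hr hi)

theorem slotPart_singleton (K : D.IsImpulsiveControl μ w) (hh : 0 < D.h) {r : ℝ}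
    (hr : r ∈ Icc 0 D.h) {i : ℕ} (hi : i ∈ Finset.Icc 1 D.N) :
    slotPart D.h μ w i {r} = ENNReal.ofReal (∫ s in (0 : ℝ)..1, w r i s) := by
  have := K.measure.finite
  have hm : Measurable fun t : ℝ => t - ((i : ℝ) - 1) * D.h := measurable_id.sub_const _
  have e : (fun t : ℝ => t - ((i : ℝ) - 1) * D.h) ⁻¹' {r} = {r + ((i : ℝ) - 1) * D.h} := by
    ext t; simp [sub_eq_iff_eq_add]
  rw [slotPart, Measure.add_apply, Measure.add_apply, Measure.smul_apply, Measure.smul_apply,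
    Measure.map_apply hm (measurableSet_singleton _), e,
    Measure.restrict_apply (measurableSet_singleton _),
    Measure.dirac_apply' _ (measurableSet_singleton _),
    Measure.dirac_apply' _ (measurableSet_singleton _)]
  rcases hr.1.eq_or_lt with h0 | h0
  · subst h0
    have : {0 + ((i : ℝ) - 1) * D.h} ∩ Ioo (((i : ℝ) - 1) * D.h) (i * D.h) = ∅ := by
      rw [Set.singleton_inter_eq_empty]; simp
    simp [hh.ne']
  rcases hr.2.eq_or_lt with h1 | h1
  · subst h1
    have : {D.h + ((i : ℝ) - 1) * D.h} ∩ Ioo (((i : ℝ) - 1) * D.h) (i * D.h) = ∅ := by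
      rw [Set.singleton_inter_eq_empty]
      intro h2; linarith [h2.2]
    simp [this, hh.ne]
  · have : {r + ((i : ℝ) - 1) * D.h} ∩ Ioo (((i : ℝ) - 1) * D.h) (i * D.h)
        = {r + ((i : ℝ) - 1) * D.h} := by
      rw [Set.inter_eq_left, singleton_subset_iff]
      constructor <;> linarith
    rw [this, K.atom_interior r ⟨h0, h1⟩ i hi, Measure.real,
      ENNReal.ofReal_toReal (measure_ne_top _ _)]
    simp [h0.ne, h1.ne']

theorem parameterMeasure_singleton (K : D.IsImpulsiveControl μ w) (hh : 0 < D.h) {r : ℝ}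
    (hr : r ∈ Icc 0 D.h) : (parameterMeasure D.N D.h μ w).real {r}
      = ∑ i ∈ Finset.Icc 1 D.N, ∫ s in (0 : ℝ)..1, w r i s := by
  have h1 : volume.restrict (Icc 0 D.h) {r} = 0 := by simp
  rw [Measure.real, parameterMeasure, Measure.add_apply, Measure.finsetSum_apply, h1, zero_add,
    ENNReal.toReal_sum]
  · refine Finset.sum_congr rfl fun i hi => ?_
    rw [K.slotPart_singleton hh hr hi, ENNReal.toReal_ofReal (K.integral_nonneg hr hi)]
  · intro i hi
    rw [K.slotPart_singleton hh hr hi]; exact ENNReal.ofReal_ne_top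

end IsImpulsiveControl

theorem measureReal_Icc_mesh [IsFiniteMeasure μ] {h : ℝ} (hh : 0 < h) (N : ℕ) :
    μ.real (Icc 0 (N * h)) = (∑ i ∈ Finset.Icc 1 N, μ.real (Ioo (((i : ℝ) - 1) * h) (i * h)))
      + ∑ i ∈ Finset.Icc 0 N, μ.real {(i : ℝ) * h} := by
  induction N with
  | zero => simp
  | succ k ih =>
    have e0 : (0 : ℝ) ≤ k * h := by positivity
    have e1 : ((k + 1 : ℕ) : ℝ) * h = k * h + h := by push_cast; ring
    have e2 : (((k + 1 : ℕ) : ℝ) - 1) * h = k * h := by push_cast; ring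
    have e3 : Icc 0 (((k + 1 : ℕ) : ℝ) * h)
        = Icc 0 (k * h) ∪ (Ioo (k * h) (((k + 1 : ℕ) : ℝ) * h) ∪ {((k + 1 : ℕ) : ℝ) * h}) := by
      rw [Ioo_union_right (by linarith), Icc_union_Ioc_eq_Icc e0 (by linarith)]
    rw [e3, measureReal_union _ (measurableSet_Ioo.union (measurableSet_singleton _)),
      measureReal_union _ (measurableSet_singleton _), ih,
      Finset.sum_Icc_succ_top (by omega), Finset.sum_Icc_succ_top (by omega), e2]
    · ring
    · simp
    · rw [Ioo_union_right (by linarith)]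
      exact Set.disjoint_left.2 fun t h1 h2 => h1.2.not_gt h2.1

namespace IsImpulsiveControl

theorem sum_slotPart_univ (K : D.IsImpulsiveControl μ w) (hh : 0 < D.h) (hTN : D.T = D.N * D.h) :
    ∑ i ∈ Finset.Icc 1 D.N, (slotPart D.h μ w i).real univ = totalVariation D.T μ := by
  have := K.measure.finite
  have h0I : (0 : ℝ) ∈ Icc 0 D.h := ⟨le_rfl, hh.le⟩
  have hhI : D.h ∈ Icc 0 D.h := ⟨hh.le, le_rfl⟩
  have h1 : ∀ i ∈ Finset.Icc 1 D.N, (slotPart D.h μ w i).real univ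
      = μ.real (Ioo (((i : ℝ) - 1) * D.h) (i * D.h)) + (∫ s in (0 : ℝ)..1, w 0 i s)
        + ∫ s in (0 : ℝ)..1, w D.h i s := by
    intro i hi
    have hm : Measurable fun t : ℝ => t - ((i : ℝ) - 1) * D.h := measurable_id.sub_const _
    rw [Measure.real, slotPart, Measure.add_apply, Measure.add_apply, Measure.smul_apply,
      Measure.smul_apply, Measure.map_apply hm MeasurableSet.univ, preimage_univ,
      Measure.restrict_apply_univ, measure_univ, measure_univ, smul_eq_mul, smul_eq_mul, mul_one,
      mul_one, ENNReal.toReal_add (by finiteness) (by finiteness),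
      ENNReal.toReal_add (by finiteness) (by finiteness),
      ENNReal.toReal_ofReal (K.integral_nonneg h0I hi),
      ENNReal.toReal_ofReal (K.integral_nonneg hhI hi), Measure.real]
  have h2 : ∑ i ∈ Finset.Icc 0 D.N, μ.real {(i : ℝ) * D.h}
      = (∑ i ∈ Finset.Icc 1 D.N, ∫ s in (0 : ℝ)..1, w D.h i s)
        + ∑ i ∈ Finset.Icc 1 D.N, ∫ s in (0 : ℝ)..1, w 0 i s := by
    rw [← Finset.sum_congr rfl K.atom_mesh, Finset.sum_add_distrib]
    have e0 : Finset.Icc 0 D.N = Finset.range (D.N + 1) := by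
      ext; simp only [Finset.mem_Icc, Finset.mem_range]; omega
    have e1 : ∀ c : ℕ → ℝ, ∑ i ∈ Finset.Icc 1 D.N, c i = ∑ i ∈ Finset.range D.N, c (i + 1) := by
      intro c
      rw [Finset.range_eq_Ico, Finset.sum_Ico_add' c 0 D.N 1]
      rfl
    rw [e0, e1, e1, Finset.sum_range_succ', Finset.sum_range_succ]
    simp only [Nat.add_eq_zero_iff, one_ne_zero, and_false, if_false, if_true, add_zero]
    congr 1
    exact Finset.sum_congr rfl fun i hi => if_neg (Finset.mem_range.1 hi).ne
  rw [Finset.sum_congr rfl h1, Finset.sum_add_distrib, Finset.sum_add_distrib, totalVariation, hTN,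
    measureReal_Icc_mesh hh, h2]
  ring

end IsImpulsiveControl

end DIS

/-! ### The rates of an impulsive control -/

/-- The function equal to `G` off the plateaus of `φ` at heights in `C`, and to `Z r`, rescaled from
`[0, 1]`, on the plateau at height `r ∈ C`. -/
noncomputable def plateauFill {E : Type*} (S : ℝ) (φ : ℝ → ℝ) (C : Set ℝ) (G : ℝ → E)
    (Z : ℝ → ℝ → E) (s : ℝ) : E :=
  open scoped Classical in
  if φ s ∈ C then Z (φ s) ((s - entryTime S φ (φ s)) / (exitTime S φ (φ s) - entryTime S φ (φ s)))
  else G s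

theorem aestronglyMeasurable_comp_affine_symm {E : Type*} [TopologicalSpace E]
    [TopologicalSpace.PseudoMetrizableSpace E] {V : ℝ → E} {p c : ℝ} (hc : 0 < c)
    (hV : AEStronglyMeasurable V (volume.restrict (Icc 0 1))) :
    AEStronglyMeasurable (fun s => V ((s - p) / c)) (volume.restrict (Icc p (p + c))) :=
  ⟨fun s => hV.mk V ((s - p) / c),
    hV.stronglyMeasurable_mk.comp_measurable ((measurable_id.sub_const p).div_const c),
    ae_restrict_comp_affine_symm hc hV.ae_eq_mk⟩

theorem integral_comp_affine_symm {E : Type*} [NormedAddCommGroup E] [NormedSpace ℝ E] (V : ℝ → E)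
    (p θ : ℝ) {c : ℝ} (hc : 0 < c) :
    ∫ s in p..p + c * θ, c⁻¹ • V ((s - p) / c) = ∫ τ in (0 : ℝ)..θ, V τ := by
  have := intervalIntegral.smul_integral_comp_add_mul (a := 0) (b := θ)
    (fun s => c⁻¹ • V ((s - p) / c)) c p
  rw [mul_zero, add_zero] at this
  rw [← this, ← intervalIntegral.integral_smul]
  refine intervalIntegral.integral_congr fun τ _ => ?_
  simp only [add_sub_cancel_left, mul_div_cancel_left₀ τ hc.ne', smul_inv_smul₀ hc.ne']

section plateauFill

variable {E : Type*} {S h : ℝ} {φ : ℝ → ℝ} {C : Set ℝ} {G : ℝ → E} {Z : ℝ → ℝ → E} {r s : ℝ}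

theorem plateauFill_of_notMem (hs : φ s ∉ C) : plateauFill S φ C G Z s = G s := if_neg hs

theorem plateauFill_of_mem_plateau (H : IsTimeChange S h φ) (hC : C ⊆ Icc 0 h) (hr : r ∈ C)
    (hs : s ∈ Icc (entryTime S φ r) (exitTime S φ r)) : plateauFill S φ C G Z s
      = Z r ((s - entryTime S φ r) / (exitTime S φ r - entryTime S φ r)) := by
  have h1 : φ s = r := ((H.fiber_eq (hC hr)).ge hs).2
  rw [plateauFill, h1, if_pos hr]

theorem aestronglyMeasurable_plateauFill [TopologicalSpace E]
    [TopologicalSpace.PseudoMetrizableSpace E] (H : IsTimeChange S h φ) (hC : C ⊆ Icc 0 h)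
    (hCc : C.Countable) (hlt : ∀ r ∈ C, entryTime S φ r < exitTime S φ r)
    (hG : StronglyMeasurable G)
    (hZ : ∀ r ∈ C, AEStronglyMeasurable (Z r) (volume.restrict (Icc 0 1))) :
    AEStronglyMeasurable (plateauFill S φ C G Z) (volume.restrict (Icc 0 S)) := by
  refine H.aestronglyMeasurable_of_plateaus hC hCc hG (fun s _ hs => plateauFill_of_notMem hs)
    fun r hr => ?_
  have := aestronglyMeasurable_comp_affine_symm (p := entryTime S φ r) (sub_pos.2 (hlt r hr))
    (hZ r hr)
  rw [add_sub_cancel] at this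
  refine this.congr ?_
  filter_upwards [ae_restrict_mem measurableSet_Icc] with s hs
  exact (plateauFill_of_mem_plateau H hC hr hs).symm

end plateauFill

namespace DIS

variable {n : ℕ} {D : DIS n} {μ : Measure ℝ} {w : ℝ → ℕ → ℝ → ℝ}

/-- The length of the parameter interval of the reparameterized process. -/
noncomputable def parameterLength (D : DIS n) (μ : Measure ℝ) (w : ℝ → ℕ → ℝ → ℝ) : ℝ :=
  (parameterMeasure D.N D.h μ w).real univ

/-- The time change of the reparameterized process. -/
noncomputable def parameterClock (D : DIS n) (μ : Measure ℝ) (w : ℝ → ℕ → ℝ → ℝ) : ℝ → ℝ :=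
  inverseDistribution D.h (parameterMeasure D.N D.h μ w)

/-- The times in `[0, h]` at which some slot has an impulse. -/
def impulseTimes (D : DIS n) (μ : Measure ℝ) (w : ℝ → ℕ → ℝ → ℝ) : Set ℝ :=
  {r | parameterMeasure D.N D.h μ w {r} ≠ 0}

/-- The rates of the reparameterized process: Radon-Nikodym densities off the plateaus, and the
rescaled functions `w^r_i` on them. -/
noncomputable def rate (D : DIS n) (μ : Measure ℝ) (w : ℝ → ℕ → ℝ → ℝ) (i : ℕ) : ℝ → ℝ :=
  plateauFill (D.parameterLength μ w) (D.parameterClock μ w) (D.impulseTimes μ w)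
    (fun s => ((slotPart D.h μ w i).rnDeriv (parameterMeasure D.N D.h μ w)
      (D.parameterClock μ w s)).toReal)
    (fun r τ => w r i τ / (exitTime (D.parameterLength μ w) (D.parameterClock μ w) r
      - entryTime (D.parameterLength μ w) (D.parameterClock μ w) r))

namespace IsImpulsiveControl

theorem isTimeChange (K : D.IsImpulsiveControl μ w) (hh : 0 < D.h) :
    IsTimeChange (D.parameterLength μ w) D.h (D.parameterClock μ w) := by
  have := K.measure.finite
  have := isFiniteMeasure_parameterMeasure (μ := μ) (w := w) D.N D.h
  exact isTimeChange_inverseDistribution hh (parameterMeasure_compl hh.le D.N)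
    (volume_le_parameterMeasure D.N D.h)

theorem map_parameterClock (K : D.IsImpulsiveControl μ w) (hh : 0 < D.h) :
    (volume.restrict (Icc 0 (D.parameterLength μ w))).map (D.parameterClock μ w)
      = parameterMeasure D.N D.h μ w := by
  have := K.measure.finite
  have := isFiniteMeasure_parameterMeasure (μ := μ) (w := w) D.N D.h
  exact map_inverseDistribution hh (parameterMeasure_compl hh.le D.N)
    (volume_le_parameterMeasure D.N D.h)

/-- The length of the plateau at height `r` is the total mass of the impulses at `r`. -/
theorem plateau_length (K : D.IsImpulsiveControl μ w) (hh : 0 < D.h) {r : ℝ} (hr : r ∈ Icc 0 D.h) :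
    exitTime (D.parameterLength μ w) (D.parameterClock μ w) r
      - entryTime (D.parameterLength μ w) (D.parameterClock μ w) r
      = ∑ i ∈ Finset.Icc 1 D.N, ∫ s in (0 : ℝ)..1, w r i s := by
  have := K.measure.finite
  have := isFiniteMeasure_parameterMeasure (μ := μ) (w := w) D.N D.h
  rw [← K.parameterMeasure_singleton hh hr]
  exact exitTime_sub_entryTime hh (parameterMeasure_compl hh.le D.N)
    (volume_le_parameterMeasure D.N D.h) hr

theorem impulseTimes_subset (hh : 0 < D.h) : D.impulseTimes μ w ⊆ Icc 0 D.h := by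
  intro r hr
  by_contra hr'
  exact hr (measure_mono_null (singleton_subset_iff.2 hr') (parameterMeasure_compl hh.le D.N))

theorem countable_impulseTimes (K : D.IsImpulsiveControl μ w) : (D.impulseTimes μ w).Countable := by
  have := K.measure.finite
  have := isFiniteMeasure_parameterMeasure (μ := μ) (w := w) D.N D.h
  exact (parameterMeasure D.N D.h μ w).countable_atoms

theorem entryTime_lt_exitTime_iff (K : D.IsImpulsiveControl μ w) (hh : 0 < D.h) {r : ℝ}
    (hr : r ∈ Icc 0 D.h) : entryTime (D.parameterLength μ w) (D.parameterClock μ w) r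
      < exitTime (D.parameterLength μ w) (D.parameterClock μ w) r ↔ r ∈ D.impulseTimes μ w := by
  have := K.measure.finite
  have := isFiniteMeasure_parameterMeasure (μ := μ) (w := w) D.N D.h
  rw [← sub_pos, K.plateau_length hh hr, ← K.parameterMeasure_singleton hh hr,
    measureReal_nonneg.lt_iff_ne', impulseTimes, mem_ofPred_eq, Measure.real, Ne,
    ENNReal.toReal_eq_zero_iff, not_or]
  exact ⟨fun h => h.1, fun h => ⟨h, measure_ne_top _ _⟩⟩

theorem aestronglyMeasurable_rate (K : D.IsImpulsiveControl μ w) (hh : 0 < D.h) {i : ℕ}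
    (hi : i ∈ Finset.Icc 1 D.N) : AEStronglyMeasurable (D.rate μ w i)
      (volume.restrict (Icc 0 (D.parameterLength μ w))) := by
  have H := K.isTimeChange hh
  have hC := impulseTimes_subset (μ := μ) (w := w) hh
  refine aestronglyMeasurable_plateauFill H hC K.countable_impulseTimes
    (fun r hr => (K.entryTime_lt_exitTime_iff hh (hC hr)).2 hr) ?_ fun r hr => ?_
  · exact ((Measure.measurable_rnDeriv _ _).comp H.cont.measurable).ennreal_toReal.stronglyMeasurable
  · exact ((K.measurable r (hC hr) i hi).div_const _).aestronglyMeasurable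

theorem rate_nonneg (K : D.IsImpulsiveControl μ w) (hh : 0 < D.h) {i : ℕ}
    (hi : i ∈ Finset.Icc 1 D.N) {s : ℝ} (hs : s ∈ Icc 0 (D.parameterLength μ w)) :
    0 ≤ D.rate μ w i s := by
  have H := K.isTimeChange hh
  have hC := impulseTimes_subset (μ := μ) (w := w) hh
  by_cases h : D.parameterClock μ w s ∈ D.impulseTimes μ w
  · have hm := (H.fiber_eq (hC h)).le ⟨hs, rfl⟩
    have hl := sub_pos.2 ((K.entryTime_lt_exitTime_iff hh (hC h)).2 h)
    rw [rate, plateauFill_of_mem_plateau H hC h hm]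
    exact div_nonneg (K.nonneg _ (hC h) i hi _ ⟨div_nonneg (sub_nonneg.2 hm.1) hl.le,
      (div_le_one hl).2 (by linarith [hm.2])⟩) hl.le
  · rw [rate, plateauFill_of_notMem h]
    exact ENNReal.toReal_nonneg

/-- On the plateaus the rates sum to one. -/
theorem sum_rate_eq_one (K : D.IsImpulsiveControl μ w) (hh : 0 < D.h) {r : ℝ}
    (hr : r ∈ D.impulseTimes μ w) : ∀ᵐ s ∂volume.restrict
      (Icc (entryTime (D.parameterLength μ w) (D.parameterClock μ w) r)
        (exitTime (D.parameterLength μ w) (D.parameterClock μ w) r)),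
      ∑ i ∈ Finset.Icc 1 D.N, D.rate μ w i s = 1 := by
  have H := K.isTimeChange hh
  have hC := impulseTimes_subset (μ := μ) (w := w) hh
  have hl := sub_pos.2 ((K.entryTime_lt_exitTime_iff hh (hC hr)).2 hr)
  have := ae_restrict_comp_affine_symm
    (p := entryTime (D.parameterLength μ w) (D.parameterClock μ w) r) hl (K.sum_eq r (hC hr))
  rw [add_sub_cancel] at this
  filter_upwards [this, ae_restrict_mem measurableSet_Icc] with s hs hs'
  simp only [rate, plateauFill_of_mem_plateau H hC hr hs']
  rw [← Finset.sum_div, hs, ← K.plateau_length hh (hC hr), div_self hl.ne']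

theorem slotPart_absolutelyContinuous {i : ℕ} (hi : i ∈ Finset.Icc 1 D.N) :
    slotPart D.h μ w i ≪ parameterMeasure D.N D.h μ w :=
  Measure.absolutelyContinuous_of_le (slotPart_le hi)

/-- The densities of the slot parts with respect to the parameter measure sum to at most one. -/
theorem sum_rnDeriv_le_one (K : D.IsImpulsiveControl μ w) :
    ∀ᵐ r ∂parameterMeasure D.N D.h μ w, ∑ i ∈ Finset.Icc 1 D.N,
      (slotPart D.h μ w i).rnDeriv (parameterMeasure D.N D.h μ w) r ≤ 1 := by
  have := K.measure.finite
  have := isFiniteMeasure_parameterMeasure (μ := μ) (w := w) D.N D.h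
  have hfin := fun i => isFiniteMeasure_slotPart (μ := μ) (w := w) D.h i
  refine ae_le_of_forall_setLIntegral_le_of_sigmaFinite
    (f := fun r => ∑ i ∈ Finset.Icc 1 D.N,
      (slotPart D.h μ w i).rnDeriv (parameterMeasure D.N D.h μ w) r) (g := fun _ => 1)
    (Finset.measurable_fun_sum _ fun i _ => Measure.measurable_rnDeriv _ _) fun B hB _ => ?_
  rw [lintegral_finsetSum _ fun i _ => Measure.measurable_rnDeriv _ _, setLIntegral_one,
    Finset.sum_congr rfl fun i hi =>
      Measure.setLIntegral_rnDeriv (slotPart_absolutelyContinuous hi) B]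
  conv_rhs => rw [parameterMeasure, Measure.add_apply, Measure.finsetSum_apply]
  exact le_add_self

theorem sum_rate_le_one (K : D.IsImpulsiveControl μ w) (hh : 0 < D.h) :
    ∀ᵐ s ∂volume.restrict (Icc 0 (D.parameterLength μ w)),
      ∑ i ∈ Finset.Icc 1 D.N, D.rate μ w i s ≤ 1 := by
  have H := K.isTimeChange hh
  refine H.ae_of_plateaus (impulseTimes_subset hh) K.countable_impulseTimes ?_ fun r hr => ?_
  · have h1 := K.sum_rnDeriv_le_one
    rw [← K.map_parameterClock hh] at h1
    have h2 := ae_of_ae_map H.cont.aemeasurable h1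
    rw [K.map_parameterClock hh] at h2
    filter_upwards [h2] with s hs hns
    simp only [rate, plateauFill_of_notMem hns]
    rw [← ENNReal.toReal_sum fun i hi => ((Finset.single_le_sum
      (f := fun i => (slotPart D.h μ w i).rnDeriv (parameterMeasure D.N D.h μ w)
        (D.parameterClock μ w s)) (fun _ _ => zero_le) hi).trans hs).trans_lt ENNReal.one_lt_top |>.ne]
    exact ENNReal.toReal_le_of_le_ofReal zero_le_one (by simpa using hs)
  · filter_upwards [K.sum_rate_eq_one hh hr] with s hs using hs.le

theorem rate_le_one (K : D.IsImpulsiveControl μ w) (hh : 0 < D.h) {i : ℕ}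
    (hi : i ∈ Finset.Icc 1 D.N) : ∀ᵐ s ∂volume.restrict (Icc 0 (D.parameterLength μ w)),
      ‖D.rate μ w i s‖ ≤ 1 := by
  filter_upwards [K.sum_rate_le_one hh, ae_restrict_mem measurableSet_Icc] with s hs hs'
  rw [Real.norm_of_nonneg (K.rate_nonneg hh hi hs')]
  exact (Finset.single_le_sum (f := fun j => D.rate μ w j s)
    (fun j hj => K.rate_nonneg hh hj hs') hi).trans hs

theorem integrableOn_rate (K : D.IsImpulsiveControl μ w) (hh : 0 < D.h) {i : ℕ}
    (hi : i ∈ Finset.Icc 1 D.N) : IntegrableOn (D.rate μ w i) (Icc 0 (D.parameterLength μ w)) :=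
  Integrable.of_bound (K.aestronglyMeasurable_rate hh hi) 1 (K.rate_le_one hh hi)

theorem rate_nonneg_ae (K : D.IsImpulsiveControl μ w) (hh : 0 < D.h) {i : ℕ}
    (hi : i ∈ Finset.Icc 1 D.N) : ∀ᵐ s ∂volume.restrict (Icc 0 (D.parameterLength μ w)),
      0 ≤ D.rate μ w i s := by
  filter_upwards [ae_restrict_mem measurableSet_Icc] with s hs using K.rate_nonneg hh hi hs

/-- The image under the time change of the measure `αᵢ ds` is the `i`-th slot part: off the
impulse times by the definition of the density, and at an impulse time `r` because `αᵢ` is there a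
rescaled `w^r_i`. -/
theorem map_densityMeasure_rate (K : D.IsImpulsiveControl μ w) (hh : 0 < D.h) {i : ℕ}
    (hi : i ∈ Finset.Icc 1 D.N) :
    (densityMeasure (D.parameterLength μ w) (D.rate μ w i)).map (D.parameterClock μ w)
      = slotPart D.h μ w i := by
  have := K.measure.finite
  have := isFiniteMeasure_parameterMeasure (μ := μ) (w := w) D.N D.h
  have hfin := isFiniteMeasure_slotPart (μ := μ) (w := w) D.h i
  have hdf := isFiniteMeasure_densityMeasure (K.integrableOn_rate hh hi)
  have H := K.isTimeChange hh
  have hC := impulseTimes_subset (μ := μ) (w := w) hh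
  have hCm := K.countable_impulseTimes.measurableSet
  have hφ := H.cont.measurable
  have : IsFiniteMeasure ((densityMeasure (D.parameterLength μ w) (D.rate μ w i)).map
    (D.parameterClock μ w)) := Measure.isFiniteMeasure_map _ _
  refine Measure.ext_of_countable K.countable_impulseTimes ?_ fun r hr => ?_
  · ext B hB
    have hBC := hB.inter hCm.compl
    have hrn := Measure.measurable_rnDeriv (slotPart D.h μ w i) (parameterMeasure D.N D.h μ w)
    have hlt := Measure.rnDeriv_lt_top (slotPart D.h μ w i) (parameterMeasure D.N D.h μ w)
    rw [← K.map_parameterClock hh] at hlt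
    have hlt' := ae_of_ae_map hφ.aemeasurable hlt
    rw [K.map_parameterClock hh] at hlt'
    rw [Measure.restrict_apply hB, Measure.restrict_apply hB, Measure.map_apply hφ hBC,
      densityMeasure, withDensity_apply _ (hφ hBC),
      ← Measure.setLIntegral_rnDeriv (slotPart_absolutelyContinuous hi) (B ∩ _)]
    conv_rhs => rw [← K.map_parameterClock hh]
    rw [setLIntegral_map hBC (by rwa [K.map_parameterClock hh]) hφ, K.map_parameterClock hh]
    refine lintegral_congr_ae ?_
    filter_upwards [ae_restrict_of_ae hlt', ae_restrict_mem (hφ hBC)] with s hs hs'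
    rw [rate, plateauFill_of_notMem hs'.2, ENNReal.ofReal_toReal hs.ne]
  · have hr' := hC hr
    have hl := sub_pos.2 ((K.entryTime_lt_exitTime_iff hh hr').2 hr)
    rw [← measureReal_eq_measureReal_iff, map_measureReal_apply hφ (measurableSet_singleton _),
      densityMeasure_real (K.integrableOn_rate hh hi) (K.rate_nonneg_ae hh hi)
        (hφ (measurableSet_singleton _)), inter_comm, H.fiber_eq hr', Measure.real,
      K.slotPart_singleton hh hr' hi, ENNReal.toReal_ofReal (K.integral_nonneg hr' hi),
      integral_Icc_eq_integral_Ioc, ← intervalIntegral.integral_of_le (sub_pos.1 hl).le,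
      ← integral_comp_affine_symm (w r i) (entryTime (D.parameterLength μ w)
        (D.parameterClock μ w) r) 1 hl, mul_one, add_sub_cancel]
    refine intervalIntegral.integral_congr fun s hs => ?_
    rw [uIcc_of_le (sub_pos.1 hl).le] at hs
    simp only [rate, plateauFill_of_mem_plateau H hC hr hs, smul_eq_mul, div_eq_inv_mul]

theorem integrableOn_speed (K : D.IsImpulsiveControl μ w) (hh : 0 < D.h) :
    IntegrableOn (fun s => 1 - ∑ i ∈ Finset.Icc 1 D.N, D.rate μ w i s)
      (Icc 0 (D.parameterLength μ w)) :=
  Integrable.sub (integrable_const 1)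
    (integrable_finsetSum _ fun _ hi => K.integrableOn_rate hh hi)

theorem speed_nonneg_ae (K : D.IsImpulsiveControl μ w) (hh : 0 < D.h) :
    ∀ᵐ s ∂volume.restrict (Icc 0 (D.parameterLength μ w)),
      0 ≤ 1 - ∑ i ∈ Finset.Icc 1 D.N, D.rate μ w i s := by
  filter_upwards [K.sum_rate_le_one hh] with s hs using sub_nonneg.2 hs

/-- Outside the impulses the time change runs through `[0, h]` at the speed `1 - Σ αᵢ`. -/
theorem map_densityMeasure_speed (K : D.IsImpulsiveControl μ w) (hh : 0 < D.h) :
    (densityMeasure (D.parameterLength μ w)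
      fun s => 1 - ∑ i ∈ Finset.Icc 1 D.N, D.rate μ w i s).map (D.parameterClock μ w)
      = volume.restrict (Icc 0 D.h) := by
  have := K.measure.finite
  have := isFiniteMeasure_parameterMeasure (μ := μ) (w := w) D.N D.h
  have hfin := fun i => isFiniteMeasure_slotPart (μ := μ) (w := w) D.h i
  have hdf := isFiniteMeasure_densityMeasure (K.integrableOn_speed hh)
  have H := K.isTimeChange hh
  have hφ := H.cont.measurable
  have hmf : IsFiniteMeasure ((densityMeasure (D.parameterLength μ w)
    fun s => 1 - ∑ i ∈ Finset.Icc 1 D.N, D.rate μ w i s).map (D.parameterClock μ w)) :=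
    Measure.isFiniteMeasure_map _ _
  ext B hB
  have h1 : ∀ i ∈ Finset.Icc 1 D.N,
      ∫ s in D.parameterClock μ w ⁻¹' B ∩ Icc 0 (D.parameterLength μ w), D.rate μ w i s
        = (slotPart D.h μ w i).real B := by
    intro i hi
    have := isFiniteMeasure_densityMeasure (K.integrableOn_rate hh hi)
    rw [← densityMeasure_real (K.integrableOn_rate hh hi) (K.rate_nonneg_ae hh hi) (hφ hB),
      ← map_measureReal_apply hφ hB, K.map_densityMeasure_rate hh hi]
  have h2 : volume.real (D.parameterClock μ w ⁻¹' B ∩ Icc 0 (D.parameterLength μ w))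
      = (volume.restrict (Icc 0 D.h)).real B
        + ∑ i ∈ Finset.Icc 1 D.N, (slotPart D.h μ w i).real B := by
    rw [← measureReal_restrict_apply (hφ hB), ← map_measureReal_apply hφ hB,
      K.map_parameterClock hh, Measure.real, parameterMeasure, Measure.add_apply,
      Measure.finsetSum_apply, ENNReal.toReal_add (measure_ne_top _ _)
        (ENNReal.sum_ne_top.2 fun i _ => measure_ne_top _ _),
      ENNReal.toReal_sum fun i _ => measure_ne_top _ _]
    rfl
  rw [← measureReal_eq_measureReal_iff, map_measureReal_apply hφ hB,
    densityMeasure_real (K.integrableOn_speed hh) (K.speed_nonneg_ae hh) (hφ hB),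
    integral_sub, integral_finsetSum, Finset.sum_congr rfl h1]
  · simp only [integral_const, smul_eq_mul, mul_one, measureReal_restrict_apply_univ]
    linarith
  · exact fun i hi => (K.integrableOn_rate hh hi).mono_set inter_subset_right
  · exact integrableOn_const (measure_ne_top_of_subset inter_subset_right (by simp))
  · exact integrable_finsetSum _ fun i hi =>
      (K.integrableOn_rate hh hi).mono_set inter_subset_right

theorem integral_rate (K : D.IsImpulsiveControl μ w) (hh : 0 < D.h) {i : ℕ}
    (hi : i ∈ Finset.Icc 1 D.N) :
    ∫ s in (0 : ℝ)..D.parameterLength μ w, D.rate μ w i s = (slotPart D.h μ w i).real univ := by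
  have := isFiniteMeasure_densityMeasure (K.integrableOn_rate hh hi)
  have H := K.isTimeChange hh
  rw [← K.map_densityMeasure_rate hh hi, map_measureReal_apply H.cont.measurable MeasurableSet.univ,
    densityMeasure_real (K.integrableOn_rate hh hi) (K.rate_nonneg_ae hh hi) (by simp),
    preimage_univ, univ_inter, integral_Icc_eq_integral_Ioc,
    intervalIntegral.integral_of_le H.pos.le]

theorem integral_speed (K : D.IsImpulsiveControl μ w) (hh : 0 < D.h) :
    ∫ s in (0 : ℝ)..D.parameterLength μ w, (1 - ∑ i ∈ Finset.Icc 1 D.N, D.rate μ w i s)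
      = D.h := by
  have := isFiniteMeasure_densityMeasure (K.integrableOn_speed hh)
  have H := K.isTimeChange hh
  have e : (volume.restrict (Icc 0 D.h)).real univ = D.h := by simp [hh.le]
  rw [← e, ← K.map_densityMeasure_speed hh,
    map_measureReal_apply H.cont.measurable MeasurableSet.univ,
    densityMeasure_real (K.integrableOn_speed hh) (K.speed_nonneg_ae hh) (by simp),
    preimage_univ, univ_inter, integral_Icc_eq_integral_Ioc,
    intervalIntegral.integral_of_le H.pos.le]

end IsImpulsiveControl

end DIS

/-! ### From extended to reparameterized processes -/

namespace DIS

variable {n : ℕ} {D : DIS n} {μ : Measure ℝ} {w : ℝ → ℕ → ℝ → ℝ} {x : ℝ → Vec n}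
  {ζ : ℝ → ℕ → ℝ → Vec n}

namespace IsJumpFamily

theorem continuousOn (J : D.IsJumpFamily x w ζ) {r : ℝ} (hr : r ∈ Icc 0 D.h) {i : ℕ}
    (hi : i ∈ Finset.Icc 1 D.N) : ContinuousOn (ζ r i) (Icc 0 1) := by
  have := (J.absCont r hr i hi).continuousOn
  rwa [uIcc_of_le zero_le_one] at this

theorem aestronglyMeasurable (J : D.IsJumpFamily x w ζ) {r : ℝ} (hr : r ∈ Icc 0 D.h) {i : ℕ}
    (hi : i ∈ Finset.Icc 1 D.N) :
    AEStronglyMeasurable (fun s => (ζ r i s, ζ r (i - 1) s)) (volume.restrict (Icc 0 1)) := by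
  have h1 : ∀ j ∈ Finset.Icc 1 D.N, AEStronglyMeasurable (ζ r j) (volume.restrict (Icc 0 1)) :=
    fun j hj => (J.continuousOn hr hj).aestronglyMeasurable measurableSet_Icc
  refine (h1 i hi).prodMk ?_
  rw [Finset.mem_Icc] at hi
  rcases Nat.eq_zero_or_pos (i - 1) with h0 | h0
  · refine (aestronglyMeasurable_const (b := D.ξ₀)).congr ?_
    rw [h0, Filter.EventuallyEq, ← restrict_Ico_eq_restrict_Icc]
    filter_upwards [ae_restrict_mem measurableSet_Ico] with s hs
    exact (J.zero r hr s ⟨hs.1, hs.2.le⟩ (Or.inl hs.2.ne)).symm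
  · exact h1 _ (Finset.mem_Icc.2 ⟨h0, by omega⟩)

theorem integral_eq_sub (J : D.IsJumpFamily x w ζ) (K : D.IsImpulsiveControl μ w)
    (hg : Continuous D.g) (hgb : ∃ C : ℝ, ∀ z, ‖D.g z‖ ≤ C) {r : ℝ} (hr : r ∈ Icc 0 D.h) {i : ℕ}
    (hi : i ∈ Finset.Icc 1 D.N) {θ : ℝ} (hθ : θ ∈ Icc (0 : ℝ) 1) :
    ∫ s in (0 : ℝ)..θ, w r i s • D.g (ζ r i s, ζ r (i - 1) s) = ζ r i θ - ζ r i 0 := by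
  obtain ⟨C, hC⟩ := hgb
  have hsub : uIcc 0 θ ⊆ Icc 0 1 := uIcc_subset_Icc ⟨le_rfl, zero_le_one⟩ hθ
  refine ((J.absCont r hr i hi).mono
    (by rwa [uIcc_of_le zero_le_one])).integral_eq_sub_of_ae_hasDerivAt ?_ ?_
  · have := J.ode r hr i hi
    rw [ae_restrict_iff' measurableSet_Icc] at this
    filter_upwards [this] with s hs hs' using hs (hsub hs')
  · have : IntegrableOn (fun s => w r i s • D.g (ζ r i s, ζ r (i - 1) s)) (Icc 0 1) :=
      Integrable.smul_bdd (K.integrableOn hr hi) C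
        (hg.comp_aestronglyMeasurable (J.aestronglyMeasurable hr hi))
        (Filter.Eventually.of_forall fun s => hC _)
    exact (this.mono_set hsub).intervalIntegrable

/-- Without an impulse at `r` there is no jump. -/
theorem end_eq_start (J : D.IsJumpFamily x w ζ) (K : D.IsImpulsiveControl μ w)
    (hg : Continuous D.g) (hgb : ∃ C : ℝ, ∀ z, ‖D.g z‖ ≤ C) {r : ℝ} (hr : r ∈ Icc 0 D.h)
    (h0 : ∑ j ∈ Finset.Icc 1 D.N, ∫ s' in (0 : ℝ)..1, w r j s' = 0) {i : ℕ}
    (hi : i ∈ Finset.Icc 1 D.N) : ζ r i 1 = ζ r i 0 := by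
  rw [← sub_eq_zero, ← J.integral_eq_sub K hg hgb hr hi ⟨zero_le_one, le_rfl⟩,
    intervalIntegral_congr_ae_Icc (g := fun _ => 0) zero_le_one, intervalIntegral.integral_zero]
  filter_upwards [K.ae_le hr hi] with s hs
  rw [h0] at hs
  rw [norm_le_zero_iff.1 hs, zero_smul]

end IsJumpFamily

/-- The trajectory of the reparameterized process in the `i`-th slot: `x` off the plateaus, and the
jump functions `ζ^r_i` on them. -/
noncomputable def slotCurve (D : DIS n) (μ : Measure ℝ) (w : ℝ → ℕ → ℝ → ℝ) (x : ℝ → Vec n)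
    (ζ : ℝ → ℕ → ℝ → Vec n) (i : ℕ) : ℝ → Vec n :=
  if i = 0 then fun _ => D.ξ₀ else
    plateauFill (D.parameterLength μ w) (D.parameterClock μ w) (D.impulseTimes μ w)
      (fun s => x (D.parameterClock μ w s + ((i : ℝ) - 1) * D.h)) (fun r τ => ζ r i τ)

section slotCurve

theorem slotCurve_zero : D.slotCurve μ w x ζ 0 = fun _ => D.ξ₀ := if_pos rfl

theorem slotCurve_of_mem {i : ℕ} (hi : i ∈ Finset.Icc 1 D.N) : D.slotCurve μ w x ζ i =
    plateauFill (D.parameterLength μ w) (D.parameterClock μ w) (D.impulseTimes μ w)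
      (fun s => x (D.parameterClock μ w s + ((i : ℝ) - 1) * D.h)) (fun r τ => ζ r i τ) :=
  if_neg (by have := (Finset.mem_Icc.1 hi).1; omega)

theorem aestronglyMeasurable_slotCurve (J : D.IsJumpFamily x w ζ) (K : D.IsImpulsiveControl μ w)
    (hh : 0 < D.h) (hTN : D.T = D.N * D.h) (hx : BoundedVariationOn x (Icc (-D.h) D.T)) {i : ℕ}
    (hi : i ∈ Finset.Icc 0 D.N) : AEStronglyMeasurable (D.slotCurve μ w x ζ i)
      (volume.restrict (Icc 0 (D.parameterLength μ w))) := by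
  have H := K.isTimeChange hh
  have hC := IsImpulsiveControl.impulseTimes_subset (μ := μ) (w := w) hh
  rcases Nat.eq_zero_or_pos i with rfl | h0
  · rw [slotCurve_zero]; exact aestronglyMeasurable_const
  have hi1 : i ∈ Finset.Icc 1 D.N := Finset.mem_Icc.2 ⟨h0, (Finset.mem_Icc.1 hi).2⟩
  obtain ⟨x', hx'm, hx'⟩ := hx.exists_measurable_eqOn
  rw [slotCurve_of_mem hi1]
  refine H.aestronglyMeasurable_of_plateaus hC K.countable_impulseTimes
    (G := fun s => x' (D.parameterClock μ w s + ((i : ℝ) - 1) * D.h))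
    (hx'm.comp (H.cont.measurable.add_const _)).stronglyMeasurable (fun s hs hns => ?_)
    fun r hr => ?_
  · have := mem_slot hi1 (H.mapsTo hs)
    rw [plateauFill_of_notMem hns, hx' ⟨by linarith [this.1], by rw [hTN]; exact this.2⟩]
  · have := aestronglyMeasurable_comp_affine_symm
      (p := entryTime (D.parameterLength μ w) (D.parameterClock μ w) r)
      (sub_pos.2 ((K.entryTime_lt_exitTime_iff hh (hC hr)).2 hr))
      ((J.continuousOn (hC hr) hi1).aestronglyMeasurable measurableSet_Icc)
    rw [add_sub_cancel] at this
    refine this.congr ?_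
    filter_upwards [ae_restrict_mem measurableSet_Icc] with s hs
    exact (plateauFill_of_mem_plateau (Z := fun r τ => ζ r i τ) H hC hr hs).symm

/-- On a plateau the impulsive dynamics of the reparameterized process is that of the jump
functions. -/
theorem integral_slotCurve_plateau (J : D.IsJumpFamily x w ζ) (K : D.IsImpulsiveControl μ w)
    (hh : 0 < D.h) (hg : Continuous D.g) (hgb : ∃ C : ℝ, ∀ z, ‖D.g z‖ ≤ C) {i : ℕ}
    (hi : i ∈ Finset.Icc 1 D.N) {r : ℝ} (hr : r ∈ D.impulseTimes μ w) {θ : ℝ}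
    (hθ : θ ∈ Icc (0 : ℝ) 1) :
    ∫ s in entryTime (D.parameterLength μ w) (D.parameterClock μ w) r..
        entryTime (D.parameterLength μ w) (D.parameterClock μ w) r
          + (exitTime (D.parameterLength μ w) (D.parameterClock μ w) r
            - entryTime (D.parameterLength μ w) (D.parameterClock μ w) r) * θ,
      D.rate μ w i s • D.g (D.slotCurve μ w x ζ i s, D.slotCurve μ w x ζ (i - 1) s)
      = ζ r i θ - ζ r i 0 := by
  have H := K.isTimeChange hh
  have hC := IsImpulsiveControl.impulseTimes_subset (μ := μ) (w := w) hh
  have hl := sub_pos.2 ((K.entryTime_lt_exitTime_iff hh (hC hr)).2 hr)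
  rw [← J.integral_eq_sub K hg hgb (hC hr) hi hθ, ← integral_comp_affine_symm
    (fun s => w r i s • D.g (ζ r i s, ζ r (i - 1) s))
    (entryTime (D.parameterLength μ w) (D.parameterClock μ w) r) θ hl]
  refine intervalIntegral_congr_ae_Icc (le_add_of_nonneg_right (mul_nonneg hl.le hθ.1)) ?_
  rw [Filter.EventuallyEq, ← restrict_Ico_eq_restrict_Icc]
  filter_upwards [ae_restrict_mem measurableSet_Ico] with s hs
  have hle := mul_le_of_le_one_right hl.le hθ.2
  have hs' : s ∈ Icc (entryTime (D.parameterLength μ w) (D.parameterClock μ w) r)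
      (exitTime (D.parameterLength μ w) (D.parameterClock μ w) r) :=
    ⟨hs.1, by linarith [hs.2]⟩
  have h3 : D.slotCurve μ w x ζ (i - 1) s = ζ r (i - 1)
      ((s - entryTime (D.parameterLength μ w) (D.parameterClock μ w) r)
        / (exitTime (D.parameterLength μ w) (D.parameterClock μ w) r
          - entryTime (D.parameterLength μ w) (D.parameterClock μ w) r)) := by
    rcases Nat.eq_zero_or_pos (i - 1) with h0 | h0
    · have h4 : (s - entryTime (D.parameterLength μ w) (D.parameterClock μ w) r)
        / (exitTime (D.parameterLength μ w) (D.parameterClock μ w) r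
          - entryTime (D.parameterLength μ w) (D.parameterClock μ w) r) < 1 :=
        (div_lt_one hl).2 (by linarith [hs.2])
      rw [h0, slotCurve_zero, J.zero r (hC hr) _
        ⟨div_nonneg (sub_nonneg.2 hs.1) hl.le, h4.le⟩ (Or.inl h4.ne)]
    · rw [slotCurve_of_mem
        (Finset.mem_Icc.2 ⟨h0, (Nat.sub_le _ _).trans (Finset.mem_Icc.1 hi).2⟩),
        plateauFill_of_mem_plateau H hC hr hs']
  rw [h3, slotCurve_of_mem hi, rate, plateauFill_of_mem_plateau H hC hr hs',
    plateauFill_of_mem_plateau H hC hr hs', div_eq_inv_mul, mul_smul]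

end slotCurve

/-- Every extended process comes from a reparameterized process. The parameter is the distribution
function of Lebesgue measure plus all the impulses. The curves are defined as integrals of the
right-hand side along the slot curves; the trajectory formula identifies them with the slot
curves at exit times, hence, by left limits, at entry times, and the jump equations do so on the
plateaus. -/
theorem IsExtended.exists_isReparameterized (X : D.IsExtended x μ w)
    (hh : 0 < D.h) (hN : 0 < D.N) (hTN : D.T = D.N * D.h)
    (hf : Continuous D.f) (hg : Continuous D.g)
    (hfb : ∃ C : ℝ, ∀ z, ‖D.f z‖ ≤ C) (hgb : ∃ C : ℝ, ∀ z, ‖D.g z‖ ≤ C) :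
    ∃ (S : ℝ) (y : ℕ → ℝ → Vec n) (α : ℕ → ℝ → ℝ), D.IsReparameterized S y α ∧
      y D.N S = x D.T ∧
      totalVariation D.T μ = ∑ i ∈ Finset.Icc 1 D.N, ∫ s in (0 : ℝ)..S, α i s := by
  obtain ⟨ζ, J, Tr⟩ := X.trajectory
  have K := X.control
  have := K.measure.finite
  have H := K.isTimeChange hh
  have hC := IsImpulsiveControl.impulseTimes_subset (μ := μ) (w := w) hh
  have hCc := K.countable_impulseTimes
  have hlt := fun r (hr : r ∈ Icc 0 D.h) => K.entryTime_lt_exitTime_iff hh hr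
  have hlen := fun r (hr : r ∈ Icc 0 D.h) => K.plateau_length hh hr
  have hplat := fun i (hi : i ∈ Finset.Icc 1 D.N) r (hr : r ∈ D.impulseTimes μ w) θ
    (hθ : θ ∈ Icc (0 : ℝ) 1) => integral_slotCurve_plateau J K hh hg hgb hi hr hθ
  set S := D.parameterLength μ w with hS
  set φ := D.parameterClock μ w with hφ
  set C := D.impulseTimes μ w with hCdef
  set α := D.rate μ w with hα
  set c := D.slotCurve μ w x ζ with hc
  have h0I : (0 : ℝ) ∈ Icc 0 D.h := ⟨le_rfl, hh.le⟩
  have hhI : D.h ∈ Icc 0 D.h := ⟨hh.le, le_rfl⟩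
  have hpred : ∀ i ∈ Finset.Icc 1 D.N, i - 1 ∈ Finset.Icc 0 D.N := fun i hi =>
    Finset.mem_Icc.2 ⟨Nat.zero_le _, (Nat.sub_le _ _).trans (Finset.mem_Icc.1 hi).2⟩
  have hYm : ∀ i ∈ Finset.Icc 1 D.N,
      AEStronglyMeasurable (fun s => (c i s, c (i - 1) s)) (volume.restrict (Icc 0 S)) :=
    fun i hi => (aestronglyMeasurable_slotCurve J K hh hTN X.bv
        (Finset.Icc_subset_Icc_left zero_le_one hi)).prodMk
      (aestronglyMeasurable_slotCurve J K hh hTN X.bv (hpred i hi))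
  -- The right-hand side of the reparameterized system along the slot curves.
  set R : ℕ → ℝ → Vec n := fun i s =>
    (1 - ∑ j ∈ Finset.Icc 1 D.N, α j s) • D.f (c i s, c (i - 1) s)
      + α i s • D.g (c i s, c (i - 1) s) with hR
  have hRi : ∀ i ∈ Finset.Icc 1 D.N, IntegrableOn (R i) (Icc 0 S) := by
    intro i hi
    obtain ⟨Cf, hCf⟩ := id hfb
    obtain ⟨Cg, hCg⟩ := id hgb
    exact (Integrable.smul_bdd (K.integrableOn_speed hh) Cf
        (hf.comp_aestronglyMeasurable (hYm i hi)) (Filter.Eventually.of_forall fun s => hCf _)).add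
      (Integrable.smul_bdd (K.integrableOn_rate hh hi) Cg
        (hg.comp_aestronglyMeasurable (hYm i hi)) (Filter.Eventually.of_forall fun s => hCg _))
  have hRint : ∀ i ∈ Finset.Icc 1 D.N, ∀ p ∈ Icc 0 S, ∀ q ∈ Icc 0 S,
      IntervalIntegrable (R i) volume p q := fun i hi p hp q hq =>
    ((hRi i hi).mono_set (uIcc_subset_Icc hp hq)).intervalIntegrable
  set F : ℕ → ℝ → Vec n := fun i s => ζ 0 i 0 + ∫ u in (0 : ℝ)..s, R i u with hF
  have h0S : (0 : ℝ) ∈ Icc 0 S := ⟨le_rfl, H.pos.le⟩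
  have hFsub : ∀ i ∈ Finset.Icc 1 D.N, ∀ p ∈ Icc 0 S, ∀ q ∈ Icc 0 S,
      F i q - F i p = ∫ u in p..q, R i u := by
    intro i hi p hp q hq
    rw [hF, add_sub_add_left_eq_sub, intervalIntegral.integral_interval_sub_left
      (hRint i hi 0 h0S q hq) (hRint i hi 0 h0S p hp)]
  have hAC : ∀ i ∈ Finset.Icc 1 D.N, AbsolutelyContinuousOnInterval (F i) 0 S := by
    intro i hi
    refine (hRint i hi 0 h0S S ⟨H.pos.le, le_rfl⟩).absolutelyContinuousOnInterval_integral.of_dist_le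
      fun s _ t _ => ?_
    simp only [hF, dist_add_left, le_refl]
  have hFc : ∀ i ∈ Finset.Icc 1 D.N, ContinuousOn (F i) (Icc 0 S) := fun i hi => by
    have := (hAC i hi).continuousOn
    rwa [uIcc_of_le H.pos.le] at this
  have hRplat : ∀ i, ∀ r ∈ C, ∀ᵐ s ∂volume.restrict (Icc (entryTime S φ r) (exitTime S φ r)),
      R i s = α i s • D.g (c i s, c (i - 1) s) := by
    intro i r hr
    filter_upwards [K.sum_rate_eq_one hh hr] with s hs
    simp only [hR]
    rw [← hα] at hs
    rw [hs, sub_self, zero_smul, zero_add]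
  have hFplat : ∀ i ∈ Finset.Icc 1 D.N, ∀ r ∈ C, ∀ θ ∈ Icc (0 : ℝ) 1,
      F i (entryTime S φ r + (exitTime S φ r - entryTime S φ r) * θ) - F i (entryTime S φ r)
        = ζ r i θ - ζ r i 0 := by
    intro i hi r hr θ hθ
    have hl := sub_pos.2 ((hlt r (hC hr)).2 hr)
    have hle : exitTime S φ r ≤ S := (H.exitTime_mem (hC hr)).1.2
    have h1 := mul_nonneg hl.le hθ.1
    have h2 := mul_le_of_le_one_right hl.le hθ.2
    have h3 := (H.entryTime_mem (hC hr)).1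
    rw [hFsub i hi _ h3 _ ⟨by linarith [h3.1], by linarith⟩, ← hplat i hi r hr θ hθ]
    refine intervalIntegral_congr_ae_Icc (by linarith) ?_
    exact ae_restrict_of_ae_restrict_of_subset (Icc_subset_Icc_right (by linarith)) (hRplat i r hr)
  -- The jump at the time `r`, trivial if there is no impulse.
  have hnojump : ∀ i ∈ Finset.Icc 1 D.N, ∀ r ∈ Icc 0 D.h, r ∉ C →
      entryTime S φ r = exitTime S φ r ∧ ζ r i 1 = ζ r i 0 := by
    intro i hi r hr hrC
    have h1 : entryTime S φ r = exitTime S φ r :=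
      le_antisymm (H.entryTime_le_exitTime hr) (not_lt.1 fun h => hrC ((hlt r hr).1 h))
    refine ⟨h1, J.end_eq_start K hg hgb hr ?_ hi⟩
    rw [← hlen r hr, h1, sub_self]
  have hjump : ∀ i ∈ Finset.Icc 1 D.N, ∀ r ∈ Icc 0 D.h,
      F i (exitTime S φ r) - F i (entryTime S φ r) = ζ r i 1 - ζ r i 0 := by
    intro i hi r hr
    by_cases hrC : r ∈ C
    · have := hFplat i hi r hrC 1 ⟨zero_le_one, le_rfl⟩
      rwa [mul_one, add_sub_cancel] at this
    · obtain ⟨h1, h2⟩ := hnojump i hi r hr hrC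
      rw [h1, h2, sub_self, sub_self]
  have hjump' : ∀ i ∈ Finset.Icc 1 D.N, ∀ r ∈ Icc 0 D.h,
      ∫ s in entryTime S φ r..exitTime S φ r, α i s • D.g (c i s, c (i - 1) s)
        = ζ r i 1 - ζ r i 0 := by
    intro i hi r hr
    by_cases hrC : r ∈ C
    · have := hplat i hi r hrC 1 ⟨zero_le_one, le_rfl⟩
      rwa [mul_one, add_sub_cancel] at this
    · obtain ⟨h1, h2⟩ := hnojump i hi r hr hrC
      rw [h1, h2, sub_self, intervalIntegral.integral_same]
  have hF00 : ∀ i, F i 0 = ζ 0 i 0 := fun i => by simp [hF]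
  have hFexit0 : ∀ i ∈ Finset.Icc 1 D.N, F i (exitTime S φ 0) = ζ 0 i 1 := by
    intro i hi
    have := hjump i hi 0 h0I
    rw [H.entryTime_zero, hF00] at this
    exact sub_left_injective this
  have hcx : ∀ i ∈ Finset.Icc 1 D.N, ∀ s, φ s ∉ C → c i s = x (φ s + ((i : ℝ) - 1) * D.h) := by
    intro i hi s hs
    rw [hc, slotCurve_of_mem hi, plateauFill_of_notMem hs]
  -- The trajectory formula: the curves follow `x` at exit times.
  have hFexit : ∀ i ∈ Finset.Icc 1 D.N, ∀ r ∈ Ioo 0 D.h,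
      x (r + ((i : ℝ) - 1) * D.h) = F i (exitTime S φ r) := by
    intro i hi r hr
    have ha := mem_slot hi h0I
    have haT := mem_slot hi hhI
    have e : ((i : ℝ) - 1) * D.h + D.h = i * D.h := by ring
    have er : r + ((i : ℝ) - 1) * D.h - ((i : ℝ) - 1) * D.h = r := add_sub_cancel_right _ _
    have ht : r + ((i : ℝ) - 1) * D.h ∈ Ioo (((i : ℝ) - 1) * D.h) ((i : ℝ) * D.h) :=
      ⟨by linarith [hr.1], by linarith [hr.2]⟩
    have hmap : ((densityMeasure S (α i)).map (fun s => φ s + ((i : ℝ) - 1) * D.h)).restrict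
        (Ioo (((i : ℝ) - 1) * D.h) (((i : ℝ) - 1) * D.h + D.h))
        = μ.restrict (Ioo (((i : ℝ) - 1) * D.h) (((i : ℝ) - 1) * D.h + D.h)) := by
      rw [e, ← slotPart_restrict (μ := μ) (w := w), ← K.map_densityMeasure_rate hh hi, Measure.map_map
        (measurable_add_const _) H.cont.measurable]
      rfl
    have key := hasSum_jumps hf hg hfb hgb H X.bv (μ := μ) (a := ((i : ℝ) - 1) * D.h)
      (by simpa using ha.1) (by rw [hTN]; linarith [haT.2]) (K.integrableOn_rate hh hi)
      (K.rate_nonneg_ae hh hi) (K.integrableOn_speed hh) (K.speed_nonneg_ae hh) hmap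
      (K.map_densityMeasure_speed hh) (hYm i hi) ?_ (t := r + ((i : ℝ) - 1) * D.h)
      (by rw [e]; exact ht)
    · have h1 : ∀ r' : Ioc 0 (r + ((i : ℝ) - 1) * D.h - ((i : ℝ) - 1) * D.h),
          ∫ s in entryTime S φ r'..exitTime S φ r', α i s • D.g (c i s, c (i - 1) s)
            = ζ r' i 1 - Function.leftLim x (r' + ((i : ℝ) - 1) * D.h) := by
        intro r'
        have hr' : (r' : ℝ) ∈ Ioc 0 D.h := ⟨r'.2.1, by linarith [r'.2.2, hr.2]⟩
        rw [hjump' i hi r' (Ioc_subset_Icc_self hr'), J.init r' hr' i hi]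
      have h2 := key.tsum_eq
      rw [tsum_congr h1] at h2
      rw [Tr.interior i hi _ ht, h2, er, ← hFexit0 i hi]
      have h3 := hFsub i hi _ (H.exitTime_mem h0I).1 _
        (H.exitTime_mem (Ioo_subset_Icc_self hr)).1
      simp only [hR] at h3
      rw [← h3]
      abel
    · intro s hs hφs heq
      have hns : φ s ∉ C := fun h => ((hlt _ (hC h)).2 h).ne heq
      rw [hcx i hi s hns]
      congr 1
      rcases Nat.eq_zero_or_pos (i - 1) with h0 | h0
      · have hi1 : i = 1 := by have := (Finset.mem_Icc.1 hi).1; omega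
        rw [h0, hc, slotCurve_zero, Tr.history]
        rw [hi1]; push_cast
        constructor <;> linarith [hφs.1, hφs.2]
      · rw [hcx (i - 1)
          (Finset.mem_Icc.2 ⟨h0, (Nat.sub_le _ _).trans (Finset.mem_Icc.1 hi).2⟩) s hns,
          Nat.cast_sub (Finset.mem_Icc.1 hi).1]
        congr 1; push_cast; ring
  have hFentry : ∀ i ∈ Finset.Icc 1 D.N, ∀ r ∈ Icc 0 D.h, F i (entryTime S φ r) = ζ r i 0 := by
    intro i hi r hr
    rcases hr.1.eq_or_lt with h0 | h0
    · rw [← h0, H.entryTime_zero, hF00]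
    · rw [J.init r ⟨h0, hr.2⟩ i hi, H.leftLim_eq (hFc i hi) (hFexit i hi) ⟨h0, hr.2⟩]
  have hFS : ∀ i ∈ Finset.Icc 1 D.N, F i S = ζ D.h i 1 := by
    intro i hi
    have := hjump i hi D.h hhI
    rw [hFentry i hi D.h hhI, H.exitTime_top] at this
    exact sub_left_injective this
  have hFeq : ∀ i ∈ Finset.Icc 1 D.N, ∀ s ∈ Ioo 0 S, F i s = c i s := by
    intro i hi s hs
    have hsI := Ioo_subset_Icc_self hs
    have hφI := H.mapsTo hsI
    have hm := (H.fiber_eq hφI).le ⟨hsI, rfl⟩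
    by_cases hsC : φ s ∈ C
    · have hl := sub_pos.2 ((hlt _ hφI).2 hsC)
      have h1 := hFplat i hi (φ s) hsC
        ((s - entryTime S φ (φ s)) / (exitTime S φ (φ s) - entryTime S φ (φ s)))
        ⟨div_nonneg (sub_nonneg.2 hm.1) hl.le, (div_le_one hl).2 (by linarith [hm.2])⟩
      rw [mul_div_cancel₀ _ hl.ne', add_sub_cancel, hFentry i hi _ hφI] at h1
      rw [sub_left_injective h1, hc, slotCurve_of_mem hi,
        plateauFill_of_mem_plateau H hC hsC hm]
    · have heq := (hnojump i hi _ hφI hsC).1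
      have hse : exitTime S φ (φ s) = s := le_antisymm (heq ▸ hm.1) hm.2
      have hne : φ s ∈ Ioo 0 D.h := by
        refine ⟨hφI.1.lt_of_ne fun h => ?_, hφI.2.lt_of_ne fun h => ?_⟩
        · rw [← h, ← (hnojump i hi 0 h0I (h ▸ hsC)).1, H.entryTime_zero] at hse
          exact hs.1.ne hse
        · rw [h, H.exitTime_top] at hse
          exact hs.2.ne' hse
      rw [hcx i hi s hsC, hFexit i hi _ hne, hse]
  set y : ℕ → ℝ → Vec n := fun i =>
    if i = 0 then fun s => if s = S then D.x₀ else D.ξ₀ else F i with hy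
  have hyF : ∀ i ∈ Finset.Icc 1 D.N, y i = F i := fun i hi =>
    if_neg (by have := (Finset.mem_Icc.1 hi).1; omega)
  have hyc : ∀ i ∈ Finset.Icc 0 D.N, ∀ s ∈ Ioo 0 S, y i s = c i s := by
    intro i hi s hs
    rcases Nat.eq_zero_or_pos i with rfl | h0
    · rw [hc, slotCurve_zero]; simp [hy, hs.2.ne]
    · have hi1 : i ∈ Finset.Icc 1 D.N := Finset.mem_Icc.2 ⟨h0, (Finset.mem_Icc.1 hi).2⟩
      rw [hyF i hi1, hFeq i hi1 s hs]
  refine ⟨S, y, α, ⟨H.pos, fun i hi => memLp_top_of_bound (K.aestronglyMeasurable_rate hh hi) 1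
    (K.rate_le_one hh hi), fun i hi => by rw [hyF i hi]; exact hAC i hi, fun i hi => ?_,
    fun i hi => K.rate_nonneg_ae hh hi, K.sum_rate_le_one hh, fun s hs => by simp [hy, hs.2.ne],
    by simp [hy], fun i hi => ?_, K.integral_speed hh⟩, ?_, ?_⟩
  · have h1 := (hRint i hi 0 h0S S ⟨H.pos.le, le_rfl⟩).ae_hasDerivAt_integral
    rw [← restrict_Ioo_eq_restrict_Icc]
    filter_upwards [ae_restrict_of_ae h1, ae_restrict_mem measurableSet_Ioo] with s hs hs'
    rw [hyc i (Finset.Icc_subset_Icc_left zero_le_one hi) s hs', hyc _ (hpred i hi) s hs',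
      hyF i hi]
    exact (hs (by rw [uIcc_of_le H.pos.le]; exact Ioo_subset_Icc_self hs') 0
      left_mem_uIcc).const_add _
  · have hi1 : i + 1 ∈ Finset.Icc 1 D.N :=
      Finset.mem_Icc.2 ⟨by omega, Finset.mem_range.1 hi⟩
    rw [hyF _ hi1, hF00, J.init_zero _ hi1, Nat.add_sub_cancel]
    rcases Nat.eq_zero_or_pos i with rfl | h0
    · simp [hy, J.zero_end]
    · have hi0 : i ∈ Finset.Icc 1 D.N := Finset.mem_Icc.2 ⟨h0, (Finset.mem_range.1 hi).le⟩
      rw [hyF i hi0, hFS i hi0]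
  · have hNN : D.N ∈ Finset.Icc 1 D.N := Finset.mem_Icc.2 ⟨hN, le_rfl⟩
    rw [hyF _ hNN, hFS _ hNN, Tr.at_end]
  · rw [← K.sum_slotPart_univ hh hTN]
    exact Finset.sum_congr rfl fun i hi => (K.integral_rate hh hi).symm

end DIS

theorem theorem3p3 {n : ℕ} (D : DIS n)
    (hh : 0 < D.h) (hT : 0 < D.T) (hN : 0 < D.N) (hTN : D.T = D.N * D.h)
    (hf : ContDiff ℝ 1 D.f) (hg : ContDiff ℝ 1 D.g)
    (hfb : ∃ C : ℝ, ∀ z, ‖D.f z‖ ≤ C) (hgb : ∃ C : ℝ, ∀ z, ‖D.g z‖ ≤ C) :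
    (∀ (S : ℝ) (y : ℕ → ℝ → Vec n) (α : ℕ → ℝ → ℝ), D.IsReparameterized S y α →
      ∃ (x : ℝ → Vec n) (μ : MeasureTheory.Measure ℝ) (w : ℝ → ℕ → ℝ → ℝ),
        D.IsExtended x μ w ∧ x D.T = y D.N S ∧
        DIS.totalVariation D.T μ = ∑ i ∈ Finset.Icc 1 D.N, ∫ s in (0 : ℝ)..S, α i s) ∧
    (∀ (x : ℝ → Vec n) (μ : MeasureTheory.Measure ℝ) (w : ℝ → ℕ → ℝ → ℝ),
      D.IsExtended x μ w →
      ∃ (S : ℝ) (y : ℕ → ℝ → Vec n) (α : ℕ → ℝ → ℝ), D.IsReparameterized S y α ∧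
        y D.N S = x D.T ∧
        DIS.totalVariation D.T μ = ∑ i ∈ Finset.Icc 1 D.N, ∫ s in (0 : ℝ)..S, α i s) := by
  refine ⟨fun S y α P => ?_, fun x μ w X =>
    X.exists_isReparameterized hh hN hTN hf.continuous hg.continuous hfb hgb⟩
  obtain ⟨β, A, Q, hβ⟩ := P.exists_isRateFamily
  rw [← Finset.sum_congr rfl hβ]
  exact Q.exists_isExtended A hh hN hTN hf.continuous hg.continuous hfb hgb
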